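/- **Setting.** Let $\Theta$ be a finite or countable set (with the discrete $\sigma$-algebra), enumerated as $\{k_1,k_2,\dots\}$, and let $E=\Theta\times\mathbb R^d$, with generic element $x=(\theta,\nu)$. Let $\lambda:E\to\,]0,\infty[$ be measurable with $\lambda\le\lambda^*$ for a constant $\lambda^*<\infty$, and let $Q$ be a Markov kernel from $E$ to $\Theta$, extended to a kernel on $E$ by $Q(x,A\times B)=Q(x,A)\,\delta_\nu(B)$ for $x=(\theta,\nu)$. For $x\in E$ and $u\in[0,1]$ let $H(x,u)$ be the element $k_i$ with $a_{i-1}(x)<u\le a_i(x)$, where $a_i(x)=\sum_{j\le i}Q(x,\{k_j\})$, $a_0=0$ (the value of $H(x,\cdot)$ on the remaining null set is irrelevant). For $\theta\in\Theta$ let $f_\theta:\mathbb R^d\to\mathbb R^d$ be bounded and Lipschitz with a constant independent of $\theta$; write $f(x)=f_\theta(\nu)$. On a probability space let $(T^*_k)_{k\ge1}$ be the successive jump times of a homogeneous Poisson process with intensity $\lambda^*$ (all of whose paths are counting paths, so that $0=T_0^*<T_1^*<T_2^*<\cdots\to\infty$), and let $(U_k)_{k\ge1}$, $(V_k)_{k\ge1}$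 be two sequences of i.i.d. random variables, uniform on $[0,1]$; the three sequences are independent. For a family of functions $\Phi_\theta:\mathbb R_+\times\mathbb R^d\to\mathbb R^d$ and $x=(\theta_0,\nu_0)\in E$, the *PDP with flow $\Phi$ started at $x$* is constructed as follows: $\tau_0=0$, $T_0=0$ and, for $n\ge1$, $$\tau_n=\inf\{k>\tau_{n-1}:\ U_k\lambda^*\le\lambda(\theta_{n-1},\Phi_{\theta_{n-1}}(T^*_k-T_{n-1},\nu_{n-1}))\},\qquad T_n=T^*_{\tau_n},$$ $$\nu_n=\Phi_{\theta_{n-1}}(T_n-T_{n-1},\nu_{n-1}),\qquad \theta_n=H((\theta_{n-1},\nu_n),V_n),$$ where $\inf\emptyset=\infty$ and $T_n=\infty$ (no further jump) if $\tau_n=\infty$. The process is $x_t=(\theta_n,\Phi_{\theta_n}(t-T_n,\nu_n))$ for $t\in[T_n,T_{n+1}[$, and $x_{s-}$ denotes its left limit at $s$. Its jump measure is $p([0,t]\times A)=\sum_{n\ge1}\mathbf 1_{T_n\le t}\mathbf 1_{(\theta_n,\nu_n)\in A}$; put $p'([0,t]\times A)=\int_0^t\lambda(x_s)Q(x_s,A)\,ds$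 and $q=p-p'$. Let $\mathcal F^p_t$ be the $\sigma$-algebra generated by the variables $p([0,s]\times A)$, $s\le t$, $A\in\mathcal B(E)$. Let $(x_t)$ be the PDP started at $x$ whose flow is $\phi_\theta(t,\nu)$, the solution at time $t$ of $y'=f_\theta(y)$, $y(0)=\nu$ (this is the PDMP). For $h>0$, let $(\overline x_t)$, with jump times $\overline T_n$ and measures $\overline p,\overline p',\overline q$, be the PDP started at the same $x$ and driven by the same noise, whose flow is the Euler polygon $\overline\phi_\theta(t,\nu)=\overline y_i+(t-ih)f_\theta(\overline y_i)$ for $t\in[ih,(i+1)h]$, where $\overline y_0=\nu$, $\overline y_{i+1}=\overline y_i+hf_\theta(\overline y_i)$. Put $\overline\eta(s)=\overline T_n+kh$ if $s\in[\overline T_n+kh,(\overline T_n+(k+1)h)\wedge\overline T_{n+1}[$. For $g:\mathbb R_+\times E\to\mathbb R$ define $$\mathcal Sg(t,x)=\lambda(x)\int_E(g(t,y)-g(t,x))\,Q(x,dy),$$ $$\mathcal Ag(t,x)=\partial_tg(t,x)+f(x)\cdot\partial_\nu g(t,x)+\mathcal Sg(t,x),\qquad \overline{\mathcal A}g(t,x,y)=\partial_tg(t,x)+f(y)\cdot\partial_\nu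 g(t,x)+\mathcal Sg(t,x).$$ **Theorem (Itô formulas).** Let $g:\mathbb R_+\times E\to\mathbb R$ be bounded and such that $(t,\nu)\mapsto g(t,\theta,\nu)$ is continuously differentiable for every $\theta\in\Theta$, with $\partial_tg$ and $\partial_\nu g$ bounded on $\mathbb R_+\times E$. Then for all $t\ge0$ $$g(t,x_t)=g(0,x)+\int_0^t\mathcal Ag(s,x_s)\,ds+M^g_t,\qquad M^g_t:=\int_0^t\int_E\big(g(s,y)-g(s,x_{s-})\big)\,q(ds\,dy),$$ $$g(t,\overline x_t)=g(0,x)+\int_0^t\overline{\mathcal A}g(s,\overline x_s,\overline x_{\overline\eta(s)})\,ds+\overline M^g_t,\qquad \overline M^g_t:=\int_0^t\int_E\big(g(s,y)-g(s,\overline x_{s-})\big)\,\overline q(ds\,dy),$$ where all the integrals converge absolutely, $(M^g_t)_{t\ge0}$ is a true $(\mathcal F^p_t)$-martingale and $(\overline M^g_t)_{t\ge0}$ is a true $(\mathcal F^{\overline p}_t)$-martingale. -/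

import Mathlib

open MeasureTheory ProbabilityTheory Filter Topology Set
open scoped NNReal ENNReal

noncomputable section

namespace PDMP

/-- The state space `E = Θ × ℝ^d`; a state is `x = (θ, ν)`. -/
abbrev State (Θ : Type*) (d : ℕ) : Type _ := Θ × EuclideanSpace ℝ (Fin d)

/-- A family of functions `Φ_θ : ℝ₊ × ℝ^d → ℝ^d`, written `Φ θ t ν`; only `t ≥ 0` is used. -/
abbrev FlowFamily (Θ : Type*) (d : ℕ) : Type _ :=
  Θ → ℝ → EuclideanSpace ℝ (Fin d) → EuclideanSpace ℝ (Fin d)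

/-- The jump characteristics: a measurable rate `λ : E → ]0, ∞[` bounded by a constant `λ*`, a
transition measure `Q(x, dθ)` from `E` to `Θ`, and an enumeration of the finite or countable set
`Θ` (the point `k_i` of rank `i` comes before the point `k_j` of rank `j` when `i < j`). -/
structure JumpCharacteristics (Θ : Type*) (d : ℕ) [MeasurableSpace Θ] where
  rate : State Θ d → ℝ
  measurable_rate : Measurable rate
  rate_pos : ∀ x, 0 < rate x
  bound : ℝ
  rate_le_bound : ∀ x, rate x ≤ bound
  Q : Kernel (State Θ d) Θ
  isMarkovKernel_Q : IsMarkovKernel Q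
  rank : Θ → ℕ
  rank_injective : Function.Injective rank

/-- One realisation of the driving noise: the points `T*_k` (`k ≥ 0`, `T*_0 = 0`) of the Poisson
process and the uniform variables `U_k`, `V_k` (`k ≥ 1`; `U 0` and `V 0` are never used). -/
structure NoisePath where
  T : ℕ → ℝ
  U : ℕ → ℝ
  V : ℕ → ℝ

/-- `W` is the driving noise of the thinning construction under `P`: `(T*_k)` are the successive
jump times of a homogeneous Poisson process of intensity `lamStar` (a counting process that is
finite at all times, with unit jumps, and whose waiting times are i.i.d. exponential), `(U_k)` and
`(V_k)` are i.i.d. uniform on `[0,1]`, and the three families are independent. -/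
structure IsThinningNoise {Ω : Type*} [MeasurableSpace Ω] (P : Measure Ω) (lamStar : ℝ)
    (W : Ω → NoisePath) : Prop where
  T_zero : ∀ ω, (W ω).T 0 = 0
  T_strictMono : ∀ ω, StrictMono (W ω).T
  T_tendsto : ∀ ω, Tendsto (W ω).T atTop atTop
  measurable_T : ∀ k, Measurable fun ω => (W ω).T (k + 1)
  measurable_U : ∀ k, Measurable fun ω => (W ω).U (k + 1)
  measurable_V : ∀ k, Measurable fun ω => (W ω).V (k + 1)
  law_T : ∀ k, HasLaw (fun ω => (W ω).T (k + 1) - (W ω).T k) (expMeasure lamStar) P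
  law_U : ∀ k, HasLaw (fun ω => (W ω).U (k + 1)) (volume.restrict (Icc (0 : ℝ) 1)) P
  law_V : ∀ k, HasLaw (fun ω => (W ω).V (k + 1)) (volume.restrict (Icc (0 : ℝ) 1)) P
  indep : iIndepFun
    (fun (i : Fin 3 × ℕ) (ω : Ω) =>
      (![(W ω).T (i.2 + 1) - (W ω).T i.2, (W ω).U (i.2 + 1), (W ω).V (i.2 + 1)] i.1 : ℝ)) P

section Construction

variable {Θ : Type*} {d : ℕ} [MeasurableSpace Θ]

/-- The transition measure on `E`, `Q(x, A × B) = Q(x, A) δ_ν(B)` for `x = (θ, ν)`. -/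
def JumpCharacteristics.QE (C : JumpCharacteristics Θ d) (x : State Θ d) : Measure (State Θ d) :=
  (C.Q x).map fun θ => (θ, x.2)

open Classical in
/-- The generalised inverse `H(x, u)` of the distribution function of `Q(x, ·)`: the point `k_i`
of `Θ` with `a_{i-1}(x) < u ≤ a_i(x)`, where `a_i(x) = Q(x, {k_1, …, k_i})`. There is at most one
such point; if there is none (a null event for uniform `u`) the `Θ`-component is left as is. -/
def JumpCharacteristics.H (C : JumpCharacteristics Θ d) (x : State Θ d) (u : ℝ) : Θ :=
  if h : ∃ θ, (C.Q x).real {j | C.rank j < C.rank θ} < u ∧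
      u ≤ (C.Q x).real {j | C.rank j ≤ C.rank θ}
  then h.choose else x.1

variable (C : JumpCharacteristics Θ d) (Φ : FlowFamily Θ d) (x₀ : State Θ d) (w : NoisePath)

/-- `inf {k > m : U_k λ* ≤ λ(θ, Φ_θ(T*_k - T*_m, ν))}` for `x = (θ, ν)`, with `inf ∅ = ∞`. -/
def nextIndex (m : ℕ) (x : State Θ d) : ℕ∞ :=
  sInf ((fun k : ℕ => (k : ℕ∞)) ''
    {k | m < k ∧ w.U k * C.bound ≤ C.rate (x.1, Φ x.1 (w.T k - w.T m) x.2)})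

open Classical in
/-- The sequence `(τ_n, (θ_n, ν_n))` started at `τ_0 = 0`, `(θ_0, ν_0) = x₀`. Once `τ_n = ∞`
(no further jump) the sequence is frozen. -/
def embedded : ℕ → ℕ∞ × State Θ d
  | 0 => (0, x₀)
  | n + 1 =>
    let m := (embedded n).1
    let x := (embedded n).2
    let k := if m = ⊤ then ⊤ else nextIndex C Φ w m.toNat x
    if k = ⊤ then (⊤, x)
    else
      let ν' := Φ x.1 (w.T k.toNat - w.T m.toNat) x.2
      (k, (C.H (x.1, ν') (w.V (n + 1)), ν'))

open Classical in
/-- The jump times `T_n = T*_{τ_n}`, with `T_n = ∞` when `τ_n = ∞`. -/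
def jumpTime (n : ℕ) : EReal :=
  if (embedded C Φ x₀ w n).1 = ⊤ then ⊤
  else ((w.T (embedded C Φ x₀ w n).1.toNat : ℝ) : EReal)

/-- The post-jump location `Y_n = (θ_n, ν_n)`. -/
def postJump (n : ℕ) : State Θ d := (embedded C Φ x₀ w n).2

/-- The index `n` with `t ∈ [T_n, T_{n+1}[`. -/
def jumpIndex (t : ℝ) : ℕ :=
  sInf {n | jumpTime C Φ x₀ w n ≤ (t : EReal) ∧ (t : EReal) < jumpTime C Φ x₀ w (n + 1)}

/-- The last jump time before or at `t`, that is `T_n` for the `n` with `t ∈ [T_n, T_{n+1}[`. -/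
def lastJump (t : ℝ) : ℝ := (jumpTime C Φ x₀ w (jumpIndex C Φ x₀ w t)).toReal

/-- The piecewise deterministic process
`x_t = (θ_n, Φ_{θ_n}(t - T_n, ν_n))` for `t ∈ [T_n, T_{n+1}[`. -/
def process (t : ℝ) : State Θ d :=
  let y := postJump C Φ x₀ w (jumpIndex C Φ x₀ w t)
  (y.1, Φ y.1 (t - lastJump C Φ x₀ w t) y.2)

open Classical in
/-- The random counting measure on `ℝ₊ × E`,
`p([0,t] × A) = ∑_{n ≥ 1} 1_{T_n ≤ t} 1_{Y_n ∈ A}`. -/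
def jumpMeasure : Measure (ℝ × State Θ d) :=
  Measure.sum fun n : ℕ =>
    if jumpTime C Φ x₀ w (n + 1) = ⊤ then 0
    else Measure.dirac ((jumpTime C Φ x₀ w (n + 1)).toReal, postJump C Φ x₀ w (n + 1))

/-- The measure `p'(ds dy) = λ(x_s) Q(x_s, dy) ds` on `ℝ₊ × E`, that is
`p'([0,t] × A) = ∫_0^t λ(x_s) Q(x_s, A) ds`. -/
def compensator : Measure (ℝ × State Θ d) :=
  (volume.restrict (Ici (0 : ℝ))).bind fun s =>
    ENNReal.ofReal (C.rate (process C Φ x₀ w s)) •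
      (C.QE (process C Φ x₀ w s)).map fun y => (s, y)

/-- The integral `∫_0^t ∫_E φ(s, y) q(ds dy)` with `q = p - p'`. -/
def compensatedIntegral (φ : ℝ × State Θ d → ℝ) (t : ℝ) : ℝ :=
  (∫ z in Ioc 0 t ×ˢ univ, φ z ∂(jumpMeasure C Φ x₀ w)) -
    ∫ z in Ioc 0 t ×ˢ univ, φ z ∂(compensator C Φ x₀ w)

/-- The integrand `(s, y) ↦ g(s, y) - g(s, x_{s-})`, where `x_{s-}` is the left limit. -/
def jumpIntegrand [TopologicalSpace Θ] (g : ℝ → State Θ d → ℝ) (z : ℝ × State Θ d) : ℝ :=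
  g z.1 z.2 - g z.1 (Function.leftLim (process C Φ x₀ w) z.1)

/-- `M^g_t = ∫_0^t ∫_E (g(s, y) - g(s, x_{s-})) q(ds dy)`. -/
def martingalePart [TopologicalSpace Θ] (g : ℝ → State Θ d → ℝ) (t : ℝ) : ℝ :=
  compensatedIntegral C Φ x₀ w (jumpIntegrand C Φ x₀ w g) t

/-- The σ-algebra `ℱ_t^p` generated by the random variables `p([0,s] × A)`, `0 ≤ s ≤ t`,
`A` a Borel set of `E`. -/
@[reducible]
def jumpSigma {Ω : Type*} (W : Ω → NoisePath) (t : ℝ) : MeasurableSpace Ω :=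
  ⨆ s ∈ Icc 0 t, ⨆ A ∈ {A : Set (State Θ d) | MeasurableSet A},
    MeasurableSpace.comap (fun ω => jumpMeasure C Φ x₀ (W ω) (Icc 0 s ×ˢ A)) inferInstance

end Construction

section Flows

variable {Θ : Type*} {d : ℕ}

/-- `y` solves `y' = F(y)` on `[0, ∞[` with `y(0) = ν` (one-sided derivative at `0`). -/
def IsODESolution (F : EuclideanSpace ℝ (Fin d) → EuclideanSpace ℝ (Fin d))
    (ν : EuclideanSpace ℝ (Fin d)) (y : ℝ → EuclideanSpace ℝ (Fin d)) : Prop :=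
  y 0 = ν ∧ ∀ t, 0 ≤ t → HasDerivWithinAt y (F (y t)) (Ici 0) t

open Classical in
/-- The flow `φ_θ(t, ν)`: the solution of `y' = f_θ(y)`, `y(0) = ν`, at time `t ≥ 0`. (It exists
and is unique when `f_θ` is Lipschitz; the other branch is then void.) -/
def odeFlow (f : Θ → EuclideanSpace ℝ (Fin d) → EuclideanSpace ℝ (Fin d)) : FlowFamily Θ d :=
  fun θ t ν => if h : ∃ y, IsODESolution (f θ) ν y then h.choose t else ν

/-- The Euler scheme `y_{i+1} = y_i + h F(y_i)`, `y_0 = ν`. -/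
def eulerSeq (F : EuclideanSpace ℝ (Fin d) → EuclideanSpace ℝ (Fin d)) (h : ℝ)
    (ν : EuclideanSpace ℝ (Fin d)) : ℕ → EuclideanSpace ℝ (Fin d)
  | 0 => ν
  | i + 1 => eulerSeq F h ν i + h • F (eulerSeq F h ν i)

/-- The Euler polygon `y_i + (t - ih) f_θ(y_i)` for `t ∈ [ih, (i+1)h]`. -/
def eulerFlow (f : Θ → EuclideanSpace ℝ (Fin d) → EuclideanSpace ℝ (Fin d)) (h : ℝ) :
    FlowFamily Θ d :=
  fun θ t ν =>
    let i := ⌊t / h⌋₊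
    eulerSeq (f θ) h ν i + (t - i * h) • f θ (eulerSeq (f θ) h ν i)

/-- `η(s) = T_n + k h` for `s ∈ [T_n + k h, (T_n + (k+1) h) ∧ T_{n+1}[`. -/
def gridTime [MeasurableSpace Θ] (C : JumpCharacteristics Θ d) (Φ : FlowFamily Θ d)
    (x₀ : State Θ d) (w : NoisePath) (h s : ℝ) : ℝ :=
  lastJump C Φ x₀ w s + ⌊(s - lastJump C Φ x₀ w s) / h⌋₊ * h

end Flows

section Operators

variable {Θ : Type*} {d : ℕ}

/-- `∂_t g(t, x)` for `g` on `ℝ₊ × E` (one-sided at `t = 0`). -/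
def dt (g : ℝ → State Θ d → ℝ) (t : ℝ) (x : State Θ d) : ℝ :=
  derivWithin (fun s => g s x) (Ici 0) t

/-- `∂_ν g(t, x)`, as a linear form on `ℝ^d`. -/
def dν (g : ℝ → State Θ d → ℝ) (t : ℝ) (x : State Θ d) : EuclideanSpace ℝ (Fin d) →L[ℝ] ℝ :=
  fderiv ℝ (fun ν => g t (x.1, ν)) x.2

/-- `g : ℝ₊ × E → ℝ` is bounded and continuously differentiable in `(t, ν)` with bounded
derivatives. Only the values `g t x` with `t ≥ 0` matter. -/
structure IsBoundedC1 (g : ℝ → State Θ d → ℝ) : Prop where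
  contDiffOn : ∀ θ, ContDiffOn ℝ 1
    (fun z : ℝ × EuclideanSpace ℝ (Fin d) => g z.1 (θ, z.2)) (Ici 0 ×ˢ univ)
  bounded : ∃ K : ℝ, ∀ t, 0 ≤ t → ∀ x, |g t x| ≤ K
  bounded_dt : ∃ K : ℝ, ∀ t, 0 ≤ t → ∀ x, |dt g t x| ≤ K
  bounded_dν : ∃ K : ℝ, ∀ t, 0 ≤ t → ∀ x, ‖dν g t x‖ ≤ K

variable [MeasurableSpace Θ] (C : JumpCharacteristics Θ d)
  (f : Θ → EuclideanSpace ℝ (Fin d) → EuclideanSpace ℝ (Fin d))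

/-- `𝒮 g(t, x) = λ(x) ∫_E (g(t, y) - g(t, x)) Q(x, dy)`. -/
def opS (g : ℝ → State Θ d → ℝ) (t : ℝ) (x : State Θ d) : ℝ :=
  C.rate x * ∫ y, (g t y - g t x) ∂(C.QE x)

/-- `𝒯 g(t, x) = ∂_t g(t, x) + f(x) ∂_ν g(t, x)`. -/
def opT (g : ℝ → State Θ d → ℝ) (t : ℝ) (x : State Θ d) : ℝ :=
  dt g t x + dν g t x (f x.1 x.2)

/-- The generator `𝒜 g = 𝒯 g + 𝒮 g`. -/
def opA (g : ℝ → State Θ d → ℝ) (t : ℝ) (x : State Θ d) : ℝ :=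
  opT f g t x + opS C g t x

/-- `𝒯bar g(t, x, y) = ∂_t g(t, x) + f(y) ∂_ν g(t, x)`. -/
def opTbar (g : ℝ → State Θ d → ℝ) (t : ℝ) (x y : State Θ d) : ℝ :=
  dt g t x + dν g t x (f y.1 y.2)

/-- `𝒜bar g(t, x, y) = 𝒯bar g(t, x, y) + 𝒮 g(t, x)`. -/
def opAbar (g : ℝ → State Θ d → ℝ) (t : ℝ) (x y : State Θ d) : ℝ :=
  opTbar f g t x y + opS C g t x

end Operators

end PDMP

end

/-!
Read along the points `T*_k` of the Poisson process, the construction is a recursion: from the time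
and location (the *anchor*) of the last accepted point, follow the flow up to `T*_{k+1}` and accept
that point with probability `λ / λ*`. Between consecutive points `g(s, x_s)` is the integral of its
drift along the flow, and at an accepted point it jumps, so summing over the points expresses
`g(t, x_t) - g(0, x)` as a drift integral plus a sum of jumps. The `q`-integral is that sum of jumps
minus the integral of `𝒮 g`, which gives the formula path by path, for any flow with a velocity.

The martingale property reduces to a single interval between two points. Given the past up to
`T*_k`, the waiting time `σ` for `T*_{k+1}` is exponential with rate `λ*`, and given `σ` the
proposed jump has mean `b(σ) / λ*`, where `b` is the value of `𝒮 g` along the flow. The tail formula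
`P(σ > ρ) = exp (-λ* ρ)` yields `E[b(σ)] = λ* E[∫_0^σ b]`, so the jump and its compensator cancel on
average. The number `n` of points accepted up to `T*_k` decides which mark `V_{n+1}` is read next.
It is a stopping time for the filtration indexed by the number of marks read, and its stopped
σ-algebra is the past meant above; on `{s < T*_{k+1}}` it contains the history of the jumps up to
`s`. The probability of `T*_k ≤ t` decays geometrically, so the increments may be summed over all
`k`.

The integrand reads `x_{s-}`, which depends only on the anchor before `s`. This is recovered from
the jump measure restricted to `[0, s[`, hence the compensated integral is adapted.
-/

noncomputable section

namespace PDMP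

/-! ### Thinning -/

section Counting

/-- A realisation of the noise whose points `0 = T*_0 < T*_1 < ⋯` increase to infinity. -/
structure NoisePath.IsCounting (w : NoisePath) : Prop where
  zero : w.T 0 = 0
  strictMono : StrictMono w.T
  tendsto : Tendsto w.T atTop atTop

variable {w : NoisePath}

theorem NoisePath.IsCounting.monotone (hw : w.IsCounting) : Monotone w.T :=
  hw.strictMono.monotone

theorem NoisePath.IsCounting.nonneg (hw : w.IsCounting) (k : ℕ) : 0 ≤ w.T k :=
  hw.zero ▸ hw.monotone k.zero_le

theorem NoisePath.IsCounting.succ_pos (hw : w.IsCounting) (k : ℕ) : 0 < w.T (k + 1) :=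
  hw.zero ▸ hw.strictMono k.succ_pos

theorem NoisePath.IsCounting.exists_mem_Ico (hw : w.IsCounting) {t : ℝ} (ht : 0 ≤ t) :
    ∃ k, t ∈ Ico (w.T k) (w.T (k + 1)) := by
  have h : t ∈ ⋃ k, Ico (w.T k) (w.T (Order.succ k)) := by
    rw [iUnion_Ico_map_succ_eq_Ici (fun k => hw.monotone bot_le)
      (not_bddAbove_of_tendsto_atTop hw.tendsto)]
    exact hw.zero.trans_le ht
  exact mem_iUnion.1 h

theorem NoisePath.IsCounting.finite_setOf_le (hw : w.IsCounting) (t : ℝ) :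
    {k | w.T k ≤ t}.Finite := by
  have h : ∀ᶠ k in cofinite, t < w.T k :=
    Nat.cofinite_eq_atTop ▸ hw.tendsto.eventually_gt_atTop t
  simpa only [eventually_cofinite, not_lt] using h

end Counting

section Thinning

variable {Θ : Type*} {d : ℕ}

/-- The state at time `t` of the deterministic trajectory that starts at time `r.1` from `r.2`;
it stays at its starting value for `t ≤ r.1`. -/
def flowFrom (Φ : FlowFamily Θ d) (r : ℝ × State Θ d) (t : ℝ) : State Θ d :=
  (r.2.1, Φ r.2.1 (max (t - r.1) 0) r.2.2)

theorem flowFrom_of_le {Φ : FlowFamily Θ d} {r : ℝ × State Θ d} {t : ℝ} (h : r.1 ≤ t) :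
    flowFrom Φ r t = (r.2.1, Φ r.2.1 (t - r.1) r.2.2) := by
  rw [flowFrom, max_eq_left (sub_nonneg.2 h)]

variable [MeasurableSpace Θ]

variable (C : JumpCharacteristics Θ d) (Φ : FlowFamily Θ d) (x₀ : State Θ d) (w : NoisePath)

open Classical in
/-- The thinning construction read along the Poisson points: the number of points accepted among
the first `k`, the last accepted one (or `0`), and the post-jump location at that time. -/
def thinned : ℕ → ℕ × ℝ × State Θ d
  | 0 => (0, 0, x₀)
  | k + 1 =>
    let z := thinned k
    let y := flowFrom Φ z.2 (w.T (k + 1))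
    if w.U (k + 1) * C.bound ≤ C.rate y
    then (z.1 + 1, w.T (k + 1), (C.H y (w.V (z.1 + 1)), y.2)) else z

/-- The number of points accepted among the first `k` Poisson points. -/
def acceptCount (k : ℕ) : ℕ := (thinned C Φ x₀ w k).1

/-- The time and the location from which the trajectory is deterministic on `[T*_k, T*_{k+1}[`. -/
def anchor (k : ℕ) : ℝ × State Θ d := (thinned C Φ x₀ w k).2

/-- The location just before the `(k+1)`-st Poisson point. -/
def arrival (k : ℕ) : State Θ d := flowFrom Φ (anchor C Φ x₀ w k) (w.T (k + 1))

/-- The `(k+1)`-st Poisson point is accepted. -/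
def Accepts (k : ℕ) : Prop :=
  w.U (k + 1) * C.bound ≤ C.rate (arrival C Φ x₀ w k)

variable {C Φ x₀ w}

theorem acceptCount_succ_of_accepts {k : ℕ} (h : Accepts C Φ x₀ w k) :
    acceptCount C Φ x₀ w (k + 1) = acceptCount C Φ x₀ w k + 1 := by
  rw [acceptCount, thinned]
  exact congrArg Prod.fst (if_pos h)

theorem acceptCount_succ_of_not_accepts {k : ℕ} (h : ¬ Accepts C Φ x₀ w k) :
    acceptCount C Φ x₀ w (k + 1) = acceptCount C Φ x₀ w k := by
  rw [acceptCount, thinned]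
  exact congrArg Prod.fst (if_neg h)

theorem anchor_succ_of_accepts {k : ℕ} (h : Accepts C Φ x₀ w k) :
    anchor C Φ x₀ w (k + 1) = (w.T (k + 1),
      (C.H (arrival C Φ x₀ w k) (w.V (acceptCount C Φ x₀ w k + 1)), (arrival C Φ x₀ w k).2)) := by
  rw [anchor, thinned]
  exact congrArg Prod.snd (if_pos h)

theorem anchor_succ_of_not_accepts {k : ℕ} (h : ¬ Accepts C Φ x₀ w k) :
    anchor C Φ x₀ w (k + 1) = anchor C Φ x₀ w k := by
  rw [anchor, thinned]
  exact congrArg Prod.snd (if_neg h)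

theorem anchor_fst_le (hw : w.IsCounting) (k : ℕ) : (anchor C Φ x₀ w k).1 ≤ w.T k := by
  induction k with
  | zero => exact hw.zero.ge
  | succ k ih =>
    by_cases h : Accepts C Φ x₀ w k
    · rw [anchor_succ_of_accepts h]
    · rw [anchor_succ_of_not_accepts h]
      exact ih.trans (hw.monotone k.le_succ)

theorem natCast_lt_nextIndex_iff {m k : ℕ} {x : State Θ d} :
    (k : ℕ∞) < nextIndex C Φ w m x ↔ ∀ j, m < j →
      w.U j * C.bound ≤ C.rate (x.1, Φ x.1 (w.T j - w.T m) x.2) → k < j := by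
  rw [nextIndex, ← ENat.natCast_add_one_le_iff, le_sInf_iff]
  simp only [forall_mem_image, mem_ofPred_eq, and_imp]
  exact forall₃_congr fun j _ _ => by rw [ENat.natCast_add_one_le_iff, Nat.cast_lt]

theorem nextIndex_eq_succ {m k : ℕ} {x : State Θ d} (hmk : m ≤ k)
    (hlt : (k : ℕ∞) < nextIndex C Φ w m x)
    (h : w.U (k + 1) * C.bound ≤ C.rate (x.1, Φ x.1 (w.T (k + 1) - w.T m) x.2)) :
    nextIndex C Φ w m x = (k + 1 : ℕ) :=
  le_antisymm (sInf_le ⟨k + 1, ⟨Nat.lt_succ_of_le hmk, h⟩, rfl⟩)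
    (by rwa [Nat.cast_add_one, ENat.natCast_add_one_le_iff])

theorem succ_lt_nextIndex {m k : ℕ} {x : State Θ d} (hlt : (k : ℕ∞) < nextIndex C Φ w m x)
    (h : ¬ w.U (k + 1) * C.bound ≤ C.rate (x.1, Φ x.1 (w.T (k + 1) - w.T m) x.2)) :
    ((k + 1 : ℕ) : ℕ∞) < nextIndex C Φ w m x := by
  rw [natCast_lt_nextIndex_iff] at hlt ⊢
  intro j hj hacc
  refine lt_of_le_of_ne (hlt j hj hacc) ?_
  rintro rfl
  exact h hacc

theorem embedded_succ_fst {n m : ℕ} (h : (embedded C Φ x₀ w n).1 = m) :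
    (embedded C Φ x₀ w (n + 1)).1 = nextIndex C Φ w m (embedded C Φ x₀ w n).2 := by
  rw [embedded]
  simp only [h, ENat.natCast_ne_top, if_false, ENat.toNat_natCast]
  split_ifs with htop
  · exact htop.symm
  · rfl

theorem embedded_succ_snd {n m k : ℕ} (h : (embedded C Φ x₀ w n).1 = m)
    (hk : (embedded C Φ x₀ w (n + 1)).1 = k) :
    (embedded C Φ x₀ w (n + 1)).2 =
      (C.H ((embedded C Φ x₀ w n).2.1, Φ (embedded C Φ x₀ w n).2.1 (w.T k - w.T m)
          (embedded C Φ x₀ w n).2.2) (w.V (n + 1)),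
        Φ (embedded C Φ x₀ w n).2.1 (w.T k - w.T m) (embedded C Φ x₀ w n).2.2) := by
  have hnext := embedded_succ_fst h
  rw [hk] at hnext
  rw [embedded]
  simp only [h, ENat.natCast_ne_top, if_false, ENat.toNat_natCast, ← hnext]

theorem embedded_succ_of_top {n : ℕ} (h : (embedded C Φ x₀ w n).1 = ⊤) :
    (embedded C Φ x₀ w (n + 1)).1 = ⊤ := by
  rw [embedded]
  simp only [h, if_true]

theorem embedded_lt_succ {n m : ℕ} (h : (embedded C Φ x₀ w n).1 = m) :
    (m : ℕ∞) < (embedded C Φ x₀ w (n + 1)).1 := by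
  rw [embedded_succ_fst h, natCast_lt_nextIndex_iff]
  exact fun j hj _ => hj

theorem embedded_fst_monotone : Monotone fun n => (embedded C Φ x₀ w n).1 := by
  refine monotone_nat_of_le_succ fun n => ?_
  induction h : (embedded C Φ x₀ w n).1 using ENat.recTopCoe with
  | top => rw [embedded_succ_of_top h]
  | coe m => exact (embedded_lt_succ h).le

theorem embedded_fst_lt_of_lt {i j m : ℕ} (h : (embedded C Φ x₀ w i).1 = m) (hij : i < j) :
    (m : ℕ∞) < (embedded C Φ x₀ w j).1 :=
  (embedded_lt_succ h).trans_le (embedded_fst_monotone hij)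

/-- Matches the recursion along the Poisson points with the sequence `(τ_n, Y_n)`: `m` is the
index of the last accepted point. -/
theorem exists_embedded_acceptCount (hw : w.IsCounting) (k : ℕ) :
    ∃ m ≤ k, embedded C Φ x₀ w (acceptCount C Φ x₀ w k) = ((m : ℕ∞), (anchor C Φ x₀ w k).2) ∧
      w.T m = (anchor C Φ x₀ w k).1 ∧
      (k : ℕ∞) < (embedded C Φ x₀ w (acceptCount C Φ x₀ w k + 1)).1 := by
  induction k with
  | zero => exact ⟨0, le_rfl, rfl, hw.zero, embedded_lt_succ (n := 0) rfl⟩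
  | succ k ih =>
    obtain ⟨m, hmk, hemb, hT, hlt⟩ := ih
    obtain ⟨hfst, hsnd⟩ := Prod.ext_iff.1 hemb
    dsimp only at hfst hsnd
    have hnext := embedded_succ_fst hfst
    have harr : arrival C Φ x₀ w k = ((anchor C Φ x₀ w k).2.1,
        Φ (anchor C Φ x₀ w k).2.1 (w.T (k + 1) - w.T m) (anchor C Φ x₀ w k).2.2) := by
      rw [arrival, flowFrom_of_le ((anchor_fst_le hw k).trans (hw.monotone k.le_succ)), hT]
    rw [hnext, hsnd] at hlt
    by_cases hacc : Accepts C Φ x₀ w k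
    · have hsucc : (embedded C Φ x₀ w (acceptCount C Φ x₀ w k + 1)).1 = ((k + 1 : ℕ) : ℕ∞) := by
        rw [hnext, hsnd]
        exact nextIndex_eq_succ hmk hlt (harr ▸ hacc)
      rw [acceptCount_succ_of_accepts hacc, anchor_succ_of_accepts hacc]
      refine ⟨k + 1, le_rfl, Prod.ext hsucc ?_, rfl, embedded_lt_succ hsucc⟩
      rw [embedded_succ_snd hfst hsucc, hsnd, harr]
    · rw [acceptCount_succ_of_not_accepts hacc, anchor_succ_of_not_accepts hacc]
      refine ⟨m, hmk.trans k.le_succ, hemb, hT, ?_⟩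
      rw [hnext, hsnd]
      exact succ_lt_nextIndex hlt (harr ▸ hacc)

theorem embedded_succ_eq_iff (hw : w.IsCounting) {n k : ℕ} :
    (embedded C Φ x₀ w (n + 1)).1 = ((k + 1 : ℕ) : ℕ∞) ↔
      Accepts C Φ x₀ w k ∧ acceptCount C Φ x₀ w k = n := by
  obtain ⟨m, hmk, hemb, -, hlt⟩ := exists_embedded_acceptCount (C := C) (Φ := Φ) (x₀ := x₀) hw k
  obtain ⟨m', hmk', hemb', -, hlt'⟩ :=
    exists_embedded_acceptCount (C := C) (Φ := Φ) (x₀ := x₀) hw (k + 1)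
  have hfst := congrArg Prod.fst hemb
  have hfst' := congrArg Prod.fst hemb'
  constructor
  · intro h
    have hcount : acceptCount C Φ x₀ w (k + 1) = n + 1 := by
      refine le_antisymm (not_lt.1 fun hgt => ?_) (not_lt.1 fun hgt => ?_)
      · have hlt_m' := embedded_fst_lt_of_lt h hgt
        rw [hfst', Nat.cast_lt] at hlt_m'
        exact hlt_m'.not_ge hmk'
      · exact (hlt'.trans_le (embedded_fst_monotone hgt)).ne h.symm
    have hacc : Accepts C Φ x₀ w k := by
      by_contra hacc
      rw [acceptCount_succ_of_not_accepts hacc] at hcount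
      rw [hcount, h, Nat.cast_inj] at hfst
      lia
    exact ⟨hacc, Nat.succ_injective ((acceptCount_succ_of_accepts hacc).symm.trans hcount)⟩
  · rintro ⟨hacc, rfl⟩
    rw [acceptCount_succ_of_accepts hacc] at hfst'
    rw [hfst', Nat.cast_lt] at hlt
    rw [hfst', le_antisymm hmk' hlt]

theorem jumpTime_of_eq {n m : ℕ} (h : (embedded C Φ x₀ w n).1 = m) :
    jumpTime C Φ x₀ w n = (w.T m : EReal) := by
  rw [jumpTime, h, if_neg (ENat.natCast_ne_top m), ENat.toNat_natCast]

theorem jumpTime_eq_top_iff {n : ℕ} :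
    jumpTime C Φ x₀ w n = ⊤ ↔ (embedded C Φ x₀ w n).1 = ⊤ := by
  rw [jumpTime]
  split_ifs with h <;> simp [h]

theorem coe_lt_jumpTime_succ (hw : w.IsCounting) {n k : ℕ} {t : ℝ}
    (hk : (k : ℕ∞) < (embedded C Φ x₀ w (n + 1)).1) (ht : t < w.T (k + 1)) :
    (t : EReal) < jumpTime C Φ x₀ w (n + 1) := by
  induction h : (embedded C Φ x₀ w (n + 1)).1 using ENat.recTopCoe with
  | top => exact jumpTime_eq_top_iff.2 h ▸ EReal.coe_lt_top t
  | coe m =>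
    rw [h, Nat.cast_lt] at hk
    rw [jumpTime_of_eq h]
    exact EReal.coe_lt_coe_iff.2 (ht.trans_le (hw.monotone hk))

theorem jumpTime_monotone (hw : w.IsCounting) : Monotone (jumpTime C Φ x₀ w) := by
  refine monotone_nat_of_le_succ fun n => ?_
  induction h : (embedded C Φ x₀ w n).1 using ENat.recTopCoe with
  | top => rw [jumpTime_eq_top_iff.2 (embedded_succ_of_top h)]; exact le_top
  | coe m =>
    rw [jumpTime_of_eq h]
    exact (coe_lt_jumpTime_succ hw (embedded_lt_succ h) (hw.strictMono m.lt_succ_self)).le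

theorem jumpIndex_eq_of_mem (hw : w.IsCounting) {n : ℕ} {t : ℝ}
    (hle : jumpTime C Φ x₀ w n ≤ t) (hlt : (t : EReal) < jumpTime C Φ x₀ w (n + 1)) :
    jumpIndex C Φ x₀ w t = n := by
  suffices {n | jumpTime C Φ x₀ w n ≤ (t : EReal) ∧
      (t : EReal) < jumpTime C Φ x₀ w (n + 1)} = {n} by rw [jumpIndex, this, csInf_singleton]
  refine eq_singleton_iff_unique_mem.2 ⟨⟨hle, hlt⟩, fun j hj => le_antisymm ?_ ?_⟩
  · exact not_lt.1 fun h => (hlt.trans_le ((jumpTime_monotone hw h).trans hj.1)).false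
  · exact not_lt.1 fun h => (hj.2.trans_le ((jumpTime_monotone hw h).trans hle)).false

theorem jumpTime_acceptCount (hw : w.IsCounting) (k : ℕ) :
    jumpTime C Φ x₀ w (acceptCount C Φ x₀ w k) = ((anchor C Φ x₀ w k).1 : ℝ) := by
  obtain ⟨m, -, hemb, hT, -⟩ := exists_embedded_acceptCount (C := C) (Φ := Φ) (x₀ := x₀) hw k
  rw [jumpTime_of_eq (congrArg Prod.fst hemb), hT]

theorem postJump_acceptCount (hw : w.IsCounting) (k : ℕ) :
    postJump C Φ x₀ w (acceptCount C Φ x₀ w k) = (anchor C Φ x₀ w k).2 := by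
  obtain ⟨m, -, hemb, -⟩ := exists_embedded_acceptCount (C := C) (Φ := Φ) (x₀ := x₀) hw k
  rw [postJump, hemb]

theorem jumpIndex_eq (hw : w.IsCounting) {k : ℕ} {t : ℝ}
    (ht : t ∈ Ico (anchor C Φ x₀ w k).1 (w.T (k + 1))) :
    jumpIndex C Φ x₀ w t = acceptCount C Φ x₀ w k := by
  obtain ⟨m, -, -, -, hlt⟩ := exists_embedded_acceptCount (C := C) (Φ := Φ) (x₀ := x₀) hw k
  refine jumpIndex_eq_of_mem hw ?_ (coe_lt_jumpTime_succ hw hlt ht.2)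
  rw [jumpTime_acceptCount hw]
  exact EReal.coe_le_coe_iff.2 ht.1

theorem lastJump_eq (hw : w.IsCounting) {k : ℕ} {t : ℝ} (ht : t ∈ Ico (w.T k) (w.T (k + 1))) :
    lastJump C Φ x₀ w t = (anchor C Φ x₀ w k).1 := by
  rw [lastJump, jumpIndex_eq hw (Ico_subset_Ico_left (anchor_fst_le hw k) ht),
    jumpTime_acceptCount hw, EReal.toReal_coe]

theorem postJump_jumpIndex (hw : w.IsCounting) {k : ℕ} {t : ℝ}
    (ht : t ∈ Ico (w.T k) (w.T (k + 1))) :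
    postJump C Φ x₀ w (jumpIndex C Φ x₀ w t) = (anchor C Φ x₀ w k).2 := by
  rw [jumpIndex_eq hw (Ico_subset_Ico_left (anchor_fst_le hw k) ht), postJump_acceptCount hw]

theorem process_eq_flowFrom (hw : w.IsCounting) {k : ℕ} {t : ℝ}
    (ht : t ∈ Ico (w.T k) (w.T (k + 1))) :
    process C Φ x₀ w t = flowFrom Φ (anchor C Φ x₀ w k) t := by
  rw [process, postJump_jumpIndex hw ht, lastJump_eq hw ht,
    flowFrom_of_le ((anchor_fst_le hw k).trans ht.1)]

end Thinning

section JumpMeasure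

theorem measureSum_eq_single {ι α : Type*} [MeasurableSpace α] {μ : ι → Measure α} (i : ι)
    (h : ∀ j ≠ i, μ j = 0) : Measure.sum μ = μ i := by
  ext s hs
  rw [Measure.sum_apply _ hs]
  exact tsum_eq_single i fun j hj => by rw [h j hj, Measure.coe_zero, Pi.zero_apply]

variable {Θ : Type*} {d : ℕ} [MeasurableSpace Θ] {C : JumpCharacteristics Θ d}
  {Φ : FlowFamily Θ d} {x₀ : State Θ d} {w : NoisePath}

open Classical in
theorem dirac_jumpTime_succ_eq_sum (hw : w.IsCounting) (n : ℕ) :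
    (if jumpTime C Φ x₀ w (n + 1) = ⊤ then (0 : Measure (ℝ × State Θ d))
      else Measure.dirac ((jumpTime C Φ x₀ w (n + 1)).toReal, postJump C Φ x₀ w (n + 1))) =
    Measure.sum fun k : ℕ => if Accepts C Φ x₀ w k ∧ acceptCount C Φ x₀ w k = n
      then Measure.dirac (w.T (k + 1), (anchor C Φ x₀ w (k + 1)).2) else 0 := by
  simp only [← embedded_succ_eq_iff hw]
  induction h : (embedded C Φ x₀ w (n + 1)).1 using ENat.recTopCoe with
  | top =>
    simp only [jumpTime_eq_top_iff.2 h, if_true, (ENat.natCast_ne_top _).symm, if_false,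
      Measure.sum_zero]
  | coe m =>
    have hpos : 0 < m := by
      have hlt := embedded_fst_lt_of_lt (C := C) (Φ := Φ) (x₀ := x₀) (w := w) rfl n.succ_pos
      rwa [h, Nat.cast_lt] at hlt
    obtain ⟨k, rfl⟩ := Nat.exists_eq_succ_of_ne_zero hpos.ne'
    obtain ⟨hacc, rfl⟩ := (embedded_succ_eq_iff hw).1 h
    rw [measureSum_eq_single k fun j hj => if_neg fun hj' => hj (by simpa using hj'.symm),
      if_pos rfl, if_neg (by rw [jumpTime_of_eq h]; exact EReal.coe_ne_top _), jumpTime_of_eq h,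
      EReal.toReal_coe, ← acceptCount_succ_of_accepts hacc, postJump_acceptCount hw]

open Classical in
theorem jumpMeasure_eq_sum (hw : w.IsCounting) :
    jumpMeasure C Φ x₀ w = Measure.sum fun k : ℕ => if Accepts C Φ x₀ w k
      then Measure.dirac (w.T (k + 1), (anchor C Φ x₀ w (k + 1)).2) else 0 := by
  rw [jumpMeasure]
  simp only [dirac_jumpTime_succ_eq_sum hw]
  rw [Measure.sum_comm]
  congr 1 with k : 1
  rw [measureSum_eq_single (acceptCount C Φ x₀ w k) fun n hn => if_neg fun h => hn h.2.symm]
  simp only [and_true]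

end JumpMeasure

section InverseTransform

variable {Θ : Type*} {d : ℕ} [MeasurableSpace Θ] {C : JumpCharacteristics Θ d}

theorem JumpCharacteristics.countable (C : JumpCharacteristics Θ d) : Countable Θ :=
  C.rank_injective.countable

/-- The level `u` selects the point `θ = k_i`: `a_{i-1}(x) < u ≤ a_i(x)`. -/
def JumpCharacteristics.Selects (C : JumpCharacteristics Θ d) (x : State Θ d) (u : ℝ) (θ : Θ) :
    Prop :=
  u ∈ Ioc ((C.Q x).real {j | C.rank j < C.rank θ}) ((C.Q x).real {j | C.rank j ≤ C.rank θ})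

theorem JumpCharacteristics.Selects.rank_le {x : State Θ d} {u : ℝ} {θ θ' : Θ}
    (h : C.Selects x u θ) (h' : C.Selects x u θ') : C.rank θ ≤ C.rank θ' := by
  have := C.isMarkovKernel_Q
  by_contra! hlt
  have hle : (C.Q x).real {j | C.rank j ≤ C.rank θ'} ≤ (C.Q x).real {j | C.rank j < C.rank θ} :=
    measureReal_mono fun j hj => lt_of_le_of_lt hj hlt
  exact (h.1.trans_le (h'.2.trans hle)).false

theorem JumpCharacteristics.Selects.unique {x : State Θ d} {u : ℝ} {θ θ' : Θ}
    (h : C.Selects x u θ) (h' : C.Selects x u θ') : θ = θ' :=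
  C.rank_injective ((h.rank_le h').antisymm (h'.rank_le h))

theorem JumpCharacteristics.Selects.H_eq {x : State Θ d} {u : ℝ} {θ : Θ}
    (h : C.Selects x u θ) : C.H x u = θ := by
  have hex : ∃ θ, C.Selects x u θ := ⟨θ, h⟩
  exact (dif_pos hex).trans (hex.choose_spec.unique h)

theorem JumpCharacteristics.H_eq_iff {x : State Θ d} {u : ℝ} {θ : Θ} :
    C.H x u = θ ↔ C.Selects x u θ ∨ ((∀ θ', ¬ C.Selects x u θ') ∧ x.1 = θ) := by
  by_cases hex : ∃ θ, C.Selects x u θ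
  · obtain ⟨θ', h'⟩ := hex
    have hnone : ¬ ∀ θ', ¬ C.Selects x u θ' := fun h => h θ' h'
    simp only [hnone, false_and, or_false]
    exact ⟨fun h => h ▸ h'.H_eq.symm ▸ h', fun h => h.H_eq⟩
  · have hH : C.H x u = x.1 := dif_neg hex
    rw [hH, or_iff_right (not_exists.1 hex θ), and_iff_right (not_exists.1 hex)]

variable [DiscreteMeasurableSpace Θ]

theorem JumpCharacteristics.measurableSet_selects (θ : Θ) :
    MeasurableSet {z : State Θ d × ℝ | C.Selects z.1 z.2 θ} := by
  have hQ (S : Set Θ) : Measurable fun z : State Θ d × ℝ => (C.Q z.1).real S :=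
    ((Kernel.measurable_coe C.Q (MeasurableSet.of_discrete (s := S))).comp
      measurable_fst).ennreal_toReal
  exact (measurableSet_lt (hQ _) measurable_snd).inter (measurableSet_le measurable_snd (hQ _))

theorem JumpCharacteristics.measurable_H (C : JumpCharacteristics Θ d) :
    Measurable fun z : State Θ d × ℝ => C.H z.1 z.2 := by
  have := C.countable
  refine measurable_to_countable' fun θ => ?_
  have hpre : (fun z : State Θ d × ℝ => C.H z.1 z.2) ⁻¹' {θ} =
      {z | C.Selects z.1 z.2 θ} ∪ ((⋂ θ', {z | C.Selects z.1 z.2 θ'}ᶜ) ∩ {z | z.1.1 = θ}) := by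
    ext z
    simp only [mem_preimage, mem_singleton_iff, C.H_eq_iff, mem_union, mem_ofPred_eq, mem_inter_iff,
      mem_iInter, mem_compl_iff]
  rw [hpre]
  exact (C.measurableSet_selects θ).union ((MeasurableSet.iInter fun θ' =>
    (C.measurableSet_selects θ').compl).inter (measurable_fst.fst (measurableSet_singleton θ)))

theorem JumpCharacteristics.volume_setOf_selects (C : JumpCharacteristics Θ d) (x : State Θ d)
    (θ : Θ) : volume {u | C.Selects x u θ} = C.Q x {θ} := by
  have := C.isMarkovKernel_Q
  have hset : {j | C.rank j ≤ C.rank θ} = {j | C.rank j < C.rank θ} ∪ {θ} := by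
    ext j
    simp only [mem_ofPred_eq, mem_union, mem_singleton_iff, le_iff_lt_or_eq,
      C.rank_injective.eq_iff]
  change volume (Ioc ((C.Q x).real _) ((C.Q x).real _)) = _
  rw [Real.volume_Ioc, hset, measureReal_union (by simp) (measurableSet_singleton _),
    add_sub_cancel_left, ofReal_measureReal]

theorem JumpCharacteristics.Q_singleton_le_map_H (C : JumpCharacteristics Θ d) (x : State Θ d)
    (θ : Θ) : C.Q x {θ} ≤ (volume.restrict (Icc (0 : ℝ) 1)).map (C.H x) {θ} := by
  have := C.isMarkovKernel_Q
  have hm : Measurable (C.H x) := C.measurable_H.comp measurable_prodMk_left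
  rw [Measure.map_apply hm (measurableSet_singleton _),
    Measure.restrict_apply (hm (measurableSet_singleton _)), ← C.volume_setOf_selects]
  exact measure_mono fun u hu => ⟨JumpCharacteristics.Selects.H_eq hu,
    measureReal_nonneg.trans hu.1.le, hu.2.trans measureReal_le_one⟩

theorem JumpCharacteristics.map_H (C : JumpCharacteristics Θ d) (x : State Θ d) :
    (volume.restrict (Icc (0 : ℝ) 1)).map (C.H x) = C.Q x := by
  have := C.countable
  have := C.isMarkovKernel_Q
  have hm : Measurable (C.H x) := C.measurable_H.comp measurable_prodMk_left
  refine (Measure.eq_of_le_of_measure_univ_eq (Measure.le_iff.2 fun s hs => ?_) ?_).symm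
  · rw [← Measure.tsum_indicator_apply_singleton ((volume.restrict _).map _) _ hs,
      ← Measure.tsum_indicator_apply_singleton (C.Q x) _ hs]
    exact ENNReal.tsum_le_tsum fun θ => indicator_le_indicator (C.Q_singleton_le_map_H x θ)
  · rw [Measure.map_apply hm MeasurableSet.univ]
    simp

end InverseTransform

section Regularity

variable {Θ : Type*} {d : ℕ}

/-- A flow of continuous trajectories, measurable in time and starting point. -/
structure IsRegularFlow (Φ : FlowFamily Θ d) : Prop where
  zero : ∀ θ ν, Φ θ 0 ν = ν
  continuousOn : ∀ θ ν, ContinuousOn (fun t => Φ θ t ν) (Ici 0)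
  measurable : ∀ θ, Measurable fun z : ℝ × EuclideanSpace ℝ (Fin d) => Φ θ (max z.1 0) z.2

variable {Φ : FlowFamily Θ d}

theorem continuous_flowFrom_snd (hΦ : IsRegularFlow Φ) (r : ℝ × State Θ d) :
    Continuous fun t => (flowFrom Φ r t).2 :=
  (hΦ.continuousOn _ _).comp_continuous (by fun_prop) fun t => mem_Ici.2 (le_max_right _ _)

theorem continuous_flowFrom [TopologicalSpace Θ] (hΦ : IsRegularFlow Φ) (r : ℝ × State Θ d) :
    Continuous (flowFrom Φ r) :=
  continuous_const.prodMk (continuous_flowFrom_snd hΦ r)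

theorem flowFrom_self (hΦ : IsRegularFlow Φ) (r : ℝ × State Θ d) : flowFrom Φ r r.1 = r.2 := by
  rw [flowFrom_of_le le_rfl, sub_self, hΦ.zero]

variable [MeasurableSpace Θ]

/-- A bounded measurable function on `ℝ₊ × E`: the class of functions for which the compensated
integral makes sense. Only the values `g t x` with `t ≥ 0` matter. -/
structure IsBoundedMeasurable (g : ℝ → State Θ d → ℝ) : Prop where
  measurable : Measurable fun z : ℝ × State Θ d => g (max z.1 0) z.2
  bounded : ∃ K : ℝ, ∀ t, 0 ≤ t → ∀ x, |g t x| ≤ K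

variable [DiscreteMeasurableSpace Θ] [Countable Θ]

theorem measurable_flowFrom (hΦ : IsRegularFlow Φ) :
    Measurable fun z : (ℝ × State Θ d) × ℝ => flowFrom Φ z.1 z.2 := by
  have h : Measurable fun z : Θ × ℝ × EuclideanSpace ℝ (Fin d) => Φ z.1 (max z.2.1 0) z.2.2 :=
    measurable_from_prod_countable_right hΦ.measurable
  exact Measurable.prodMk (by fun_prop) (h.comp
    (f := fun z : (ℝ × State Θ d) × ℝ => (z.1.2.1, z.2 - z.1.1, z.1.2.2)) (by fun_prop))

theorem isBoundedMeasurable_of_continuousOn {g : ℝ → State Θ d → ℝ}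
    (hcont : ∀ θ, ContinuousOn (fun z : ℝ × EuclideanSpace ℝ (Fin d) => g z.1 (θ, z.2))
      (Ici 0 ×ˢ univ))
    (hbdd : ∃ K : ℝ, ∀ t, 0 ≤ t → ∀ x, |g t x| ≤ K) : IsBoundedMeasurable g where
  measurable := by
    have h : Measurable fun z : Θ × ℝ × EuclideanSpace ℝ (Fin d) =>
        g (max z.2.1 0) (z.1, z.2.2) :=
      measurable_from_prod_countable_right fun θ =>
        ((hcont θ).comp_continuous (f := fun z : ℝ × EuclideanSpace ℝ (Fin d) => (max z.1 0, z.2))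
          (by fun_prop) fun z => ⟨mem_Ici.2 (le_max_right _ _), mem_univ _⟩).measurable
    exact h.comp (f := fun z : ℝ × State Θ d => (z.2.1, z.1, z.2.2)) (by fun_prop)
  bounded := hbdd

end Regularity

section PointMeasures

variable {α ι : Type*} [MeasurableSpace α]

open Classical in
theorem restrict_sum_dirac {p : ι → Prop} {z : ι → α} {S : Set α} (hS : MeasurableSet S)
    {F : Finset ι} (hF : ∀ i, i ∈ F ↔ p i ∧ z i ∈ S) :
    (Measure.sum fun i => if p i then Measure.dirac (z i) else 0).restrict S =
      ∑ i ∈ F, Measure.dirac (z i) := by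
  ext A hA
  rw [Measure.restrict_apply hA, Measure.sum_apply _ (hA.inter hS), Measure.finsetSum_apply,
    tsum_eq_sum (s := F)]
  · refine Finset.sum_congr rfl fun i hi => ?_
    obtain ⟨hp, hz⟩ := (hF i).1 hi
    rw [if_pos hp, Measure.dirac_apply' _ (hA.inter hS), Measure.dirac_apply' _ hA]
    simp only [indicator, mem_inter_iff, hz, and_true]
  · intro i hi
    split_ifs with hp
    · rw [Measure.dirac_apply' _ (hA.inter hS),
        indicator_of_notMem fun h => hi ((hF i).2 ⟨hp, h.2⟩)]
    · rw [Measure.coe_zero, Pi.zero_apply]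

end PointMeasures

section Path

variable {Θ : Type*} {d : ℕ} [MeasurableSpace Θ] {C : JumpCharacteristics Θ d}
  {Φ : FlowFamily Θ d} {x₀ : State Θ d} {w : NoisePath}

theorem leftLim_process [TopologicalSpace Θ] [DiscreteTopology Θ] (hw : w.IsCounting)
    (hΦ : IsRegularFlow Φ) {k : ℕ} {s : ℝ} (hs : s ∈ Ioc (w.T k) (w.T (k + 1))) :
    Function.leftLim (process C Φ x₀ w) s = flowFrom Φ (anchor C Φ x₀ w k) s := by
  refine leftLim_eq_of_tendsto ?_
  have hflow := (continuous_flowFrom hΦ (anchor C Φ x₀ w k)).tendsto s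
  refine (hflow.mono_left nhdsWithin_le_nhds).congr' ?_
  filter_upwards [Ioo_mem_nhdsLT hs.1] with r hr
  exact (process_eq_flowFrom hw ⟨hr.1.le, hr.2.trans_le hs.2⟩).symm

theorem leftLim_process_eq_process [TopologicalSpace Θ] [DiscreteTopology Θ] (hw : w.IsCounting)
    (hΦ : IsRegularFlow Φ) {s : ℝ} (hs : 0 ≤ s) (hrange : s ∉ range w.T) :
    Function.leftLim (process C Φ x₀ w) s = process C Φ x₀ w s := by
  obtain ⟨k, hk⟩ := hw.exists_mem_Ico hs
  rw [leftLim_process hw hΦ ⟨lt_of_le_of_ne hk.1 fun h => hrange ⟨k, h⟩, hk.2.le⟩,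
    process_eq_flowFrom hw hk]

section JumpSums

variable {t : ℝ}

open Classical in
theorem exists_restrict_jumpMeasure_eq (hw : w.IsCounting) (t : ℝ) :
    ∃ F : Finset ℕ, (∀ k, k ∈ F ↔ w.T (k + 1) ≤ t ∧ Accepts C Φ x₀ w k) ∧
      (jumpMeasure C Φ x₀ w).restrict (Ioc 0 t ×ˢ univ) =
        ∑ k ∈ F, Measure.dirac (w.T (k + 1), (anchor C Φ x₀ w (k + 1)).2) := by
  have hfin : {k | w.T (k + 1) ≤ t ∧ Accepts C Φ x₀ w k}.Finite :=
    ((hw.finite_setOf_le t).preimage (Nat.succ_injective.injOn)).subset fun k hk => hk.1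
  have hmem : ∀ k, k ∈ hfin.toFinset ↔ w.T (k + 1) ≤ t ∧ Accepts C Φ x₀ w k := fun k => by
    rw [Finite.mem_toFinset, mem_ofPred_eq]
  refine ⟨hfin.toFinset, hmem, ?_⟩
  rw [jumpMeasure_eq_sum hw]
  exact restrict_sum_dirac (measurableSet_Ioc.prod MeasurableSet.univ) fun k => by
    rw [hmem, and_comm, mem_prod, mem_Ioc]
    simp only [hw.succ_pos, mem_univ, true_and, and_true]

variable [MeasurableSingletonClass Θ]

theorem integrableOn_jumpMeasure (hw : w.IsCounting) (φ : ℝ × State Θ d → ℝ) :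
    IntegrableOn φ (Ioc 0 t ×ˢ univ) (jumpMeasure C Φ x₀ w) := by
  obtain ⟨F, -, hF⟩ := exists_restrict_jumpMeasure_eq (C := C) (Φ := Φ) (x₀ := x₀) hw t
  rw [IntegrableOn, hF]
  exact integrable_finsetSum_measure.2 fun k _ => integrable_dirac (by simp)

open Classical in
theorem integral_jumpMeasure (hw : w.IsCounting) (φ : ℝ × State Θ d → ℝ) :
    ∫ z in Ioc 0 t ×ˢ univ, φ z ∂(jumpMeasure C Φ x₀ w) = ∑' k,
      if w.T (k + 1) ≤ t ∧ Accepts C Φ x₀ w k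
      then φ (w.T (k + 1), (anchor C Φ x₀ w (k + 1)).2) else 0 := by
  obtain ⟨F, hmem, hF⟩ := exists_restrict_jumpMeasure_eq (C := C) (Φ := Φ) (x₀ := x₀) hw t
  rw [hF, integral_finsetSum_measure fun k _ => integrable_dirac (by simp),
    tsum_eq_sum (s := F) fun k hk => if_neg fun h => hk ((hmem k).2 h)]
  exact Finset.sum_congr rfl fun k hk => by rw [if_pos ((hmem k).1 hk), integral_dirac]

variable (C Φ x₀ w) in
open Classical in
/-- The increment of `g(t, x_t)` at the `(k+1)`-st Poisson point. -/
def jumpSize (g : ℝ → State Θ d → ℝ) (k : ℕ) : ℝ :=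
  if Accepts C Φ x₀ w k then g (w.T (k + 1)) (anchor C Φ x₀ w (k + 1)).2 -
    g (w.T (k + 1)) (arrival C Φ x₀ w k) else 0

theorem integral_jumpIntegrand [TopologicalSpace Θ] [DiscreteTopology Θ] (hw : w.IsCounting)
    (hΦ : IsRegularFlow Φ) (g : ℝ → State Θ d → ℝ) (t : ℝ) :
    ∫ z in Ioc 0 t ×ˢ univ, jumpIntegrand C Φ x₀ w g z ∂(jumpMeasure C Φ x₀ w) =
      ∑' k, if w.T (k + 1) ≤ t then jumpSize C Φ x₀ w g k else 0 := by
  classical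
  rw [integral_jumpMeasure hw]
  refine tsum_congr fun k => ?_
  rw [jumpSize, jumpIntegrand, leftLim_process hw hΦ ⟨hw.strictMono k.lt_succ_self, le_rfl⟩,
    ← arrival, ite_and]

end JumpSums

variable [DiscreteMeasurableSpace Θ] [Countable Θ]

theorem measurable_process (hw : w.IsCounting) (hΦ : IsRegularFlow Φ) :
    Measurable fun s => process C Φ x₀ w (max s 0) := by
  classical
  have hex (s : ℝ) : ∃ k, max s 0 < w.T (k + 1) :=
    (hw.exists_mem_Ico (le_max_right s 0)).imp fun k hk => hk.2
  have hflow (k : ℕ) : Measurable fun s => flowFrom Φ (anchor C Φ x₀ w k) (max s 0) :=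
    (measurable_flowFrom hΦ).comp (f := fun s : ℝ => (anchor C Φ x₀ w k, max s 0)) (by fun_prop)
  convert Measurable.find hflow (p := fun k s => max s 0 < w.T (k + 1))
    (fun k => measurableSet_lt (by fun_prop) measurable_const) hex using 2 with s
  refine process_eq_flowFrom hw ⟨?_, Nat.find_spec (hex s)⟩
  rcases Nat.eq_zero_or_pos (Nat.find (hex s)) with h | h
  · rw [h, hw.zero]
    exact le_max_right _ _
  · obtain ⟨k, hk⟩ := Nat.exists_eq_succ_of_ne_zero h.ne'
    rw [hk]
    exact not_lt.1 (Nat.find_min (hex s) (hk ▸ Nat.lt_succ_self k))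

end Path

/-! ### The compensator -/

section Compensator

variable {Θ : Type*} {d : ℕ} [MeasurableSpace Θ]

theorem JumpCharacteristics.QE_eq_prod_dirac (C : JumpCharacteristics Θ d) (x : State Θ d) :
    C.QE x = (C.Q x).prod (Measure.dirac x.2) := by
  have := C.isMarkovKernel_Q
  exact (Measure.prod_dirac _).symm

/-- The jump kernel `λ(x) Q(x, dy)` on `E`. -/
def JumpCharacteristics.jumpKernel (C : JumpCharacteristics Θ d) :
    Kernel (State Θ d) (State Θ d) :=
  (C.Q ×ₖ Kernel.deterministic Prod.snd measurable_snd).withDensity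
    fun x _ => ENNReal.ofReal (C.rate x)

variable {C : JumpCharacteristics Θ d} {g : ℝ → State Θ d → ℝ}

theorem JumpCharacteristics.jumpKernel_apply (C : JumpCharacteristics Θ d) (x : State Θ d) :
    C.jumpKernel x = ENNReal.ofReal (C.rate x) • C.QE x := by
  have := C.isMarkovKernel_Q
  rw [jumpKernel, Kernel.withDensity_apply _
    (by exact C.measurable_rate.ennreal_ofReal.comp measurable_fst),
    withDensity_const, Kernel.prod_apply, Kernel.deterministic_apply, C.QE_eq_prod_dirac]

theorem JumpCharacteristics.bound_pos (C : JumpCharacteristics Θ d) (x : State Θ d) :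
    0 < C.bound :=
  (C.rate_pos x).trans_le (C.rate_le_bound x)

theorem JumpCharacteristics.measureReal_jumpKernel_univ (C : JumpCharacteristics Θ d)
    (x : State Θ d) : (C.jumpKernel x).real univ = C.rate x := by
  have := C.isMarkovKernel_Q
  rw [C.jumpKernel_apply, C.QE_eq_prod_dirac, measureReal_ennreal_smul_apply, probReal_univ,
    mul_one, ENNReal.toReal_ofReal (C.rate_pos x).le]

instance JumpCharacteristics.isFiniteKernel_jumpKernel (C : JumpCharacteristics Θ d) :
    IsFiniteKernel C.jumpKernel := by
  have := C.isMarkovKernel_Q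
  refine ⟨ENNReal.ofReal C.bound, ENNReal.ofReal_lt_top, fun x => ?_⟩
  rw [C.jumpKernel_apply, C.QE_eq_prod_dirac, Measure.smul_apply, measure_univ, smul_eq_mul,
    mul_one]
  exact ENNReal.ofReal_le_ofReal (C.rate_le_bound x)

theorem opS_eq_integral_jumpKernel (g : ℝ → State Θ d → ℝ) (t : ℝ) (x : State Θ d) :
    opS C g t x = ∫ y, (g t y - g t x) ∂(C.jumpKernel x) := by
  rw [C.jumpKernel_apply, integral_smul_measure, ENNReal.toReal_ofReal (C.rate_pos x).le, opS,
    smul_eq_mul]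

theorem measurable_opS (hg : IsBoundedMeasurable g) :
    Measurable fun z : ℝ × State Θ d => opS C g (max z.1 0) z.2 := by
  simp only [opS_eq_integral_jumpKernel]
  have hdiff : Measurable fun p : (ℝ × State Θ d) × State Θ d =>
      g (max p.1.1 0) p.2 - g (max p.1.1 0) p.1.2 :=
    (hg.measurable.comp (f := fun p : (ℝ × State Θ d) × State Θ d => (p.1.1, p.2))
      (by fun_prop)).sub (hg.measurable.comp measurable_fst)
  exact (hdiff.stronglyMeasurable.integral_kernel_prod_right'
    (κ := C.jumpKernel.comap (Prod.snd : ℝ × State Θ d → _) measurable_snd)).measurable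

theorem abs_opS_le {K : ℝ} (hK : ∀ t, 0 ≤ t → ∀ x, |g t x| ≤ K) {t : ℝ} (ht : 0 ≤ t)
    (x : State Θ d) : |opS C g t x| ≤ 2 * K * C.bound := by
  have hK0 : 0 ≤ K := (abs_nonneg _).trans (hK t ht x)
  rw [opS_eq_integral_jumpKernel]
  have hdiff (y : State Θ d) : ‖g t y - g t x‖ ≤ 2 * K :=
    (norm_sub_le _ _).trans (by rw [two_mul]; exact add_le_add (hK t ht y) (hK t ht x))
  refine (norm_integral_le_of_norm_le_const (ae_of_all _ hdiff)).trans ?_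
  rw [C.measureReal_jumpKernel_univ]
  exact mul_le_mul_of_nonneg_left (C.rate_le_bound x) (by positivity)

theorem restrict_prod_univ_compProd {α β : Type*} [MeasurableSpace α] [MeasurableSpace β]
    (μ : Measure α) [SFinite μ] (κ : Kernel α β) [IsSFiniteKernel κ] {s : Set α}
    (hs : MeasurableSet s) : (μ ⊗ₘ κ).restrict (s ×ˢ univ) = μ.restrict s ⊗ₘ κ := by
  rw [Measure.compProd, ← Kernel.restrict_apply _ (hs.prod MeasurableSet.univ),
    ← Kernel.compProd_restrict_left hs]
  rfl

variable {Φ : FlowFamily Θ d} {x₀ : State Θ d} {w : NoisePath}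
  [DiscreteMeasurableSpace Θ] [Countable Θ]

variable (C x₀) in
/-- The kernel `(s, dy) ↦ λ(x_s) Q(x_s, dy)` along a path. -/
abbrev pathKernel (hw : w.IsCounting) (hΦ : IsRegularFlow Φ) : Kernel ℝ (State Θ d) :=
  C.jumpKernel.comap (fun s => process C Φ x₀ w (max s 0)) (measurable_process hw hΦ)

theorem compensator_eq_compProd (hw : w.IsCounting) (hΦ : IsRegularFlow Φ) :
    compensator C Φ x₀ w =
      volume.restrict (Ici 0) ⊗ₘ pathKernel C x₀ hw hΦ := by
  rw [Measure.compProd_eq_comp_prod, compensator]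
  refine Measure.bind_congr_right ?_
  filter_upwards [ae_restrict_mem measurableSet_Ici] with s hs
  rw [Kernel.prod_apply, Kernel.id_apply, Measure.dirac_prod, Kernel.comap_apply,
    C.jumpKernel_apply, max_eq_left (mem_Ici.1 hs), Measure.map_smul]

theorem restrict_compensator_eq_compProd (hw : w.IsCounting) (hΦ : IsRegularFlow Φ) (t : ℝ) :
    (compensator C Φ x₀ w).restrict (Ioc 0 t ×ˢ univ) =
      volume.restrict (Ioc 0 t) ⊗ₘ pathKernel C x₀ hw hΦ := by
  rw [compensator_eq_compProd hw hΦ, restrict_prod_univ_compProd _ _ measurableSet_Ioc,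
    Measure.restrict_restrict measurableSet_Ioc,
    inter_eq_left.2 (Ioc_subset_Icc_self.trans Icc_subset_Ici_self)]

theorem intervalIntegrable_opS (hw : w.IsCounting) (hΦ : IsRegularFlow Φ)
    (hg : IsBoundedMeasurable g) {a b : ℝ} (ha : 0 ≤ a) (hb : 0 ≤ b) :
    IntervalIntegrable (fun s => opS C g s (process C Φ x₀ w s)) volume a b := by
  obtain ⟨K, hK⟩ := hg.bounded
  have hm : Measurable fun s => opS C g (max s 0) (process C Φ x₀ w (max s 0)) :=
    (measurable_opS hg).comp (measurable_id.prodMk (measurable_process hw hΦ))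
  have hint : IntervalIntegrable (fun s => opS C g (max s 0) (process C Φ x₀ w (max s 0)))
      volume a b :=
    (intervalIntegrable_const (c := 2 * K * C.bound)).mono_fun hm.aestronglyMeasurable
      (ae_of_all _ fun s => (abs_opS_le hK (le_max_right _ _) _).trans (le_abs_self _))
  exact hint.congr fun s hs => by simp only [max_eq_left ((le_min ha hb).trans hs.1.le)]

theorem integrable_jumpIncrement_compProd (hw : w.IsCounting) (hΦ : IsRegularFlow Φ)
    (hg : IsBoundedMeasurable g) (t : ℝ) :
    Integrable (fun z => g (max z.1 0) z.2 - g (max z.1 0) (process C Φ x₀ w (max z.1 0)))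
      (volume.restrict (Ioc 0 t) ⊗ₘ pathKernel C x₀ hw hΦ) := by
  obtain ⟨K, hK⟩ := hg.bounded
  have hm : Measurable fun z : ℝ × State Θ d =>
      g (max z.1 0) z.2 - g (max z.1 0) (process C Φ x₀ w (max z.1 0)) :=
    hg.measurable.sub (hg.measurable.comp
      (measurable_fst.prodMk ((measurable_process hw hΦ).comp measurable_fst)))
  exact .of_bound hm.aestronglyMeasurable (K + K) (ae_of_all _ fun z => (norm_sub_le _ _).trans
    (add_le_add (hK _ (le_max_right _ _) _) (hK _ (le_max_right _ _) _)))

variable [TopologicalSpace Θ] [DiscreteTopology Θ]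

/-- Only countably many left limits differ from the value of the process. -/
theorem jumpIntegrand_ae_eq_compensator (hw : w.IsCounting) (hΦ : IsRegularFlow Φ)
    (g : ℝ → State Θ d → ℝ) (t : ℝ) :
    jumpIntegrand C Φ x₀ w g =ᵐ[(compensator C Φ x₀ w).restrict (Ioc 0 t ×ˢ univ)]
      fun z => g (max z.1 0) z.2 - g (max z.1 0) (process C Φ x₀ w (max z.1 0)) := by
  have hrange : ∀ᵐ s ∂volume.restrict (Ioc 0 t), s ∈ (range w.T)ᶜ ∩ Ioc 0 t := by
    filter_upwards [ae_restrict_mem measurableSet_Ioc,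
      ae_restrict_of_ae ((countable_range w.T).ae_notMem volume)] with s hs hs' using ⟨hs', hs⟩
  rw [restrict_compensator_eq_compProd hw hΦ]
  filter_upwards [Measure.ae_compProd_of_ae_fst _
    ((countable_range w.T).measurableSet.compl.inter measurableSet_Ioc) hrange] with z hz
  rw [jumpIntegrand, leftLim_process_eq_process hw hΦ hz.2.1.le hz.1, max_eq_left hz.2.1.le]

theorem integrableOn_compensator (hw : w.IsCounting) (hΦ : IsRegularFlow Φ)
    (hg : IsBoundedMeasurable g) (t : ℝ) :
    IntegrableOn (jumpIntegrand C Φ x₀ w g) (Ioc 0 t ×ˢ univ) (compensator C Φ x₀ w) := by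
  rw [IntegrableOn, integrable_congr (jumpIntegrand_ae_eq_compensator hw hΦ g t),
    restrict_compensator_eq_compProd hw hΦ]
  exact integrable_jumpIncrement_compProd hw hΦ hg t

theorem integral_compensator (hw : w.IsCounting) (hΦ : IsRegularFlow Φ)
    (hg : IsBoundedMeasurable g) {t : ℝ} (ht : 0 ≤ t) :
    ∫ z in Ioc 0 t ×ˢ univ, jumpIntegrand C Φ x₀ w g z ∂(compensator C Φ x₀ w) =
      ∫ s in (0 : ℝ)..t, opS C g s (process C Φ x₀ w s) := by
  rw [integral_congr_ae (jumpIntegrand_ae_eq_compensator hw hΦ g t),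
    restrict_compensator_eq_compProd hw hΦ,
    Measure.integral_compProd (integrable_jumpIncrement_compProd hw hΦ hg t),
    intervalIntegral.integral_of_le ht]
  refine setIntegral_congr_fun measurableSet_Ioc fun s hs => ?_
  simp only [Kernel.comap_apply, max_eq_left hs.1.le, opS_eq_integral_jumpKernel]

end Compensator

/-! ### The pathwise Itô formula -/

section ChainRule

variable {E : Type*} [NormedAddCommGroup E] [NormedSpace ℝ E]

theorem fderivWithin_prod_univ_apply {G : ℝ × E → ℝ} {S : Set ℝ} {t : ℝ} {ν : E} (ht : t ∈ S)
    (hS : UniqueDiffWithinAt ℝ S t) (hG : DifferentiableWithinAt ℝ G (S ×ˢ univ) (t, ν))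
    (a : ℝ) (y : E) :
    fderivWithin ℝ G (S ×ˢ univ) (t, ν) (a, y) =
      a * derivWithin (fun s => G (s, ν)) S t + fderiv ℝ (fun μ => G (t, μ)) ν y := by
  have htime : HasDerivWithinAt (fun s => G (s, ν)) (fderivWithin ℝ G (S ×ˢ univ) (t, ν) (1, 0)) S
      t :=
    hG.hasFDerivWithinAt.comp_hasDerivWithinAt t
      ((hasDerivWithinAt_id t S).prodMk (hasDerivWithinAt_const t S ν))
      fun s hs => mk_mem_prod hs (mem_univ _)
  have hspace : HasFDerivAt (fun μ => G (t, μ))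
      ((fderivWithin ℝ G (S ×ˢ univ) (t, ν)).comp (ContinuousLinearMap.inr ℝ ℝ E)) ν :=
    (hG.hasFDerivWithinAt.comp ν (hasFDerivAt_prodMk_right t ν).hasFDerivWithinAt
      fun μ _ => mk_mem_prod ht (mem_univ μ)).hasFDerivAt univ_mem
  have hsplit : ((a, y) : ℝ × E) = a • ((1 : ℝ), (0 : E)) + (0, y) := by simp
  rw [htime.derivWithin hS, hspace.fderiv, hsplit, map_add, map_smul, smul_eq_mul]
  rfl

theorem integral_fderivWithin_along_curve {G : ℝ × E → ℝ}
    (hG : ContDiffOn ℝ 1 G (Ici 0 ×ˢ univ)) {a b : ℝ} (ha : 0 ≤ a) (hab : a ≤ b) {y y' : ℝ → E}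
    (hy : ContinuousOn y (Icc a b)) (hy' : ∀ s ∈ Ioo a b, HasDerivWithinAt y (y' s) (Ioi s) s)
    (hint : IntervalIntegrable y' volume a b) :
    IntervalIntegrable (fun s => fderivWithin ℝ G (Ici 0 ×ˢ univ) (s, y s) (1, y' s)) volume a b ∧
      ∫ s in a..b, fderivWithin ℝ G (Ici 0 ×ˢ univ) (s, y s) (1, y' s) =
        G (b, y b) - G (a, y a) := by
  have hmaps : MapsTo (fun s => (s, y s)) (Icc a b) (Ici 0 ×ˢ univ) := fun s hs =>
    mk_mem_prod (ha.trans hs.1) (mem_univ _)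
  have hcurve : ContinuousOn (fun s => (s, y s)) (Icc a b) := continuousOn_id.prodMk hy
  have hD : ContinuousOn (fun s => fderivWithin ℝ G (Ici 0 ×ˢ univ) (s, y s)) (Icc a b) :=
    (hG.continuousOn_fderivWithin ((uniqueDiffOn_Ici 0).prod uniqueDiffOn_univ) le_rfl).comp
      hcurve hmaps
  have hF : IntervalIntegrable (fun s => fderivWithin ℝ G (Ici 0 ×ˢ univ) (s, y s) (1, y' s))
      volume a b := by
    rw [intervalIntegrable_iff_integrableOn_Icc_of_le hab] at hint ⊢
    obtain ⟨K, hK⟩ := isCompact_Icc.exists_bound_of_continuousOn hD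
    have hpair : Integrable (fun s => ((1 : ℝ), y' s)) (volume.restrict (Icc a b)) :=
      (integrable_const _).prodMk hint
    exact (ContinuousLinearMap.apply ℝ ℝ).flip.integrable_of_bilin_of_bdd_left K
      (hD.aestronglyMeasurable measurableSet_Icc) (ae_restrict_of_forall_mem measurableSet_Icc hK)
      hpair
  refine ⟨hF, intervalIntegral.integral_eq_sub_of_hasDeriv_right_of_le hab
    (f := fun s => G (s, y s)) (hG.continuousOn.comp hcurve hmaps) (fun s hs => ?_) hF⟩
  have hs0 : 0 ≤ s := ha.trans hs.1.le
  have hmem : (s, y s) ∈ Ici (0 : ℝ) ×ˢ (univ : Set E) := mk_mem_prod hs0 (mem_univ _)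
  exact (hG.differentiableOn one_ne_zero _ hmem).hasFDerivWithinAt.comp_hasDerivWithinAt s
    ((hasDerivWithinAt_id s (Ioi s)).prodMk (hy' s hs))
    fun r hr => mk_mem_prod (hs0.trans (mem_Ioi.1 hr).le) (mem_univ _)

variable {Θ : Type*} {d : ℕ} {g : ℝ → State Θ d → ℝ}

/-- `g` is continuously differentiable in `(t, ν)` on `ℝ₊ × ℝ^d`, for every `θ`. -/
def IsC1 (g : ℝ → State Θ d → ℝ) : Prop :=
  ∀ θ, ContDiffOn ℝ 1 (fun z : ℝ × EuclideanSpace ℝ (Fin d) => g z.1 (θ, z.2)) (Ici 0 ×ˢ univ)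

theorem IsC1.dt_add_dν (hg : IsC1 g) {t : ℝ} (ht : 0 ≤ t) (x : State Θ d)
    (y : EuclideanSpace ℝ (Fin d)) :
    dt g t x + dν g t x y = fderivWithin ℝ (fun z : ℝ × EuclideanSpace ℝ (Fin d) =>
      g z.1 (x.1, z.2)) (Ici 0 ×ˢ univ) (t, x.2) (1, y) := by
  have hmem : t ∈ Ici (0 : ℝ) := ht
  rw [fderivWithin_prod_univ_apply hmem (uniqueDiffOn_Ici 0 t hmem)
    ((hg x.1).differentiableOn one_ne_zero _ (mk_mem_prod ht (mem_univ _))), one_mul]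
  rfl

theorem IsC1.isBoundedMeasurable [MeasurableSpace Θ] [DiscreteMeasurableSpace Θ] [Countable Θ]
    (hg : IsC1 g) (hbdd : ∃ K : ℝ, ∀ t, 0 ≤ t → ∀ x, |g t x| ≤ K) : IsBoundedMeasurable g :=
  isBoundedMeasurable_of_continuousOn (fun θ => (hg θ).continuousOn) hbdd

/-- `v` is the right derivative in time of the flow `Φ`, integrable along each trajectory. -/
structure HasVelocity (Φ v : FlowFamily Θ d) : Prop where
  hasDerivWithinAt : ∀ θ ν t, 0 ≤ t → HasDerivWithinAt (fun s => Φ θ s ν) (v θ t ν) (Ioi t) t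
  intervalIntegrable : ∀ θ ν t, 0 ≤ t → IntervalIntegrable (fun s => v θ s ν) volume 0 t

variable {Φ v : FlowFamily Θ d}

theorem HasVelocity.hasDerivWithinAt_flowFrom (hv : HasVelocity Φ v) (r : ℝ × State Θ d) {s : ℝ}
    (hs : r.1 ≤ s) :
    HasDerivWithinAt (fun u => (flowFrom Φ r u).2) (v r.2.1 (s - r.1) r.2.2) (Ioi s) s := by
  have hshift := (hv.hasDerivWithinAt r.2.1 r.2.2 (s - r.1) (sub_nonneg.2 hs)).scomp s
    (h := fun u => u - r.1) (h' := (1 : ℝ)) ((hasDerivWithinAt_id s (Ioi s)).sub_const r.1)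
    fun u hu => sub_lt_sub_right (mem_Ioi.1 hu) r.1
  rw [one_smul] at hshift
  refine hshift.congr (fun u hu => ?_) ?_
  · rw [flowFrom_of_le (hs.trans (mem_Ioi.1 hu).le), Function.comp_apply]
  · rw [flowFrom_of_le hs, Function.comp_apply]

theorem HasVelocity.intervalIntegrable_shift (hv : HasVelocity Φ v) (r : ℝ × State Θ d)
    {a b : ℝ} (ha : r.1 ≤ a) (hb : r.1 ≤ b) :
    IntervalIntegrable (fun s => v r.2.1 (s - r.1) r.2.2) volume a b := by
  have h : IntervalIntegrable (fun s => v r.2.1 s r.2.2) volume (a - r.1) (b - r.1) :=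
    (hv.intervalIntegrable _ _ _ (sub_nonneg.2 ha)).symm.trans
      (hv.intervalIntegrable _ _ _ (sub_nonneg.2 hb))
  simpa only [sub_add_cancel] using h.comp_sub_right r.1

theorem integral_along_flow (hΦ : IsRegularFlow Φ) (hv : HasVelocity Φ v) (hg : IsC1 g)
    (r : ℝ × State Θ d) {a b : ℝ} (ha : 0 ≤ a) (hra : r.1 ≤ a) (hab : a ≤ b) :
    IntervalIntegrable (fun s => dt g s (flowFrom Φ r s) +
        dν g s (flowFrom Φ r s) (v r.2.1 (s - r.1) r.2.2)) volume a b ∧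
      ∫ s in a..b, (dt g s (flowFrom Φ r s) + dν g s (flowFrom Φ r s) (v r.2.1 (s - r.1) r.2.2)) =
        g b (flowFrom Φ r b) - g a (flowFrom Φ r a) := by
  obtain ⟨hint, heq⟩ := integral_fderivWithin_along_curve (hg r.2.1) ha hab
    (continuous_flowFrom_snd hΦ r).continuousOn
    (fun s hs => hv.hasDerivWithinAt_flowFrom r (hra.trans hs.1.le))
    (hv.intervalIntegrable_shift r hra (hra.trans hab))
  have hchain : ∀ s : ℝ, 0 ≤ s → _ := fun s hs => hg.dt_add_dν hs (flowFrom Φ r s)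
    (v r.2.1 (s - r.1) r.2.2)
  refine ⟨hint.congr fun s hs => (hchain s ?_).symm, ?_⟩
  · rw [uIoc_of_le hab] at hs
    exact ha.trans hs.1.le
  · refine (intervalIntegral.integral_congr fun s hs => hchain s ?_).trans heq
    rw [uIcc_of_le hab] at hs
    exact ha.trans hs.1

end ChainRule

section PathwiseIto

variable {Θ : Type*} {d : ℕ} [MeasurableSpace Θ]
  {C : JumpCharacteristics Θ d} {Φ v : FlowFamily Θ d} {x₀ : State Θ d} {w : NoisePath}
  {g : ℝ → State Θ d → ℝ}

variable (C Φ v x₀ w g) in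
/-- The derivative of `g(s, x_s)` along the flow between the jumps. -/
def driftAlong (s : ℝ) : ℝ :=
  dt g s (process C Φ x₀ w s) + dν g s (process C Φ x₀ w s)
    (v (process C Φ x₀ w s).1 (s - lastJump C Φ x₀ w s)
      (postJump C Φ x₀ w (jumpIndex C Φ x₀ w s)).2)

theorem integral_driftAlong_piece (hw : w.IsCounting) (hΦ : IsRegularFlow Φ)
    (hv : HasVelocity Φ v) (hg : IsC1 g) {k : ℕ} {t : ℝ} (ht : t ∈ Icc (w.T k) (w.T (k + 1))) :
    IntervalIntegrable (driftAlong C Φ v x₀ w g) volume (w.T k) t ∧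
      ∫ s in (w.T k)..t, driftAlong C Φ v x₀ w g s =
        g t (flowFrom Φ (anchor C Φ x₀ w k) t) -
          g (w.T k) (flowFrom Φ (anchor C Φ x₀ w k) (w.T k)) := by
  obtain ⟨hint, heq⟩ := integral_along_flow hΦ hv hg (anchor C Φ x₀ w k) (hw.nonneg k)
    (anchor_fst_le hw k) ht.1
  have hdrift : ∀ᵐ s ∂volume, s ∈ uIoc (w.T k) t →
      dt g s (flowFrom Φ (anchor C Φ x₀ w k) s) + dν g s (flowFrom Φ (anchor C Φ x₀ w k) s)
        (v (anchor C Φ x₀ w k).2.1 (s - (anchor C Φ x₀ w k).1) (anchor C Φ x₀ w k).2.2) =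
      driftAlong C Φ v x₀ w g s := by
    filter_upwards [Measure.ae_ne volume t] with s hne hs
    rw [uIoc_of_le ht.1] at hs
    have hs' : s ∈ Ico (w.T k) (w.T (k + 1)) :=
      ⟨hs.1.le, (lt_of_le_of_ne hs.2 hne).trans_le ht.2⟩
    rw [driftAlong, process_eq_flowFrom hw hs', lastJump_eq hw hs', postJump_jumpIndex hw hs']
    rfl
  refine ⟨hint.congr_ae ((ae_restrict_iff' measurableSet_uIoc).2 hdrift), ?_⟩
  rw [← heq]
  exact intervalIntegral.integral_congr_ae (hdrift.mono fun s hs h => (hs h).symm)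

theorem flowFrom_anchor_succ (hΦ : IsRegularFlow Φ) (k : ℕ) :
    g (w.T (k + 1)) (flowFrom Φ (anchor C Φ x₀ w (k + 1)) (w.T (k + 1))) =
      g (w.T (k + 1)) (flowFrom Φ (anchor C Φ x₀ w k) (w.T (k + 1))) +
        jumpSize C Φ x₀ w g k := by
  by_cases h : Accepts C Φ x₀ w k
  · have hself := flowFrom_self hΦ (anchor C Φ x₀ w (k + 1))
    have htime : (anchor C Φ x₀ w (k + 1)).1 = w.T (k + 1) := by rw [anchor_succ_of_accepts h]
    rw [htime] at hself
    rw [hself, jumpSize, if_pos h, arrival, add_sub_cancel]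
  · rw [anchor_succ_of_not_accepts h, jumpSize, if_neg h, add_zero]

theorem integral_driftAlong_points (hw : w.IsCounting) (hΦ : IsRegularFlow Φ)
    (hv : HasVelocity Φ v) (hg : IsC1 g) (k : ℕ) :
    IntervalIntegrable (driftAlong C Φ v x₀ w g) volume 0 (w.T k) ∧
      g (w.T k) (flowFrom Φ (anchor C Φ x₀ w k) (w.T k)) =
        g 0 x₀ + (∫ s in (0 : ℝ)..(w.T k), driftAlong C Φ v x₀ w g s) +
          ∑ j ∈ Finset.range k, jumpSize C Φ x₀ w g j := by
  induction k with
  | zero =>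
    have hstart : flowFrom Φ (anchor C Φ x₀ w 0) 0 = x₀ := flowFrom_self hΦ (0, x₀)
    rw [hw.zero, hstart, intervalIntegral.integral_same, Finset.sum_range_zero, add_zero, add_zero]
    exact ⟨IntervalIntegrable.refl, rfl⟩
  | succ k ih =>
    obtain ⟨hint, heq⟩ := integral_driftAlong_piece (C := C) (x₀ := x₀) hw hΦ hv hg (k := k)
      ⟨hw.monotone k.le_succ, le_rfl⟩
    refine ⟨ih.1.trans hint, ?_⟩
    rw [← intervalIntegral.integral_add_adjacent_intervals ih.1 hint, heq,
      flowFrom_anchor_succ (g := g) hΦ, ih.2, Finset.sum_range_succ]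
    ring

open Classical in
theorem tsum_points_le_eq_sum {M : Type*} [AddCommMonoid M] [TopologicalSpace M]
    (hw : w.IsCounting) {k : ℕ} {t : ℝ} (ht : t ∈ Ico (w.T k) (w.T (k + 1))) (a : ℕ → M) :
    (∑' j, if w.T (j + 1) ≤ t then a j else 0) = ∑ j ∈ Finset.range k, a j := by
  have hiff (j : ℕ) : w.T (j + 1) ≤ t ↔ j ∈ Finset.range k := by
    rw [Finset.mem_range]
    refine ⟨fun h => ?_, fun h => (hw.monotone h).trans ht.1⟩
    exact Nat.succ_lt_succ_iff.1 (hw.strictMono.lt_iff_lt.1 (h.trans_lt ht.2))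
  rw [tsum_eq_sum (s := Finset.range k) fun j hj => if_neg fun h => hj ((hiff j).1 h)]
  exact Finset.sum_congr rfl fun j hj => if_pos ((hiff j).2 hj)

open Classical in
theorem integral_driftAlong (hw : w.IsCounting) (hΦ : IsRegularFlow Φ)
    (hv : HasVelocity Φ v) (hg : IsC1 g) {t : ℝ} (ht : 0 ≤ t) :
    IntervalIntegrable (driftAlong C Φ v x₀ w g) volume 0 t ∧
      g t (process C Φ x₀ w t) =
        g 0 x₀ + (∫ s in (0 : ℝ)..t, driftAlong C Φ v x₀ w g s) +
          ∑' k, if w.T (k + 1) ≤ t then jumpSize C Φ x₀ w g k else 0 := by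
  obtain ⟨k, hk⟩ := hw.exists_mem_Ico ht
  obtain ⟨hint, heq⟩ := integral_driftAlong_points (C := C) (x₀ := x₀) hw hΦ hv hg k
  obtain ⟨hint', heq'⟩ := integral_driftAlong_piece (C := C) (x₀ := x₀) hw hΦ hv hg
    (Ico_subset_Icc_self hk)
  refine ⟨hint.trans hint', ?_⟩
  rw [tsum_points_le_eq_sum hw hk, process_eq_flowFrom hw hk,
    ← intervalIntegral.integral_add_adjacent_intervals hint hint', heq', heq]
  ring

variable [DiscreteMeasurableSpace Θ] [Countable Θ] [TopologicalSpace Θ] [DiscreteTopology Θ]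

open Classical in
theorem martingalePart_eq (hw : w.IsCounting) (hΦ : IsRegularFlow Φ) (hg : IsBoundedMeasurable g)
    {t : ℝ} (ht : 0 ≤ t) :
    martingalePart C Φ x₀ w g t =
      (∑' k, if w.T (k + 1) ≤ t then jumpSize C Φ x₀ w g k else 0) -
        ∫ s in (0 : ℝ)..t, opS C g s (process C Φ x₀ w s) := by
  rw [martingalePart, compensatedIntegral, integral_jumpIntegrand hw hΦ,
    integral_compensator hw hΦ hg ht]

theorem ito_path (hw : w.IsCounting) (hΦ : IsRegularFlow Φ) (hv : HasVelocity Φ v)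
    (hg : IsC1 g) (hg' : IsBoundedMeasurable g) {t : ℝ} (ht : 0 ≤ t) :
    IntervalIntegrable (fun s => driftAlong C Φ v x₀ w g s + opS C g s (process C Φ x₀ w s))
        volume 0 t ∧
      g t (process C Φ x₀ w t) = g 0 x₀ +
        (∫ s in (0 : ℝ)..t, (driftAlong C Φ v x₀ w g s + opS C g s (process C Φ x₀ w s))) +
          martingalePart C Φ x₀ w g t := by
  obtain ⟨hint, heq⟩ := integral_driftAlong (C := C) (x₀ := x₀) hw hΦ hv hg ht
  have hint' := intervalIntegrable_opS (C := C) (x₀ := x₀) hw hΦ hg' le_rfl ht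
  refine ⟨hint.add hint', ?_⟩
  rw [martingalePart_eq hw hΦ hg' ht, intervalIntegral.integral_add hint hint', heq]
  ring

end PathwiseIto

/-! ### One step of the thinning -/

section ExponentialLaw

variable {r : ℝ}

theorem measureReal_expMeasure_Ioi (hr : 0 < r) {ρ : ℝ} (hρ : 0 ≤ ρ) :
    (expMeasure r).real (Ioi ρ) = Real.exp (-(r * ρ)) := by
  have := isProbabilityMeasure_expMeasure hr
  have hcdf := cdf_expMeasure_eq hr ρ
  rw [cdf_eq_real, if_pos hρ] at hcdf
  rw [← compl_Iic, probReal_compl_eq_one_sub measurableSet_Iic, hcdf, sub_sub_cancel]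

theorem integral_expMeasure_eq_setIntegral_Ioi (hr : 0 < r) (b : ℝ → ℝ) :
    ∫ σ, b σ ∂(expMeasure r) = r * ∫ ρ in Ioi 0, Real.exp (-(r * ρ)) * b ρ := by
  have hpdf : Measurable (exponentialPDF r) := (measurable_exponentialPDFReal r).ennreal_ofReal
  rw [show expMeasure r = volume.withDensity (exponentialPDF r) from rfl,
    integral_withDensity_eq_integral_toReal_smul hpdf (ae_of_all _ fun _ => ENNReal.ofReal_lt_top),
    ← integral_const_mul, integral_Ici_eq_integral_Ioi.symm,
    ← integral_indicator measurableSet_Ici]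
  congr with ρ
  rcases lt_or_ge ρ 0 with hρ | hρ
  · rw [exponentialPDF_of_neg hρ, indicator_of_notMem (by simpa using hρ), ENNReal.toReal_zero,
      zero_smul]
  · rw [exponentialPDF_of_nonneg hρ, indicator_of_mem (by simpa using hρ),
      ENNReal.toReal_ofReal (by positivity), smul_eq_mul, mul_assoc]

/-- Fubini: both sides integrate `b` against the tail `P(σ > ρ) = exp (-r ρ)`. -/
theorem integral_expMeasure_eq_mul_integral_primitive (hr : 0 < r) {b : ℝ → ℝ}
    (hb : Integrable b volume) :
    ∫ σ, b σ ∂(expMeasure r) = r * ∫ σ, (∫ ρ in Ioc 0 σ, b ρ) ∂(expMeasure r) := by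
  have := isProbabilityMeasure_expMeasure hr
  have hprimitive (σ : ℝ) : ∫ ρ in Ioc 0 σ, b ρ = ∫ ρ in Ioi 0, (Iio σ).indicator b ρ := by
    rw [integral_Ioc_eq_integral_Ioo, setIntegral_indicator measurableSet_Iio, Ioi_inter_Iio]
  have hindicator : (Function.uncurry fun σ ρ => (Iio σ).indicator b ρ) =
      {z : ℝ × ℝ | z.2 < z.1}.indicator fun z => b z.2 := by
    ext ⟨σ, ρ⟩
    simp [indicator]
  have hinteg : Integrable (Function.uncurry fun σ ρ => (Iio σ).indicator b ρ)
      ((expMeasure r).prod (volume.restrict (Ioi 0))) := by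
    rw [hindicator]
    exact (hb.restrict.comp_snd (expMeasure r)).indicator
      (measurableSet_lt measurable_snd measurable_fst)
  have htail (ρ : ℝ) (hρ : ρ ∈ Ioi (0 : ℝ)) :
      ∫ σ, (Iio σ).indicator b ρ ∂(expMeasure r) = Real.exp (-(r * ρ)) * b ρ := by
    have heq : (fun σ => (Iio σ).indicator b ρ) = (Ioi ρ).indicator fun _ => b ρ := by
      ext σ
      simp [indicator]
    rw [heq, integral_indicator measurableSet_Ioi, setIntegral_const,
      measureReal_expMeasure_Ioi hr (mem_Ioi.1 hρ).le, smul_eq_mul]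
  simp only [hprimitive]
  rw [integral_integral_swap hinteg, integral_expMeasure_eq_setIntegral_Ioi hr,
    setIntegral_congr_fun measurableSet_Ioi htail]

theorem measurable_setIntegral_Ioc {α : Type*} [MeasurableSpace α] {b : α → ℝ → ℝ}
    (hb : Measurable (Function.uncurry b)) {l u : α → ℝ} (hl : Measurable l) (hu : Measurable u) :
    Measurable fun a => ∫ ρ in Ioc (l a) (u a), b a ρ := by
  have hset : MeasurableSet {z : α × ℝ | z.2 ∈ Ioc (l z.1) (u z.1)} :=
    (measurableSet_lt (hl.comp measurable_fst) measurable_snd).inter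
      (measurableSet_le measurable_snd (hu.comp measurable_fst))
  simp only [← integral_indicator (measurableSet_Ioc (α := ℝ))]
  exact (hb.indicator hset).stronglyMeasurable.integral_prod_right' (ν := volume) |>.measurable

/-- The uniform law on `[0,1]`, the common law of the marks `U_k` and `V_k`. -/
abbrev uniformLaw : Measure ℝ := volume.restrict (Icc (0 : ℝ) 1)

instance isProbabilityMeasure_uniformLaw : IsProbabilityMeasure uniformLaw := ⟨by simp⟩

/-- The joint law of the noise `(T*_{k+1} - T*_k, U_{k+1}, V_{n+1})` that decides about one
Poisson point: an exponential waiting time and two uniform marks. -/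
def stepLaw (r : ℝ) : Measure (ℝ × ℝ × ℝ) :=
  (expMeasure r).prod (uniformLaw.prod uniformLaw)

theorem isProbabilityMeasure_stepLaw (hr : 0 < r) : IsProbabilityMeasure (stepLaw r) := by
  have := isProbabilityMeasure_expMeasure hr
  rw [stepLaw]
  infer_instance

/-- A mark whose mean given the waiting time `σ` is `b σ / r` is compensated by `∫_0^σ b`. -/
theorem integral_stepLaw_sub_primitive_eq_zero (hr : 0 < r) {J : ℝ × ℝ × ℝ → ℝ} {b : ℝ → ℝ}
    (hJ : Integrable J (stepLaw r)) (hb : Integrable b volume) (hbm : Measurable b)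
    (hmean : ∀ σ, ∫ z, J (σ, z) ∂(uniformLaw.prod uniformLaw) = b σ / r) :
    ∫ z, (J z - ∫ ρ in Ioc 0 z.1, b ρ) ∂(stepLaw r) = 0 := by
  have := isProbabilityMeasure_expMeasure hr
  have hprimitive : Integrable (fun σ => ∫ ρ in Ioc 0 σ, b ρ) (expMeasure r) :=
    .of_bound (measurable_setIntegral_Ioc (b := fun _ => b) (hbm.comp measurable_snd)
      measurable_const measurable_id).aestronglyMeasurable (∫ ρ, ‖b ρ‖) (ae_of_all _ fun σ =>
        (norm_integral_le_integral_norm _).trans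
          (setIntegral_le_integral hb.norm (ae_of_all _ fun _ => norm_nonneg _)))
  have hmark : ∫ z, J z ∂(stepLaw r) = ∫ σ, (∫ ρ in Ioc 0 σ, b ρ) ∂(expMeasure r) := by
    rw [stepLaw, integral_prod _ hJ]
    simp only [hmean]
    rw [integral_div, integral_expMeasure_eq_mul_integral_primitive hr hb,
      mul_div_cancel_left₀ _ hr.ne']
  have hcomp : ∫ z : ℝ × ℝ × ℝ, (∫ ρ in Ioc 0 z.1, b ρ) ∂(stepLaw r) =
      ∫ σ, (∫ ρ in Ioc 0 σ, b ρ) ∂(expMeasure r) := by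
    rw [stepLaw, integral_fun_fst (fun σ => ∫ ρ in Ioc 0 σ, b ρ), probReal_univ, one_smul]
  rw [integral_sub hJ (hprimitive.comp_fst _), hmark, hcomp, sub_self]

end ExponentialLaw

section Marks

variable {Θ : Type*} {d : ℕ} [MeasurableSpace Θ]
  {C : JumpCharacteristics Θ d} {g : ℝ → State Θ d → ℝ}

variable (C g) in
open Classical in
/-- The increment of `g` at a proposed jump at time `t` from the state `y`, decided by the
uniform variables `u` (acceptance) and `v` (new mode). Times are cut off at `0` because `g` is
only controlled on `[0, ∞[`. -/
def mark (t : ℝ) (y : State Θ d) (u v : ℝ) : ℝ :=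
  if u * C.bound ≤ C.rate y then g (max t 0) (C.H y v, y.2) - g (max t 0) y else 0

theorem abs_mark_le {K : ℝ} (hK : ∀ t, 0 ≤ t → ∀ x, |g t x| ≤ K) (t : ℝ) (y : State Θ d)
    (u v : ℝ) : |mark C g t y u v| ≤ 2 * K := by
  have hK0 : 0 ≤ K := (abs_nonneg _).trans (hK _ (le_max_right t 0) y)
  rw [mark]
  split_ifs
  · rw [two_mul]
    exact (abs_sub _ _).trans (add_le_add (hK _ (le_max_right t 0) _) (hK _ (le_max_right t 0) _))
  · simpa using hK0

theorem measureReal_uniformLaw_setOf_accept (y : State Θ d) :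
    uniformLaw.real {u | u * C.bound ≤ C.rate y} = C.rate y / C.bound := by
  have hpos := C.bound_pos y
  have hset : {u | u * C.bound ≤ C.rate y} = Iic (C.rate y / C.bound) := by
    ext u
    exact (le_div_iff₀ hpos).symm
  rw [hset, measureReal_restrict_apply measurableSet_Iic, inter_comm, ← Ici_inter_Iic, inter_assoc,
    Iic_inter_Iic, min_eq_right ((div_le_one hpos).2 (C.rate_le_bound y)), Ici_inter_Iic,
    Real.volume_real_Icc_of_le (by have := C.rate_pos y; positivity), sub_zero]

variable [DiscreteMeasurableSpace Θ]

theorem measurable_mark (hg : IsBoundedMeasurable g) :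
    Measurable fun z : (ℝ × State Θ d) × ℝ × ℝ => mark C g z.1.1 z.1.2 z.2.1 z.2.2 := by
  have hH : Measurable fun z : (ℝ × State Θ d) × ℝ × ℝ => C.H z.1.2 z.2.2 :=
    C.measurable_H.comp (measurable_fst.snd.prodMk measurable_snd.snd)
  refine Measurable.ite (measurableSet_le (measurable_snd.fst.mul_const _)
    (C.measurable_rate.comp measurable_fst.snd)) (Measurable.sub ?_ ?_) measurable_const
  · exact hg.measurable.comp (measurable_fst.fst.prodMk (hH.prodMk measurable_fst.snd.snd))
  · exact hg.measurable.comp measurable_fst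

theorem integral_uniformLaw_comp_H (φ : State Θ d → ℝ) (y : State Θ d) :
    ∫ v, φ (C.H y v, y.2) ∂uniformLaw = ∫ x, φ x ∂(C.QE y) := by
  have hH : Measurable (C.H y) := C.measurable_H.comp measurable_prodMk_left
  have hemb : MeasurableEmbedding fun θ : Θ => (θ, y.2) := measurableEmbedding_prod_mk_right _
  rw [JumpCharacteristics.QE, hemb.integral_map, ← C.map_H y,
    integral_map hH.aemeasurable Measurable.of_discrete.aestronglyMeasurable]

theorem integral_mark (g : ℝ → State Θ d → ℝ) (t : ℝ) (y : State Θ d) :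
    ∫ z : ℝ × ℝ, mark C g t y z.1 z.2 ∂(uniformLaw.prod uniformLaw) =
      opS C g (max t 0) y / C.bound := by
  have hprod : (fun z : ℝ × ℝ => mark C g t y z.1 z.2) = fun z =>
      {u | u * C.bound ≤ C.rate y}.indicator 1 z.1 *
        (g (max t 0) (C.H y z.2, y.2) - g (max t 0) y) := by
    ext z
    by_cases h : z.1 * C.bound ≤ C.rate y <;> simp [mark, h]
  rw [hprod, integral_prod_mul ({u | u * C.bound ≤ C.rate y}.indicator (1 : ℝ → ℝ))
      (fun v => g (max t 0) (C.H y v, y.2) - g (max t 0) y),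
    integral_indicator_one (measurableSet_le (by fun_prop) measurable_const),
    measureReal_uniformLaw_setOf_accept,
    integral_uniformLaw_comp_H (fun x => g (max t 0) x - g (max t 0) y), opS]
  ring

end Marks

/-! ### The past of a Poisson point -/

section Noise

variable {Ω : Type*} {mΩ : MeasurableSpace Ω} {P : Measure Ω} {lam : ℝ} {W : Ω → NoisePath}

theorem IsThinningNoise.isCounting (hW : IsThinningNoise P lam W) (ω : Ω) : (W ω).IsCounting :=
  ⟨hW.T_zero ω, hW.T_strictMono ω, hW.T_tendsto ω⟩

variable (W) in
/-- The independent variables that make up the noise: the waiting times, the `U_k` and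
the `V_k`. -/
def noiseVar (i : Fin 3 × ℕ) (ω : Ω) : ℝ :=
  ![(W ω).T (i.2 + 1) - (W ω).T i.2, (W ω).U (i.2 + 1), (W ω).V (i.2 + 1)] i.1

theorem IsThinningNoise.measurable_time (hW : IsThinningNoise P lam W) (k : ℕ) :
    Measurable fun ω => (W ω).T k := by
  cases k with
  | zero => simpa only [hW.T_zero] using measurable_const
  | succ k => exact hW.measurable_T k

theorem IsThinningNoise.measurable_noiseVar (hW : IsThinningNoise P lam W) (i : Fin 3 × ℕ) :
    Measurable (noiseVar W i) := by
  obtain ⟨i, j⟩ := i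
  fin_cases i
  · exact (hW.measurable_T j).sub (hW.measurable_time j)
  · exact hW.measurable_U j
  · exact hW.measurable_V j

/-- The indices of the noise used up to the `k`-th Poisson point when `n` points are accepted:
a mark `V` is only consumed at an acceptance. -/
def pastIndices (k n : ℕ) : Set (Fin 3 × ℕ) := {i | i.2 < if i.1 = 2 then n else k}

variable (W) in
/-- The σ-algebra of `T*_j`, `U_j` for `j ≤ k` and `V_j` for `j ≤ n`. -/
@[reducible]
def pastSigma (k n : ℕ) : MeasurableSpace Ω :=
  ⨆ i ∈ pastIndices k n, MeasurableSpace.comap (noiseVar W i) inferInstance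

theorem pastSigma_mono {k n k' n' : ℕ} (hk : k ≤ k') (hn : n ≤ n') :
    pastSigma W k n ≤ pastSigma W k' n' := by
  refine biSup_mono fun i hi => ?_
  simp only [pastIndices, mem_ofPred_eq] at hi ⊢
  split_ifs at hi ⊢ <;> omega

theorem IsThinningNoise.pastSigma_le (hW : IsThinningNoise P lam W) (k n : ℕ) :
    pastSigma W k n ≤ mΩ :=
  iSup₂_le fun i _ => (hW.measurable_noiseVar i).comap_le

theorem measurable_noiseVar_of_mem {I : Set (Fin 3 × ℕ)} {i : Fin 3 × ℕ} (hi : i ∈ I) :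
    Measurable[⨆ i ∈ I, MeasurableSpace.comap (noiseVar W i) inferInstance] (noiseVar W i) :=
  .of_comap_le (le_biSup (fun i => MeasurableSpace.comap (noiseVar W i) inferInstance) hi)

theorem IsThinningNoise.measurable_time_pastSigma (hW : IsThinningNoise P lam W) {j k : ℕ} (n : ℕ)
    (hj : j ≤ k) : Measurable[pastSigma W k n] fun ω => (W ω).T j := by
  induction j with
  | zero => simpa only [hW.T_zero] using measurable_const
  | succ j ih =>
    have hincr : Measurable[pastSigma W k n] (noiseVar W (0, j)) :=
      measurable_noiseVar_of_mem (by simpa [pastIndices] using Nat.lt_of_succ_le hj)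
    have heq : (fun ω => (W ω).T (j + 1)) = fun ω => (W ω).T j + noiseVar W (0, j) ω := by
      ext ω
      simp [noiseVar]
    rw [heq]
    exact (ih (by omega)).add hincr

theorem measurable_U_pastSigma {j k : ℕ} (n : ℕ) (hj : j < k) :
    Measurable[pastSigma W k n] fun ω => (W ω).U (j + 1) :=
  measurable_noiseVar_of_mem (i := (1, j)) (by simpa [pastIndices] using hj)

theorem measurable_V_pastSigma {j n : ℕ} (k : ℕ) (hj : j < n) :
    Measurable[pastSigma W k n] fun ω => (W ω).V (j + 1) :=
  measurable_noiseVar_of_mem (i := (2, j)) (by simpa [pastIndices] using hj)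

variable (W) in
/-- The noise that decides about the `(k+1)`-st Poisson point when `n` points were accepted. -/
def stepNoise (k n : ℕ) (ω : Ω) : ℝ × ℝ × ℝ :=
  (noiseVar W (0, k) ω, noiseVar W (1, k) ω, noiseVar W (2, n) ω)

theorem IsThinningNoise.measurable_stepNoise (hW : IsThinningNoise P lam W) (k n : ℕ) :
    Measurable (stepNoise W k n) :=
  (hW.measurable_noiseVar _).prodMk ((hW.measurable_noiseVar _).prodMk (hW.measurable_noiseVar _))

theorem IsThinningNoise.indepFun_stepNoise (hW : IsThinningNoise P lam W) {α : Type*}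
    {mα : MeasurableSpace α} {k n : ℕ} {X : Ω → α} (hX : Measurable[pastSigma W k n] X) :
    IndepFun X (stepNoise W k n) P := by
  have hdisj : Disjoint (pastIndices k n) {(0, k), (1, k), (2, n)} := by
    rw [Set.disjoint_right]
    rintro i (rfl | rfl | rfl) <;> simp [pastIndices]
  have hindep := indep_iSup_of_disjoint (fun i => (hW.measurable_noiseVar i).comap_le)
    ((iIndepFun_iff_iIndep _ (noiseVar W) _).1 hW.indep) hdisj
  rw [IndepFun_iff_Indep]
  refine indep_of_indep_of_le_left (indep_of_indep_of_le_right hindep (Measurable.comap_le ?_))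
    hX.comap_le
  exact (measurable_noiseVar_of_mem (by simp)).prodMk
    ((measurable_noiseVar_of_mem (by simp)).prodMk (measurable_noiseVar_of_mem (by simp)))

variable [IsProbabilityMeasure P]

theorem IsThinningNoise.map_stepNoise (hW : IsThinningNoise P lam W) (k n : ℕ) :
    P.map (stepNoise W k n) = stepLaw lam := by
  have hind : iIndepFun (noiseVar W) P := hW.indep
  have hm := hW.measurable_noiseVar
  have hmarks : IndepFun (noiseVar W (1, k)) (noiseVar W (2, n)) P := hind.indepFun (by simp)
  have htime : IndepFun (noiseVar W (0, k))
      (fun ω => (noiseVar W (1, k) ω, noiseVar W (2, n) ω)) P :=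
    (hind.indepFun_prodMk hm (1, k) (2, n) (0, k) (by simp) (by simp)).symm
  have htime_law : P.map (noiseVar W (0, k)) = expMeasure lam := (hW.law_T k).map_eq
  have hU_law : P.map (noiseVar W (1, k)) = uniformLaw := (hW.law_U k).map_eq
  have hV_law : P.map (noiseVar W (2, n)) = uniformLaw := (hW.law_V n).map_eq
  rw [stepLaw, ← htime_law]
  nth_rw 1 [← hU_law]
  rw [← hV_law, ← (indepFun_iff_map_prod_eq_prod_map_map (hm _).aemeasurable
    (hm _).aemeasurable).1 hmarks]
  exact (indepFun_iff_map_prod_eq_prod_map_map (hm _).aemeasurable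
    ((hm _).prodMk (hm _)).aemeasurable).1 htime

/-- Averaging over the noise of the next step, which is independent of the past. -/
theorem IsThinningNoise.integral_stepNoise_eq_zero (hW : IsThinningNoise P lam W) {α : Type*}
    {mα : MeasurableSpace α} {k n : ℕ} {X : Ω → α} (hX : Measurable[pastSigma W k n] X)
    {F : α × ℝ × ℝ × ℝ → ℝ} (hF : Measurable F)
    (hint : Integrable (fun ω => F (X ω, stepNoise W k n ω)) P)
    (hzero : ∀ a, ∫ z, F (a, z) ∂(stepLaw lam) = 0) :
    ∫ ω, F (X ω, stepNoise W k n ω) ∂P = 0 := by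
  have hXm : Measurable X := hX.mono (hW.pastSigma_le k n) le_rfl
  have hS := hW.measurable_stepNoise k n
  have hpair : AEMeasurable (fun ω => (X ω, stepNoise W k n ω)) P := (hXm.prodMk hS).aemeasurable
  have := Measure.isProbabilityMeasure_map (μ := P) hS.aemeasurable
  have hlaw := (indepFun_iff_map_prod_eq_prod_map_map hXm.aemeasurable hS.aemeasurable).1
    (hW.indepFun_stepNoise hX)
  have hint' := (integrable_map_measure hF.aestronglyMeasurable hpair).2 hint
  rw [← integral_map hpair hF.aestronglyMeasurable]
  rw [hlaw] at hint' ⊢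
  rw [integral_prod _ hint', hW.map_stepNoise]
  simp only [hzero, integral_zero]

end Noise

section PointFiltration

variable {Θ : Type*} {d : ℕ} [MeasurableSpace Θ] {C : JumpCharacteristics Θ d}
  {Φ : FlowFamily Θ d} {x₀ : State Θ d}
  {Ω : Type*} {mΩ : MeasurableSpace Ω} {P : Measure Ω} {lam : ℝ} {W : Ω → NoisePath}

theorem measurableSet_accept [DiscreteMeasurableSpace Θ] [Countable Θ] {α : Type*}
    {_ : MeasurableSpace α} (hΦ : IsRegularFlow Φ) {r : α → ℝ × State Θ d} {t u : α → ℝ}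
    (hr : Measurable r) (ht : Measurable t) (hu : Measurable u) :
    MeasurableSet {a | u a * C.bound ≤ C.rate (flowFrom Φ (r a) (t a))} :=
  measurableSet_le (hu.mul_const _)
    (C.measurable_rate.comp ((measurable_flowFrom hΦ).comp (hr.prodMk ht)))

theorem measurable_newAnchor [DiscreteMeasurableSpace Θ] [Countable Θ] {α : Type*}
    {_ : MeasurableSpace α} (hΦ : IsRegularFlow Φ) {r : α → ℝ × State Θ d} {t v : α → ℝ}
    (hr : Measurable r) (ht : Measurable t) (hv : Measurable v) :
    Measurable fun a => (t a, (C.H (flowFrom Φ (r a) (t a)) (v a),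
      (flowFrom Φ (r a) (t a)).2)) := by
  have hf : Measurable fun a => flowFrom Φ (r a) (t a) :=
    (measurable_flowFrom hΦ).comp (hr.prodMk ht)
  exact ht.prodMk ((C.measurable_H.comp (hf.prodMk hv)).prodMk hf.snd)

variable (C Φ x₀ W) in
open Classical in
/-- The anchor after `k` Poisson points on the event that `n` of them were accepted, and a constant
off that event. This makes it a function of the noise in `pastSigma W k n` alone. -/
def truncatedAnchor (k n : ℕ) (ω : Ω) : ℝ × State Θ d :=
  if acceptCount C Φ x₀ (W ω) k = n then anchor C Φ x₀ (W ω) k else (0, x₀)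

theorem truncatedAnchor_of_eq {k n : ℕ} {ω : Ω} (h : acceptCount C Φ x₀ (W ω) k = n) :
    truncatedAnchor C Φ x₀ W k n ω = anchor C Φ x₀ (W ω) k :=
  if_pos h

theorem setOf_acceptCount_succ_eq_zero (k : ℕ) :
    {ω | acceptCount C Φ x₀ (W ω) (k + 1) = 0} =
      {ω | acceptCount C Φ x₀ (W ω) k = 0 ∧ ¬ Accepts C Φ x₀ (W ω) k} := by
  ext ω
  by_cases h : Accepts C Φ x₀ (W ω) k
  · simp [acceptCount_succ_of_accepts h, h]
  · simp [acceptCount_succ_of_not_accepts h, h]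

theorem setOf_acceptCount_succ_eq_succ (k n : ℕ) :
    {ω | acceptCount C Φ x₀ (W ω) (k + 1) = n + 1} =
      {ω | acceptCount C Φ x₀ (W ω) k = n + 1 ∧ ¬ Accepts C Φ x₀ (W ω) k} ∪
        {ω | acceptCount C Φ x₀ (W ω) k = n ∧ Accepts C Φ x₀ (W ω) k} := by
  ext ω
  by_cases h : Accepts C Φ x₀ (W ω) k
  · simp [acceptCount_succ_of_accepts h, h]
  · simp [acceptCount_succ_of_not_accepts h, h]

open Classical in
theorem truncatedAnchor_succ_zero (k : ℕ) :
    truncatedAnchor C Φ x₀ W (k + 1) 0 = fun ω =>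
      if acceptCount C Φ x₀ (W ω) k = 0 ∧ ¬ Accepts C Φ x₀ (W ω) k
      then truncatedAnchor C Φ x₀ W k 0 ω else (0, x₀) := by
  ext1 ω
  by_cases h : Accepts C Φ x₀ (W ω) k
  · simp [truncatedAnchor, acceptCount_succ_of_accepts h, h]
  · by_cases h' : acceptCount C Φ x₀ (W ω) k = 0 <;>
      simp [truncatedAnchor, acceptCount_succ_of_not_accepts h, anchor_succ_of_not_accepts h, h, h']

open Classical in
theorem truncatedAnchor_succ_succ (k n : ℕ) :
    truncatedAnchor C Φ x₀ W (k + 1) (n + 1) = fun ω =>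
      let y := flowFrom Φ (truncatedAnchor C Φ x₀ W k n ω) ((W ω).T (k + 1))
      if acceptCount C Φ x₀ (W ω) k = n + 1 ∧ ¬ Accepts C Φ x₀ (W ω) k
      then truncatedAnchor C Φ x₀ W k (n + 1) ω
      else if acceptCount C Φ x₀ (W ω) k = n ∧ Accepts C Φ x₀ (W ω) k
      then ((W ω).T (k + 1), (C.H y ((W ω).V (n + 1)), y.2))
      else (0, x₀) := by
  ext1 ω
  by_cases h : Accepts C Φ x₀ (W ω) k
  · by_cases h' : acceptCount C Φ x₀ (W ω) k = n <;>
      simp [truncatedAnchor, acceptCount_succ_of_accepts h, anchor_succ_of_accepts h, arrival, h,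
        h']
  · by_cases h' : acceptCount C Φ x₀ (W ω) k = n + 1 <;>
      simp [truncatedAnchor, acceptCount_succ_of_not_accepts h, anchor_succ_of_not_accepts h, h, h']

variable [DiscreteMeasurableSpace Θ] [Countable Θ]

theorem measurableSet_acceptCount_eq_and_accepts (hW : IsThinningNoise P lam W)
    (hΦ : IsRegularFlow Φ) {k n : ℕ}
    (hcount : MeasurableSet[pastSigma W k n] {ω | acceptCount C Φ x₀ (W ω) k = n})
    (hanchor : Measurable[pastSigma W k n] (truncatedAnchor C Φ x₀ W k n)) :
    MeasurableSet[pastSigma W (k + 1) n]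
      {ω | acceptCount C Φ x₀ (W ω) k = n ∧ Accepts C Φ x₀ (W ω) k} := by
  have haccept := measurableSet_accept (C := C) hΦ
    (hanchor.mono (pastSigma_mono k.le_succ le_rfl) le_rfl)
    (hW.measurable_time_pastSigma n le_rfl) (measurable_U_pastSigma n k.lt_succ_self)
  convert (pastSigma_mono k.le_succ le_rfl _ hcount).inter haccept using 1
  ext ω
  refine and_congr_right fun h => ?_
  rw [mem_ofPred_eq, truncatedAnchor_of_eq h, Accepts, arrival]

theorem measurable_truncatedAnchor_and_count (hW : IsThinningNoise P lam W)
    (hΦ : IsRegularFlow Φ) (k n : ℕ) :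
    MeasurableSet[pastSigma W k n] {ω | acceptCount C Φ x₀ (W ω) k = n} ∧
      Measurable[pastSigma W k n] (truncatedAnchor C Φ x₀ W k n) := by
  classical
  induction k generalizing n with
  | zero =>
    have hconst : truncatedAnchor C Φ x₀ W 0 n = fun _ => (0, x₀) := by
      ext1 ω
      exact ite_self _
    rw [hconst]
    exact ⟨MeasurableSet.const (0 = n), measurable_const⟩
  | succ k ih =>
    have hold (n : ℕ) : Measurable[pastSigma W (k + 1) n] (truncatedAnchor C Φ x₀ W k n) :=
      (ih n).2.mono (pastSigma_mono k.le_succ le_rfl) le_rfl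
    have hyes (n : ℕ) := measurableSet_acceptCount_eq_and_accepts hW hΦ (ih n).1 (ih n).2
    have hno (n : ℕ) : MeasurableSet[pastSigma W (k + 1) n]
        {ω | acceptCount C Φ x₀ (W ω) k = n ∧ ¬ Accepts C Φ x₀ (W ω) k} := by
      convert (pastSigma_mono k.le_succ le_rfl _ (ih n).1).diff (hyes n) using 1
      ext ω
      simp +contextual
    cases n with
    | zero =>
      rw [setOf_acceptCount_succ_eq_zero, truncatedAnchor_succ_zero]
      exact ⟨hno 0, Measurable.ite (hno 0) (hold 0) measurable_const⟩
    | succ n =>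
      have hyes' := pastSigma_mono le_rfl n.le_succ _ (hyes n)
      rw [setOf_acceptCount_succ_eq_succ, truncatedAnchor_succ_succ]
      refine ⟨(hno (n + 1)).union hyes', Measurable.ite (hno (n + 1)) (hold (n + 1))
        (Measurable.ite hyes' ?_ measurable_const)⟩
      exact measurable_newAnchor hΦ ((hold n).mono (pastSigma_mono le_rfl n.le_succ) le_rfl)
        (hW.measurable_time_pastSigma _ le_rfl) (measurable_V_pastSigma _ n.lt_succ_self)

theorem measurableSet_acceptCount_eq (hW : IsThinningNoise P lam W) (hΦ : IsRegularFlow Φ)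
    (k n : ℕ) : MeasurableSet[pastSigma W k n] {ω | acceptCount C Φ x₀ (W ω) k = n} :=
  (measurable_truncatedAnchor_and_count hW hΦ k n).1

theorem measurable_truncatedAnchor (hW : IsThinningNoise P lam W) (hΦ : IsRegularFlow Φ)
    (k n : ℕ) : Measurable[pastSigma W k n] (truncatedAnchor C Φ x₀ W k n) :=
  (measurable_truncatedAnchor_and_count hW hΦ k n).2

/-- The filtration `n ↦ pastSigma W k n`, in which `acceptCount k` is a stopping time. -/
def pastFiltration (hW : IsThinningNoise P lam W) (k : ℕ) : Filtration ℕ mΩ where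
  seq n := pastSigma W k n
  mono' _ _ h := pastSigma_mono le_rfl h
  le' n := hW.pastSigma_le k n

theorem isStoppingTime_acceptCount (hW : IsThinningNoise P lam W) (C : JumpCharacteristics Θ d)
    (x₀ : State Θ d) (hΦ : IsRegularFlow Φ) (k : ℕ) :
    IsStoppingTime (pastFiltration hW k) fun ω => WithTop.some (acceptCount C Φ x₀ (W ω) k) :=
  isStoppingTime_of_measurableSet_eq fun n => by
    simp only [WithTop.coe_inj]
    exact measurableSet_acceptCount_eq hW hΦ k n

/-- The history up to the `k`-th Poisson point: the events that, when `n` points were accepted,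
only depend on `T*_j`, `U_j` for `j ≤ k` and on `V_j` for `j ≤ n`. -/
abbrev pointSigma (hW : IsThinningNoise P lam W) (C : JumpCharacteristics Θ d) (x₀ : State Θ d)
    (hΦ : IsRegularFlow Φ) (k : ℕ) : MeasurableSpace Ω :=
  (isStoppingTime_acceptCount hW C x₀ hΦ k).measurableSpace

theorem measurableSet_pointSigma_iff (hW : IsThinningNoise P lam W) (hΦ : IsRegularFlow Φ) {k : ℕ}
    {B : Set Ω} : MeasurableSet[pointSigma hW C x₀ hΦ k] B ↔
      ∀ n, MeasurableSet[pastSigma W k n] (B ∩ {ω | acceptCount C Φ x₀ (W ω) k = n}) := by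
  have hτ := isStoppingTime_acceptCount hW C x₀ hΦ k
  have hslice (n : ℕ) : MeasurableSet[pointSigma hW C x₀ hΦ k]
      (B ∩ {ω | acceptCount C Φ x₀ (W ω) k = n}) ↔
        MeasurableSet[pastSigma W k n] (B ∩ {ω | acceptCount C Φ x₀ (W ω) k = n}) := by
    have h := hτ.measurableSet_inter_eq_iff B n
    simp only [WithTop.coe_inj] at h
    exact h
  refine ⟨fun hB n => (hslice n).1 (hB.inter ?_), fun h => ?_⟩
  · simpa only [WithTop.coe_inj] using hτ.measurableSet_eq_of_countable' n
  · have hunion : B = ⋃ n, B ∩ {ω | acceptCount C Φ x₀ (W ω) k = n} := by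
      ext ω
      simp
    rw [hunion]
    exact MeasurableSet.iUnion fun n => (hslice n).2 (h n)

theorem pastSigma_zero_le_pointSigma (hW : IsThinningNoise P lam W) (hΦ : IsRegularFlow Φ)
    (k : ℕ) : pastSigma W k 0 ≤ pointSigma hW C x₀ hΦ k :=
  (isStoppingTime_acceptCount hW C x₀ hΦ k).le_measurableSpace_of_const_le fun _ => bot_le

theorem measurable_acceptCount_anchor (hW : IsThinningNoise P lam W) (hΦ : IsRegularFlow Φ)
    (k : ℕ) : Measurable[pointSigma hW C x₀ hΦ k] fun ω =>
      (acceptCount C Φ x₀ (W ω) k, anchor C Φ x₀ (W ω) k) := by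
  intro D hD
  refine (measurableSet_pointSigma_iff hW hΦ).2 fun n => ?_
  have hpre : MeasurableSet[pastSigma W k n]
      ((fun ω => (n, truncatedAnchor C Φ x₀ W k n ω)) ⁻¹' D) :=
    (measurable_const.prodMk (measurable_truncatedAnchor hW hΦ k n)) hD
  convert hpre.inter (measurableSet_acceptCount_eq (C := C) (x₀ := x₀) hW hΦ k n) using 1
  ext ω
  refine and_congr_left fun h => ?_
  rw [mem_preimage, mem_preimage, truncatedAnchor_of_eq h,
    show acceptCount C Φ x₀ (W ω) k = n from h]

theorem pointSigma_mono (hW : IsThinningNoise P lam W) (hΦ : IsRegularFlow Φ) :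
    Monotone (pointSigma hW C x₀ hΦ) := by
  refine monotone_nat_of_le_succ fun k B hB => (measurableSet_pointSigma_iff hW hΦ).2 fun n => ?_
  have hle (ω : Ω) : acceptCount C Φ x₀ (W ω) k ≤ acceptCount C Φ x₀ (W ω) (k + 1) := by
    by_cases h : Accepts C Φ x₀ (W ω) k
    · exact (Nat.le_succ _).trans_eq (acceptCount_succ_of_accepts h).symm
    · exact (acceptCount_succ_of_not_accepts h).ge
  have hunion : B ∩ {ω | acceptCount C Φ x₀ (W ω) (k + 1) = n} =
      ⋃ m ≤ n, (B ∩ {ω | acceptCount C Φ x₀ (W ω) k = m}) ∩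
        {ω | acceptCount C Φ x₀ (W ω) (k + 1) = n} := by
    ext ω
    simp only [mem_inter_iff, mem_ofPred_eq, mem_iUnion, exists_prop]
    exact ⟨fun ⟨hB, h⟩ => ⟨_, h ▸ hle ω, ⟨hB, rfl⟩, h⟩, fun ⟨_, _, ⟨hB, _⟩, h⟩ => ⟨hB, h⟩⟩
  rw [hunion]
  exact MeasurableSet.iUnion fun m => MeasurableSet.iUnion fun hm =>
    (pastSigma_mono k.le_succ hm _ ((measurableSet_pointSigma_iff hW hΦ).1 hB m)).inter
      (measurableSet_acceptCount_eq hW hΦ (k + 1) n)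

end PointFiltration

theorem integrable_of_hasSum {α : Type*} {mα : MeasurableSpace α} {μ : Measure α}
    {F : ℕ → α → ℝ} {S : α → ℝ} (hF : ∀ k, Integrable (F k) μ)
    (hsum : Summable fun k => ∫ a, ‖F k a‖ ∂μ) (hS : ∀ a, HasSum (fun k => F k a) (S a)) :
    Integrable S μ := by
  refine ⟨aestronglyMeasurable_of_tendsto_ae atTop
    (fun n => Finset.aestronglyMeasurable_fun_sum (Finset.range n) fun k _ => (hF k).1)
    (ae_of_all _ fun a => (hS a).tendsto_sum_nat), ?_⟩
  calc ∫⁻ a, ‖S a‖ₑ ∂μ ≤ ∫⁻ a, ∑' k, ‖F k a‖ₑ ∂μ :=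
        lintegral_mono fun a => (hS a).tsum_eq ▸ enorm_tsum_le_tsum_enorm
    _ = ∑' k, ENNReal.ofReal (∫ a, ‖F k a‖ ∂μ) := by
        rw [lintegral_tsum fun k => (hF k).1.enorm]
        simp only [ofReal_integral_norm_eq_lintegral_enorm (hF _)]
    _ < ⊤ := hsum.tsum_ofReal_lt_top

section PoissonCount

variable {Ω : Type*} {mΩ : MeasurableSpace Ω} {P : Measure Ω} {lam : ℝ}
  {W : Ω → NoisePath}

theorem IsThinningNoise.mgf_noiseVar (hW : IsThinningNoise P lam W) (hlam : 0 < lam) (k : ℕ) :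
    mgf (noiseVar W (0, k)) P (-1) = lam / (lam + 1) := by
  have hlaw : P.map (noiseVar W (0, k)) = expMeasure lam := (hW.law_T k).map_eq
  have hexp (ρ : ℝ) : Real.exp (-(lam * ρ)) * Real.exp (-1 * ρ) = Real.exp (-(lam + 1) * ρ) := by
    rw [← Real.exp_add]
    ring_nf
  rw [← mgf_id_map (hW.measurable_noiseVar _).aemeasurable, hlaw, mgf,
    integral_expMeasure_eq_setIntegral_Ioi hlam]
  simp only [id_eq, hexp]
  rw [integral_exp_mul_Ioi (by linarith), mul_zero, Real.exp_zero, neg_div_neg_eq, mul_one_div]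

variable [IsProbabilityMeasure P]

/-- Chernoff's bound, with the Laplace transform of the time of the `k`-th Poisson point at `1`. -/
theorem IsThinningNoise.measureReal_time_le (hW : IsThinningNoise P lam W) (hlam : 0 < lam)
    (t : ℝ) (k : ℕ) : P.real {ω | (W ω).T k ≤ t} ≤ Real.exp t * (lam / (lam + 1)) ^ k := by
  have hsum : (fun ω => (W ω).T k) = ∑ j ∈ Finset.range k, noiseVar W (0, j) := by
    ext ω
    simp [noiseVar, Finset.sum_range_sub (fun j => (W ω).T j), hW.T_zero]
  have hindep : iIndepFun (fun j => noiseVar W (0, j)) P :=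
    hW.indep.precomp (g := fun j : ℕ => ((0 : Fin 3), j)) fun _ _ h => (Prod.ext_iff.1 h).2
  have hmgf : mgf (fun ω => (W ω).T k) P (-1) = (lam / (lam + 1)) ^ k := by
    rw [hsum, hindep.mgf_sum fun j => hW.measurable_noiseVar _]
    simp only [hW.mgf_noiseVar hlam, Finset.prod_const, Finset.card_range]
  have hint : Integrable (fun ω => Real.exp (-1 * (W ω).T k)) P := by
    by_contra h
    exact (pow_pos (by positivity) k).ne' (hmgf ▸ mgf_undef h)
  simpa [hmgf] using measure_le_le_exp_mul_mgf t (by norm_num) hint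

theorem IsThinningNoise.summable_measureReal_time_le (hW : IsThinningNoise P lam W)
    (hlam : 0 < lam) (t : ℝ) : Summable fun k => P.real {ω | (W ω).T k ≤ t} :=
  .of_nonneg_of_le (fun _ => measureReal_nonneg) (hW.measureReal_time_le hlam t) <|
    (summable_geometric_of_lt_one (by positivity)
      ((div_lt_one (by linarith)).2 (by linarith))).mul_left _

end PoissonCount

section Increments

variable {Θ : Type*} {d : ℕ} [MeasurableSpace Θ] {C : JumpCharacteristics Θ d}
  {Φ : FlowFamily Θ d} {x₀ : State Θ d} {w : NoisePath} {g : ℝ → State Θ d → ℝ}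

variable (C Φ x₀ w g) in
/-- The increment over `]s, t]` of the compensated integral between two Poisson points. -/
def increment (s t : ℝ) (k : ℕ) : ℝ :=
  (Ioc s t).indicator (fun _ => jumpSize C Φ x₀ w g k) (w.T (k + 1)) -
    ∫ ρ in Ioc (w.T k) (w.T (k + 1)) ∩ Ioc s t, opS C g ρ (process C Φ x₀ w ρ)

variable (C Φ g) in
/-- The increment as a function of the past, `z.1`, and of the noise of the step, `z.2`. -/
def stepIncrement (s t : ℝ) (z : (ℝ × ℝ × State Θ d) × ℝ × ℝ × ℝ) : ℝ :=
  (Ioc s t).indicator (fun τ => mark C g τ (flowFrom Φ z.1.2 τ) z.2.2.1 z.2.2.2) (z.1.1 + z.2.1) -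
    ∫ ρ in Ioc 0 z.2.1,
      (Ioc s t).indicator (fun τ => opS C g (max τ 0) (flowFrom Φ z.1.2 τ)) (z.1.1 + ρ)

theorem jumpSize_eq_mark (hw : w.IsCounting) (k : ℕ) :
    jumpSize C Φ x₀ w g k = mark C g (w.T (k + 1)) (arrival C Φ x₀ w k) (w.U (k + 1))
      (w.V (acceptCount C Φ x₀ w k + 1)) := by
  by_cases h : Accepts C Φ x₀ w k
  · rw [jumpSize, mark, if_pos h, if_pos (by exact h), anchor_succ_of_accepts h,
      max_eq_left (hw.nonneg _)]
  · rw [jumpSize, mark, if_neg h, if_neg (by exact h)]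

theorem setIntegral_Ioc_comp_add_left (c : ℝ → ℝ) {a b : ℝ} (hab : a ≤ b) :
    ∫ ρ in Ioc 0 (b - a), c (a + ρ) = ∫ ρ in Ioc a b, c ρ := by
  rw [← intervalIntegral.integral_of_le (sub_nonneg.2 hab),
    intervalIntegral.integral_comp_add_left, ← intervalIntegral.integral_of_le (by linarith),
    add_zero, add_sub_cancel]

theorem increment_eq_stepIncrement (hw : w.IsCounting) (s t : ℝ) (k : ℕ) :
    increment C Φ x₀ w g s t k = stepIncrement C Φ g s t ((w.T k, anchor C Φ x₀ w k),
      (w.T (k + 1) - w.T k, w.U (k + 1), w.V (acceptCount C Φ x₀ w k + 1))) := by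
  simp only [increment, stepIncrement, add_sub_cancel]
  congr 1
  · by_cases h : w.T (k + 1) ∈ Ioc s t
    · rw [indicator_of_mem h, indicator_of_mem h, jumpSize_eq_mark hw, arrival]
    · rw [indicator_of_notMem h, indicator_of_notMem h]
  · rw [setIntegral_Ioc_comp_add_left _ (hw.monotone k.le_succ),
      setIntegral_indicator measurableSet_Ioc]
    refine setIntegral_congr_ae (measurableSet_Ioc.inter measurableSet_Ioc) ?_
    filter_upwards [compl_mem_ae_iff.2 (measure_singleton (w.T (k + 1)))] with ρ hne hρ
    rw [process_eq_flowFrom hw ⟨hρ.1.1.le, lt_of_le_of_ne hρ.1.2 hne⟩,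
      max_eq_left ((hw.nonneg k).trans hρ.1.1.le)]

theorem increment_eq_zero_of_notMem {s t : ℝ} {k : ℕ} (hw : w.IsCounting)
    (h : w.T (k + 1) ≤ s ∨ t < w.T k) : increment C Φ x₀ w g s t k = 0 := by
  have hk := hw.monotone k.le_succ
  have hnotMem : w.T (k + 1) ∉ Ioc s t := fun h' => by
    rcases h with h | h
    · exact h'.1.not_ge h
    · exact (h.trans_le hk).not_ge h'.2
  have hempty : Ioc (w.T k) (w.T (k + 1)) ∩ Ioc s t = ∅ := by
    rw [Ioc_inter_Ioc, Ioc_eq_empty]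
    rcases h with h | h <;> grind
  rw [increment, indicator_of_notMem hnotMem, hempty, setIntegral_empty, sub_zero]

theorem abs_increment_le (hw : w.IsCounting) {K : ℝ} (hK : ∀ t, 0 ≤ t → ∀ x, |g t x| ≤ K)
    {s t : ℝ} (hs : 0 ≤ s) (hst : s ≤ t) (k : ℕ) :
    |increment C Φ x₀ w g s t k| ≤
      {k | w.T k ≤ t}.indicator (fun _ => 2 * K + 2 * K * C.bound * (t - s)) k := by
  have hK0 : 0 ≤ K := (abs_nonneg _).trans (hK 0 le_rfl x₀)
  have hbound := C.bound_pos x₀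
  by_cases h : w.T k ≤ t
  swap
  · rw [increment_eq_zero_of_notMem hw (.inr (not_le.1 h)), abs_zero,
      indicator_of_notMem (by exact h)]
  rw [indicator_of_mem (by exact h)]
  have hjump : |(Ioc s t).indicator (fun _ => jumpSize C Φ x₀ w g k) (w.T (k + 1))| ≤ 2 * K := by
    refine (norm_indicator_le_norm_self (fun _ => jumpSize C Φ x₀ w g k) _).trans ?_
    rw [jumpSize_eq_mark hw]
    exact abs_mark_le hK _ _ _ _
  have hdrift : |∫ ρ in Ioc (w.T k) (w.T (k + 1)) ∩ Ioc s t, opS C g ρ (process C Φ x₀ w ρ)| ≤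
      2 * K * C.bound * (t - s) := by
    have hfinite : volume (Ioc (w.T k) (w.T (k + 1)) ∩ Ioc s t) < ⊤ :=
      measure_inter_lt_top_of_right_ne_top (by simp)
    refine (norm_setIntegral_le_of_norm_le_const (C := 2 * K * C.bound) hfinite
      (f := fun ρ => opS C g ρ (process C Φ x₀ w ρ))
      fun ρ hρ => abs_opS_le hK (hs.trans hρ.2.1.le) _).trans ?_
    gcongr
    refine (measureReal_mono inter_subset_right (by simp)).trans_eq ?_
    rw [Real.volume_real_Ioc_of_le hst]
  exact (abs_sub _ _).trans (add_le_add hjump hdrift)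

section Measurability

variable [DiscreteMeasurableSpace Θ] [Countable Θ]

theorem measurable_stepIncrement (hΦ : IsRegularFlow Φ) (hg : IsBoundedMeasurable g) (s t : ℝ) :
    Measurable (stepIncrement C Φ g s t) := by
  have hflow := measurable_flowFrom hΦ
  have htime : Measurable fun z : (ℝ × ℝ × State Θ d) × ℝ × ℝ × ℝ => z.1.1 + z.2.1 := by fun_prop
  have htime' : Measurable fun z : ((ℝ × ℝ × State Θ d) × ℝ × ℝ × ℝ) × ℝ => z.1.1.1 + z.2 := by
    fun_prop
  have hmark : Measurable fun z : (ℝ × ℝ × State Θ d) × ℝ × ℝ × ℝ =>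
      mark C g (z.1.1 + z.2.1) (flowFrom Φ z.1.2 (z.1.1 + z.2.1)) z.2.2.1 z.2.2.2 :=
    (measurable_mark hg).comp ((htime.prodMk (hflow.comp (measurable_fst.snd.prodMk htime))).prodMk
      measurable_snd.snd)
  have hopS : Measurable fun z : ((ℝ × ℝ × State Θ d) × ℝ × ℝ × ℝ) × ℝ =>
      opS C g (max (z.1.1.1 + z.2) 0) (flowFrom Φ z.1.1.2 (z.1.1.1 + z.2)) :=
    (measurable_opS hg).comp (htime'.prodMk (hflow.comp (measurable_fst.fst.snd.prodMk htime')))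
  exact (hmark.indicator (htime measurableSet_Ioc)).sub
    (measurable_setIntegral_Ioc (b := fun (z : (ℝ × ℝ × State Θ d) × ℝ × ℝ × ℝ) ρ =>
        (Ioc s t).indicator (fun τ => opS C g (max τ 0) (flowFrom Φ z.1.2 τ)) (z.1.1 + ρ))
      (hopS.indicator (htime' measurableSet_Ioc)) measurable_const measurable_snd.fst)

theorem integral_stepIncrement (hΦ : IsRegularFlow Φ) (hg : IsBoundedMeasurable g) (s t : ℝ)
    (a : ℝ × ℝ × State Θ d) :
    ∫ z, stepIncrement C Φ g s t (a, z) ∂(stepLaw C.bound) = 0 := by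
  have hpos := C.bound_pos a.2.2
  have := isProbabilityMeasure_stepLaw hpos
  obtain ⟨K, hK⟩ := hg.bounded
  have hflow : Measurable fun τ => flowFrom Φ a.2 τ :=
    (measurable_flowFrom hΦ).comp measurable_prodMk_left
  have htime : Measurable fun z : ℝ × ℝ × ℝ => a.1 + z.1 := by fun_prop
  have hmark : Measurable fun z : ℝ × ℝ × ℝ =>
      mark C g (a.1 + z.1) (flowFrom Φ a.2 (a.1 + z.1)) z.2.1 z.2.2 :=
    (measurable_mark hg).comp ((htime.prodMk (hflow.comp htime)).prodMk measurable_snd)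
  have hopS : Measurable fun τ => opS C g (max τ 0) (flowFrom Φ a.2 τ) :=
    (measurable_opS hg).comp (measurable_id.prodMk hflow)
  have hopS_int : Integrable
      ((Ioc s t).indicator fun τ => opS C g (max τ 0) (flowFrom Φ a.2 τ)) volume :=
    (integrable_indicator_iff measurableSet_Ioc).2 <| Integrable.of_bound
      hopS.aestronglyMeasurable (2 * K * C.bound)
      (ae_of_all _ fun τ => abs_opS_le hK (le_max_right _ _) _)
  refine integral_stepLaw_sub_primitive_eq_zero hpos
    (J := fun z => (Ioc s t).indicator
      (fun τ => mark C g τ (flowFrom Φ a.2 τ) z.2.1 z.2.2) (a.1 + z.1))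
    (.of_bound (hmark.indicator (htime measurableSet_Ioc)).aestronglyMeasurable (2 * K)
      (ae_of_all _ fun z => ?_))
    (hopS_int.comp_add_left a.1) ((hopS.indicator measurableSet_Ioc).comp (by fun_prop)) fun σ => ?_
  · exact (norm_indicator_le_norm_self _ _).trans (abs_mark_le hK _ _ _ _)
  · by_cases h : a.1 + σ ∈ Ioc s t <;> simp [h, integral_mark]

end Measurability

theorem hasSum_indicator_jumpSize (hw : w.IsCounting) {s t : ℝ} (hst : s ≤ t) :
    HasSum (fun k => (Ioc s t).indicator (fun _ => jumpSize C Φ x₀ w g k) (w.T (k + 1)))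
      ((∑' k, if w.T (k + 1) ≤ t then jumpSize C Φ x₀ w g k else 0) -
        ∑' k, if w.T (k + 1) ≤ s then jumpSize C Φ x₀ w g k else 0) := by
  have hsum (t : ℝ) : Summable fun k => if w.T (k + 1) ≤ t then jumpSize C Φ x₀ w g k else 0 :=
    summable_of_hasFiniteSupport ((hw.finite_setOf_le t).subset fun k hk => by
      by_contra h
      exact hk (if_neg fun h' => h ((hw.monotone k.le_succ).trans h')))
  refine ((hsum t).hasSum.sub (hsum s).hasSum).congr_fun fun k => ?_
  by_cases h : w.T (k + 1) ≤ s
  · simp [h, h.trans hst, not_lt.2 h]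
  · simp [indicator, h, not_le.1 h]

theorem iUnion_Ioc_inter_Ioc (hw : w.IsCounting) {s : ℝ} (hs : 0 ≤ s) (t : ℝ) :
    ⋃ k, Ioc (w.T k) (w.T (k + 1)) ∩ Ioc s t = Ioc s t := by
  rw [← iUnion_inter, inter_eq_right]
  intro ρ hρ
  obtain ⟨k, hk⟩ := hw.exists_mem_Ico (hs.trans hρ.1.le)
  rcases hk.1.eq_or_lt with h | h
  · cases k with
    | zero => exact absurd (hw.zero ▸ h) (hs.trans_lt hρ.1).ne
    | succ k => exact mem_iUnion.2 ⟨k, h ▸ hw.strictMono k.lt_succ_self, h.ge⟩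
  · exact mem_iUnion.2 ⟨k, h, hk.2.le⟩

theorem hasSum_increment [TopologicalSpace Θ] [DiscreteTopology Θ] [DiscreteMeasurableSpace Θ]
    [Countable Θ] (hw : w.IsCounting) (hΦ : IsRegularFlow Φ)
    (hg : IsBoundedMeasurable g) {s t : ℝ} (hs : 0 ≤ s) (hst : s ≤ t) :
    HasSum (increment C Φ x₀ w g s t)
      (martingalePart C Φ x₀ w g t - martingalePart C Φ x₀ w g s) := by
  have hdisj : Pairwise (Function.onFun Disjoint fun k =>
      Ioc (w.T k) (w.T (k + 1)) ∩ Ioc s t) := fun i j hij =>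
    (hw.monotone.pairwise_disjoint_on_Ioc_succ hij).mono inter_subset_left inter_subset_left
  have hint := intervalIntegrable_opS (C := C) (x₀ := x₀) hw hΦ hg hs (hs.trans hst)
  have hdrift := hasSum_integral_iUnion (μ := volume)
    (f := fun ρ => opS C g ρ (process C Φ x₀ w ρ))
    (fun k => measurableSet_Ioc.inter measurableSet_Ioc) hdisj
    (by rwa [iUnion_Ioc_inter_Ioc hw hs, ← intervalIntegrable_iff_integrableOn_Ioc_of_le hst])
  rw [iUnion_Ioc_inter_Ioc hw hs, ← intervalIntegral.integral_of_le hst] at hdrift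
  rw [martingalePart_eq hw hΦ hg (hs.trans hst), martingalePart_eq hw hΦ hg hs,
    ← intervalIntegral.integral_add_adjacent_intervals
      (intervalIntegrable_opS (C := C) (x₀ := x₀) hw hΦ hg le_rfl hs) hint,
    sub_sub_sub_comm, add_sub_cancel_left]
  exact (hasSum_indicator_jumpSize hw hst).sub hdrift

end Increments

/-! ### The martingale property -/

section JumpFiltration

variable {Θ : Type*} {d : ℕ} [MeasurableSpace Θ] {C : JumpCharacteristics Θ d}
  {Φ : FlowFamily Θ d} {x₀ : State Θ d} {w : NoisePath}

theorem accepts_iff_acceptCount_succ {k : ℕ} :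
    Accepts C Φ x₀ w k ↔ acceptCount C Φ x₀ w (k + 1) = acceptCount C Φ x₀ w k + 1 := by
  by_cases h : Accepts C Φ x₀ w k
  · simp [acceptCount_succ_of_accepts h, h]
  · simp [acceptCount_succ_of_not_accepts h, h]

open Classical in
theorem jumpMeasure_apply (hw : w.IsCounting) {S : Set (ℝ × State Θ d)} (hS : MeasurableSet S) :
    jumpMeasure C Φ x₀ w S = ∑' k, if Accepts C Φ x₀ w k ∧
      (w.T (k + 1), (anchor C Φ x₀ w (k + 1)).2) ∈ S then 1 else 0 := by
  rw [jumpMeasure_eq_sum hw, Measure.sum_apply _ hS]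
  refine tsum_congr fun k => ?_
  by_cases h : Accepts C Φ x₀ w k
  · rw [if_pos h, Measure.dirac_apply' _ hS]
    simp only [indicator, h, true_and, Pi.one_apply]
  · simp [h]

theorem jumpMeasure_ne_zero_iff (hw : w.IsCounting) {S : Set (ℝ × State Θ d)}
    (hS : MeasurableSet S) :
    jumpMeasure C Φ x₀ w S ≠ 0 ↔
      ∃ k, Accepts C Φ x₀ w k ∧ (w.T (k + 1), (anchor C Φ x₀ w (k + 1)).2) ∈ S := by
  classical
  simp [jumpMeasure_apply hw hS]

open Classical in
theorem jumpMeasure_Icc_prod (hw : w.IsCounting) (s : ℝ) {A : Set (State Θ d)}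
    (hA : MeasurableSet A) :
    jumpMeasure C Φ x₀ w (Icc 0 s ×ˢ A) = ∑' k, if Accepts C Φ x₀ w k ∧ w.T (k + 1) ≤ s ∧
      (anchor C Φ x₀ w (k + 1)).2 ∈ A then 1 else 0 := by
  simp only [jumpMeasure_apply hw (measurableSet_Icc.prod hA), mem_prod, mem_Icc, hw.nonneg,
    true_and]

open Classical in
theorem jumpMeasure_Icc_prod_eq_sum_range (hw : w.IsCounting) {s : ℝ} {k : ℕ}
    (hs : s < w.T (k + 1)) {A : Set (State Θ d)} (hA : MeasurableSet A) :
    jumpMeasure C Φ x₀ w (Icc 0 s ×ˢ A) = ∑ j ∈ Finset.range k,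
      if Accepts C Φ x₀ w j ∧ w.T (j + 1) ≤ s ∧ (anchor C Φ x₀ w (j + 1)).2 ∈ A
      then 1 else 0 := by
  rw [jumpMeasure_Icc_prod hw s hA]
  refine tsum_eq_sum fun j hj => if_neg fun h => h.2.1.not_gt (hs.trans_le (hw.monotone ?_))
  simpa using hj

variable [DiscreteMeasurableSpace Θ] [Countable Θ]
  {Ω : Type*} {mΩ : MeasurableSpace Ω} {P : Measure Ω} {lam : ℝ} {W : Ω → NoisePath}

theorem measurableSet_accepts_and (hW : IsThinningNoise P lam W) (hΦ : IsRegularFlow Φ) (k : ℕ)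
    (s : ℝ) {A : Set (State Θ d)} (hA : MeasurableSet A) :
    MeasurableSet[pointSigma hW C x₀ hΦ (k + 1)] {ω | Accepts C Φ x₀ (W ω) k ∧
      (W ω).T (k + 1) ≤ s ∧ (anchor C Φ x₀ (W ω) (k + 1)).2 ∈ A} := by
  have hnew := measurable_acceptCount_anchor (C := C) (x₀ := x₀) hW hΦ (k + 1)
  have hold : Measurable[pointSigma hW C x₀ hΦ (k + 1)] fun ω => acceptCount C Φ x₀ (W ω) k :=
    ((measurable_acceptCount_anchor hW hΦ k).mono (pointSigma_mono hW hΦ k.le_succ) le_rfl).fst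
  have htime : Measurable[pointSigma hW C x₀ hΦ (k + 1)] fun ω => (W ω).T (k + 1) :=
    (hW.measurable_time_pastSigma 0 le_rfl).mono (pastSigma_zero_le_pointSigma hW hΦ (k + 1)) le_rfl
  simp only [accepts_iff_acceptCount_succ]
  exact (measurableSet_eq_fun hnew.fst (hold.add_const 1)).inter
    ((measurableSet_le htime measurable_const).inter (hnew.snd.snd hA))

theorem measurable_jumpMeasure (hW : IsThinningNoise P lam W) (hΦ : IsRegularFlow Φ) (s : ℝ)
    {A : Set (State Θ d)} (hA : MeasurableSet A) :
    Measurable fun ω => jumpMeasure C Φ x₀ (W ω) (Icc 0 s ×ˢ A) := by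
  classical
  simp only [jumpMeasure_Icc_prod (hW.isCounting _) s hA]
  refine Measurable.tsum fun k => Measurable.ite ?_ measurable_const measurable_const
  exact (isStoppingTime_acceptCount hW C x₀ hΦ (k + 1)).measurableSpace_le _
    (measurableSet_accepts_and hW hΦ k s hA)

theorem jumpSigma_le (hW : IsThinningNoise P lam W) (hΦ : IsRegularFlow Φ) (t : ℝ) :
    jumpSigma C Φ x₀ W t ≤ mΩ :=
  iSup₂_le fun s _ => iSup₂_le fun _ hA => (measurable_jumpMeasure hW hΦ s hA).comap_le

theorem exists_measurableSet_pointSigma_inter_eq (hW : IsThinningNoise P lam W)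
    (hΦ : IsRegularFlow Φ) (k : ℕ) {s : ℝ} {B : Set Ω}
    (hB : MeasurableSet[jumpSigma C Φ x₀ W s] B) :
    ∃ B', MeasurableSet[pointSigma hW C x₀ hΦ k] B' ∧
      {ω | s < (W ω).T (k + 1)} ∩ B' = {ω | s < (W ω).T (k + 1)} ∩ B := by
  classical
  set D : Set Ω := {ω | s < (W ω).T (k + 1)}
  have htrace : jumpSigma C Φ x₀ W s ≤ MeasurableSpace.map (Subtype.val : D → Ω)
      (MeasurableSpace.comap Subtype.val (pointSigma hW C x₀ hΦ k)) := by
    refine iSup₂_le fun r hr => iSup₂_le fun A hA => ?_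
    rw [← measurable_iff_comap_le]
    have hcount : Measurable[pointSigma hW C x₀ hΦ k] fun ω => ∑ j ∈ Finset.range k,
        if Accepts C Φ x₀ (W ω) j ∧ (W ω).T (j + 1) ≤ r ∧ (anchor C Φ x₀ (W ω) (j + 1)).2 ∈ A
        then (1 : ℝ≥0∞) else 0 := by
      refine Finset.measurable_fun_sum _ fun j hj => Measurable.ite ?_ measurable_const
        measurable_const
      exact pointSigma_mono hW hΦ (Nat.succ_le_of_lt (Finset.mem_range.1 hj)) _
        (measurableSet_accepts_and hW hΦ j r hA)
    refine fun S hS => ⟨_, hcount hS, ?_⟩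
    ext ⟨ω, hω⟩
    simp only [mem_preimage,
      jumpMeasure_Icc_prod_eq_sum_range (hW.isCounting ω) (hr.2.trans_lt hω) hA]
  obtain ⟨B', hB', h⟩ := htrace B hB
  exact ⟨B', hB', Subtype.preimage_coe_eq_preimage_coe_iff.1 h⟩

end JumpFiltration

section MartingaleProperty

variable {Θ : Type*} {d : ℕ} [MeasurableSpace Θ]
  {C : JumpCharacteristics Θ d} {Φ : FlowFamily Θ d} {x₀ : State Θ d} {g : ℝ → State Θ d → ℝ}
  {Ω : Type*} {mΩ : MeasurableSpace Ω} {P : Measure Ω} {W : Ω → NoisePath}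

theorem increment_eq_stepIncrement_truncatedAnchor (hW : IsThinningNoise P C.bound W) (s t : ℝ)
    {k n : ℕ} {ω : Ω} (h : acceptCount C Φ x₀ (W ω) k = n) :
    increment C Φ x₀ (W ω) g s t k = stepIncrement C Φ g s t
      (((W ω).T k, truncatedAnchor C Φ x₀ W k n ω), stepNoise W k n ω) := by
  rw [increment_eq_stepIncrement (hW.isCounting ω), truncatedAnchor_of_eq h, h]
  simp [stepNoise, noiseVar]

variable [DiscreteMeasurableSpace Θ] [Countable Θ]

theorem measurable_increment (hW : IsThinningNoise P C.bound W) (hΦ : IsRegularFlow Φ)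
    (hg : IsBoundedMeasurable g) (s t : ℝ) (k : ℕ) :
    Measurable fun ω => increment C Φ x₀ (W ω) g s t k := by
  have hslice (n : ℕ) : Measurable fun ω => stepIncrement C Φ g s t
      (((W ω).T k, truncatedAnchor C Φ x₀ W k n ω), stepNoise W k n ω) :=
    (measurable_stepIncrement hΦ hg s t).comp (((hW.measurable_time k).prodMk
      ((measurable_truncatedAnchor hW hΦ k n).mono (hW.pastSigma_le k n) le_rfl)).prodMk
        (hW.measurable_stepNoise k n))
  have hcount : Measurable fun ω => acceptCount C Φ x₀ (W ω) k :=
    ((measurable_acceptCount_anchor hW hΦ k).mono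
      (isStoppingTime_acceptCount hW C x₀ hΦ k).measurableSpace_le le_rfl).fst
  have hglue : Measurable fun z : ℕ × Ω => stepIncrement C Φ g s t
      (((W z.2).T k, truncatedAnchor C Φ x₀ W k z.1 z.2), stepNoise W k z.1 z.2) :=
    measurable_from_prod_countable_right hslice
  simpa only [increment_eq_stepIncrement_truncatedAnchor hW s t rfl, Function.comp_def, id_eq]
    using hglue.comp (hcount.prodMk measurable_id)

variable [IsProbabilityMeasure P]

theorem integrable_increment (hW : IsThinningNoise P C.bound W) (hΦ : IsRegularFlow Φ)
    (hg : IsBoundedMeasurable g) {s t : ℝ} (hs : 0 ≤ s) (hst : s ≤ t) (k : ℕ) :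
    Integrable (fun ω => increment C Φ x₀ (W ω) g s t k) P := by
  obtain ⟨K, hK⟩ := hg.bounded
  exact .mono' ((integrable_const _).indicator
      (measurableSet_le (hW.measurable_time k) measurable_const))
    (measurable_increment hW hΦ hg s t k).aestronglyMeasurable
    (ae_of_all _ fun ω => abs_increment_le (hW.isCounting ω) hK hs hst k)

theorem summable_integral_norm_increment (hW : IsThinningNoise P C.bound W)
    (hΦ : IsRegularFlow Φ) (hg : IsBoundedMeasurable g) {s t : ℝ} (hs : 0 ≤ s) (hst : s ≤ t) :
    Summable fun k => ∫ ω, ‖increment C Φ x₀ (W ω) g s t k‖ ∂P := by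
  obtain ⟨K, hK⟩ := hg.bounded
  refine .of_nonneg_of_le (fun k => integral_nonneg fun ω => norm_nonneg _) (fun k => ?_)
    ((hW.summable_measureReal_time_le (C.bound_pos x₀) t).mul_right
      (2 * K + 2 * K * C.bound * (t - s)))
  have hset : MeasurableSet {ω | (W ω).T k ≤ t} :=
    measurableSet_le (hW.measurable_time k) measurable_const
  calc ∫ ω, ‖increment C Φ x₀ (W ω) g s t k‖ ∂P
      ≤ ∫ ω, {ω | (W ω).T k ≤ t}.indicator (fun _ => 2 * K + 2 * K * C.bound * (t - s)) ω ∂P :=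
        integral_mono (integrable_increment hW hΦ hg hs hst k).norm
          ((integrable_const _).indicator hset)
          fun ω => abs_increment_le (hW.isCounting ω) hK hs hst k
    _ = P.real {ω | (W ω).T k ≤ t} * (2 * K + 2 * K * C.bound * (t - s)) := by
        rw [integral_indicator_const _ hset, smul_eq_mul]

theorem setIntegral_increment_pastSigma (hW : IsThinningNoise P C.bound W)
    (hΦ : IsRegularFlow Φ) (hg : IsBoundedMeasurable g) {s t : ℝ} (hs : 0 ≤ s) (hst : s ≤ t)
    {k n : ℕ} {D : Set Ω} (hD : MeasurableSet[pastSigma W k n] D)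
    (hDn : ∀ ω ∈ D, acceptCount C Φ x₀ (W ω) k = n) :
    ∫ ω in D, increment C Φ x₀ (W ω) g s t k ∂P = 0 := by
  have hD' := hW.pastSigma_le k n _ hD
  rw [← integral_indicator hD']
  have hpast : Measurable[pastSigma W k n] fun ω =>
      (((W ω).T k, truncatedAnchor C Φ x₀ W k n ω), D.indicator (fun _ => (1 : ℝ)) ω) :=
    ((hW.measurable_time_pastSigma n le_rfl).prodMk (measurable_truncatedAnchor hW hΦ k n)).prodMk
      (measurable_const.indicator hD)
  have hstep : Measurable fun z : ((ℝ × ℝ × State Θ d) × ℝ) × ℝ × ℝ × ℝ =>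
      z.1.2 * stepIncrement C Φ g s t (z.1.1, z.2) :=
    measurable_fst.snd.mul ((measurable_stepIncrement hΦ hg s t).comp
      (measurable_fst.fst.prodMk measurable_snd))
  have hindicator (ω : Ω) : D.indicator (fun _ => (1 : ℝ)) ω * stepIncrement C Φ g s t
      (((W ω).T k, truncatedAnchor C Φ x₀ W k n ω), stepNoise W k n ω) =
      D.indicator (fun ω => increment C Φ x₀ (W ω) g s t k) ω := by
    by_cases hω : ω ∈ D
    · rw [indicator_of_mem hω, indicator_of_mem hω, one_mul,
        increment_eq_stepIncrement_truncatedAnchor hW s t (hDn ω hω)]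
    · rw [indicator_of_notMem hω, indicator_of_notMem hω, zero_mul]
  have hint := (integrable_increment (x₀ := x₀) hW hΦ hg hs hst k).indicator hD'
  rw [← funext hindicator] at hint ⊢
  exact hW.integral_stepNoise_eq_zero hpast hstep hint fun a => by
    simp only [integral_const_mul, integral_stepIncrement hΦ hg, mul_zero]

theorem setIntegral_increment_eq_zero (hW : IsThinningNoise P C.bound W)
    (hΦ : IsRegularFlow Φ) (hg : IsBoundedMeasurable g) {s t : ℝ} (hs : 0 ≤ s) (hst : s ≤ t)
    (k : ℕ) {B : Set Ω} (hB : MeasurableSet[jumpSigma C Φ x₀ W s] B) :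
    ∫ ω in B, increment C Φ x₀ (W ω) g s t k ∂P = 0 := by
  obtain ⟨B', hB', htrace⟩ := exists_measurableSet_pointSigma_inter_eq hW hΦ k hB
  have hvanish (ω : Ω) (hω : ¬ s < (W ω).T (k + 1)) : increment C Φ x₀ (W ω) g s t k = 0 :=
    increment_eq_zero_of_notMem (hW.isCounting ω) (.inl (not_lt.1 hω))
  have hreplace : ∫ ω in B, increment C Φ x₀ (W ω) g s t k ∂P =
      ∫ ω in B', increment C Φ x₀ (W ω) g s t k ∂P := by
    rw [← integral_indicator (jumpSigma_le hW hΦ s _ hB), ← integral_indicator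
      ((isStoppingTime_acceptCount hW C x₀ hΦ k).measurableSpace_le _ hB')]
    congr with ω
    by_cases hω : s < (W ω).T (k + 1)
    · have hmem : ω ∈ B' ↔ ω ∈ B := by simpa [hω] using Set.ext_iff.1 htrace ω
      by_cases hb : ω ∈ B
      · rw [indicator_of_mem hb, indicator_of_mem (hmem.2 hb)]
      · rw [indicator_of_notMem hb, indicator_of_notMem (mt hmem.1 hb)]
    · simp only [indicator, hvanish ω hω, ite_self]
  have hslices := (measurableSet_pointSigma_iff hW hΦ).1 hB'
  have hunion : B' = ⋃ n, B' ∩ {ω | acceptCount C Φ x₀ (W ω) k = n} := by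
    ext ω
    simp
  rw [hreplace, hunion, integral_iUnion (fun n => hW.pastSigma_le k n _ (hslices n)) ?_
    (integrable_increment hW hΦ hg hs hst k).integrableOn]
  · simp only [setIntegral_increment_pastSigma hW hΦ hg hs hst (hslices _) fun _ hω => hω.2,
      tsum_zero]
  · exact fun i j hij => Set.disjoint_left.2 fun ω hi hj => hij (hi.2.symm.trans hj.2)

variable [TopologicalSpace Θ] [DiscreteTopology Θ]

theorem integrable_martingalePart (hW : IsThinningNoise P C.bound W) (hΦ : IsRegularFlow Φ)
    (hg : IsBoundedMeasurable g) {t : ℝ} (ht : 0 ≤ t) :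
    Integrable (fun ω => martingalePart C Φ x₀ (W ω) g t) P := by
  have hzero (ω : Ω) : martingalePart C Φ x₀ (W ω) g 0 = 0 := by
    simp [martingalePart, compensatedIntegral]
  have hsum (ω : Ω) : HasSum (fun k => increment C Φ x₀ (W ω) g 0 t k)
      (martingalePart C Φ x₀ (W ω) g t) := by
    have h := hasSum_increment (C := C) (x₀ := x₀) (hW.isCounting ω) hΦ hg le_rfl ht
    rwa [hzero, sub_zero] at h
  exact integrable_of_hasSum (integrable_increment hW hΦ hg le_rfl ht)
    (summable_integral_norm_increment hW hΦ hg le_rfl ht) hsum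

theorem setIntegral_martingalePart (hW : IsThinningNoise P C.bound W) (hΦ : IsRegularFlow Φ)
    (hg : IsBoundedMeasurable g) {s t : ℝ} (hs : 0 ≤ s) (hst : s ≤ t) {B : Set Ω}
    (hB : MeasurableSet[jumpSigma C Φ x₀ W s] B) :
    ∫ ω in B, martingalePart C Φ x₀ (W ω) g s ∂P =
      ∫ ω in B, martingalePart C Φ x₀ (W ω) g t ∂P := by
  have hint := integrable_increment (x₀ := x₀) hW hΦ hg hs hst
  have hsum := hasSum_integral_of_summable_integral_norm (μ := P.restrict B)
    (F := fun k ω => increment C Φ x₀ (W ω) g s t k) (fun k => (hint k).integrableOn)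
    (.of_nonneg_of_le (fun k => integral_nonneg fun ω => norm_nonneg _)
      (fun k => setIntegral_le_integral (hint k).norm (ae_of_all _ fun ω => norm_nonneg _))
      (summable_integral_norm_increment hW hΦ hg hs hst))
  simp only [setIntegral_increment_eq_zero hW hΦ hg hs hst _ hB,
    (hasSum_increment (hW.isCounting _) hΦ hg hs hst).tsum_eq] at hsum
  refine (sub_eq_zero.1 ?_).symm
  rw [← integral_sub (integrable_martingalePart hW hΦ hg (hs.trans hst)).integrableOn
    (integrable_martingalePart hW hΦ hg hs).integrableOn]
  exact hsum.unique hasSum_zero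

end MartingaleProperty

/-! ### Adaptedness -/

section KernelMeasurability

variable {α β : Type*} [MeasurableSpace α] [MeasurableSpace β] {μ : α → Measure β}

theorem measurable_measure_prodMk_left (hμ : Measurable μ) (hfin : ∀ a, IsFiniteMeasure (μ a))
    {S : Set (α × β)} (hS : MeasurableSet S) : Measurable fun a => μ a (Prod.mk a ⁻¹' S) :=
  Kernel.measurable_kernel_prodMk_left_of_finite (κ := ⟨μ, hμ⟩) hS hfin

theorem measurable_integral_prodMk_left (hμ : Measurable μ) (hfin : ∀ a, IsFiniteMeasure (μ a))
    {φ : α × β → ℝ} (hφ : Measurable φ) : Measurable fun a => ∫ b, φ (a, b) ∂(μ a) := by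
  have hmass : Measurable fun a => μ a univ := (Measure.measurable_coe MeasurableSet.univ).comp hμ
  let κ : Kernel α β := ⟨fun a => (μ a univ)⁻¹ • μ a, Measure.measurable_of_measurable_coe _
    fun S hS => hmass.inv.mul ((Measure.measurable_coe hS).comp hμ)⟩
  have : IsFiniteKernel κ := ⟨1, ENNReal.one_lt_top, fun a => ENNReal.inv_mul_le_one _⟩
  have haverage : Measurable fun a => ⨍ b, φ (a, b) ∂(μ a) :=
    (hφ.stronglyMeasurable.integral_kernel_prod_right' (κ := κ)).measurable
  simp only [← measure_smul_average (μ _)]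
  exact hmass.ennreal_toReal.smul haverage

end KernelMeasurability

section LastAnchor

variable {Θ : Type*} {d : ℕ} [MeasurableSpace Θ] {C : JumpCharacteristics Θ d}
  {Φ : FlowFamily Θ d} {x₀ : State Θ d} {w : NoisePath}

theorem anchor_fst_nonneg (hw : w.IsCounting) (k : ℕ) : 0 ≤ (anchor C Φ x₀ w k).1 := by
  induction k with
  | zero => exact le_rfl
  | succ k ih =>
    by_cases h : Accepts C Φ x₀ w k
    · rw [anchor_succ_of_accepts h]
      exact hw.nonneg _
    · rwa [anchor_succ_of_not_accepts h]

theorem anchor_fst_le_iff (hw : w.IsCounting) {r : ℝ} (hr : 0 ≤ r) (k : ℕ) :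
    (anchor C Φ x₀ w k).1 ≤ r ↔ ∀ j < k, Accepts C Φ x₀ w j → w.T (j + 1) ≤ r := by
  induction k with
  | zero => exact iff_of_true hr fun j hj => absurd hj j.not_lt_zero
  | succ k ih =>
    by_cases h : Accepts C Φ x₀ w k
    · rw [anchor_succ_of_accepts h]
      exact ⟨fun hle j hj _ => (hw.monotone hj).trans hle, fun hall => hall k k.lt_succ_self h⟩
    · rw [anchor_succ_of_not_accepts h, ih, Nat.forall_lt_succ_right]
      simp [h]

theorem anchor_snd_mem_iff (hw : w.IsCounting) (k : ℕ) {A : Set (State Θ d)} :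
    (anchor C Φ x₀ w k).2 ∈ A ↔ ((anchor C Φ x₀ w k).1 = 0 ∧ x₀ ∈ A) ∨
      ∃ j, Accepts C Φ x₀ w j ∧ w.T (j + 1) = (anchor C Φ x₀ w k).1 ∧
        (anchor C Φ x₀ w (j + 1)).2 ∈ A := by
  induction k with
  | zero =>
    have h (j : ℕ) : w.T (j + 1) ≠ (anchor C Φ x₀ w 0).1 := (hw.succ_pos j).ne'
    simp only [h, false_and, and_false, exists_false, or_false]
    exact (and_iff_right rfl).symm
  | succ k ih =>
    by_cases h : Accepts C Φ x₀ w k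
    · have hfst : (anchor C Φ x₀ w (k + 1)).1 = w.T (k + 1) := by rw [anchor_succ_of_accepts h]
      simp only [hfst, (hw.succ_pos k).ne', false_and, false_or, hw.strictMono.injective.eq_iff,
        Nat.add_right_cancel_iff]
      simp [h]
    · rw [anchor_succ_of_not_accepts h, ih]

/-- The number of Poisson points before `s > 0`. -/
def pointsBefore (w : NoisePath) (s : ℝ) : ℕ := sInf {k | s ≤ w.T (k + 1)}

theorem lt_pointsBefore_iff (hw : w.IsCounting) {s : ℝ} {j : ℕ} :
    j < pointsBefore w s ↔ w.T (j + 1) < s := by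
  refine ⟨fun hj => not_le.1 (Nat.notMem_of_lt_sInf hj), fun h => ?_⟩
  obtain ⟨k, hk⟩ := (hw.tendsto.eventually_ge_atTop s).exists_forall_of_atTop
  have hmem : s ≤ w.T (pointsBefore w s + 1) :=
    Nat.sInf_mem (s := {k | s ≤ w.T (k + 1)}) ⟨k, hk (k + 1) k.le_succ⟩
  exact not_le.1 fun hj => h.not_ge (hmem.trans (hw.monotone (Nat.succ_le_succ hj)))

variable (C Φ x₀) in
/-- The time and the location from which the trajectory is deterministic just before `s > 0`;
there `x_{s-}` depends on the noise only through this pair. -/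
def lastAnchor (w : NoisePath) (s : ℝ) : ℝ × State Θ d := anchor C Φ x₀ w (pointsBefore w s)

theorem lastAnchor_fst_le_iff (hw : w.IsCounting) {r : ℝ} (hr : 0 ≤ r) (s : ℝ) :
    (lastAnchor C Φ x₀ w s).1 ≤ r ↔ jumpMeasure C Φ x₀ w (Ioo r s ×ˢ univ) = 0 := by
  rw [lastAnchor, anchor_fst_le_iff hw hr, ← not_iff_not, ← ne_eq (jumpMeasure _ _ _ _ _),
    jumpMeasure_ne_zero_iff hw (measurableSet_Ioo.prod MeasurableSet.univ)]
  simp only [lt_pointsBefore_iff hw, mem_prod, mem_Ioo, mem_univ, and_true]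
  push Not
  exact exists_congr fun j => by tauto

theorem lastAnchor_snd_mem_iff (hw : w.IsCounting) (s : ℝ) {A : Set (State Θ d)}
    (hA : MeasurableSet A) :
    (lastAnchor C Φ x₀ w s).2 ∈ A ↔ ((lastAnchor C Φ x₀ w s).1 = 0 ∧ x₀ ∈ A) ∨
      jumpMeasure C Φ x₀ w ({(lastAnchor C Φ x₀ w s).1} ×ˢ A) ≠ 0 := by
  rw [jumpMeasure_ne_zero_iff hw ((measurableSet_singleton _).prod hA)]
  exact anchor_snd_mem_iff hw _

theorem leftLim_process_eq_flowFrom_lastAnchor [DiscreteMeasurableSpace Θ] [Countable Θ]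
    [TopologicalSpace Θ] [DiscreteTopology Θ]
    (hw : w.IsCounting) (hΦ : IsRegularFlow Φ) {s : ℝ} (hs : 0 < s) :
    Function.leftLim (process C Φ x₀ w) s = flowFrom Φ (lastAnchor C Φ x₀ w s) s := by
  refine leftLim_process hw hΦ ⟨?_, not_lt.1 fun h => lt_irrefl _ ((lt_pointsBefore_iff hw).2 h)⟩
  cases hk : pointsBefore w s with
  | zero => exact hw.zero.trans_lt hs
  | succ k => exact (lt_pointsBefore_iff hw).1 (hk ▸ k.lt_succ_self)

end LastAnchor

section Adapted

variable {Θ : Type*} {d : ℕ} [MeasurableSpace Θ] {C : JumpCharacteristics Θ d}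
  {Φ : FlowFamily Θ d} {x₀ : State Θ d} {g : ℝ → State Θ d → ℝ}
  {Ω : Type*} {W : Ω → NoisePath} {t : ℝ}

theorem jumpSigma_mono (W : Ω → NoisePath) {s t : ℝ} (hst : s ≤ t) :
    jumpSigma C Φ x₀ W s ≤ jumpSigma C Φ x₀ W t :=
  biSup_mono fun _ hr => Icc_subset_Icc_right hst hr

theorem measurable_jumpMeasure_jumpSigma {s : ℝ} (hs : s ∈ Icc 0 t) {A : Set (State Θ d)}
    (hA : MeasurableSet A) : Measurable[jumpSigma C Φ x₀ W t]
      fun ω => jumpMeasure C Φ x₀ (W ω) (Icc 0 s ×ˢ A) :=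
  Measurable.of_comap_le <| le_iSup₂_of_le s hs <| le_iSup₂_of_le A hA le_rfl

theorem jumpMeasure_Iic_prod {w : NoisePath} (hw : w.IsCounting) (s : ℝ) {A : Set (State Θ d)}
    (hA : MeasurableSet A) :
    jumpMeasure C Φ x₀ w (Iic s ×ˢ A) = jumpMeasure C Φ x₀ w (Icc 0 s ×ˢ A) := by
  classical
  simp only [jumpMeasure_apply hw (measurableSet_Icc.prod hA),
    jumpMeasure_apply hw (measurableSet_Iic.prod hA), mem_prod, mem_Icc, mem_Iic, hw.nonneg,
    true_and]

theorem isFiniteMeasure_restrict_jumpMeasure {w : NoisePath} (hw : w.IsCounting) (t : ℝ) :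
    IsFiniteMeasure ((jumpMeasure C Φ x₀ w).restrict (Iic t ×ˢ univ)) := by
  classical
  obtain ⟨k, hk⟩ := (hw.tendsto.eventually_gt_atTop t).exists_forall_of_atTop
  refine ⟨?_⟩
  rw [Measure.restrict_apply_univ, jumpMeasure_Iic_prod hw t MeasurableSet.univ,
    jumpMeasure_Icc_prod_eq_sum_range hw (hk (k + 1) k.le_succ) MeasurableSet.univ]
  refine ENNReal.sum_lt_top.2 fun j _ => ?_
  split_ifs
  · exact ENNReal.one_lt_top
  · exact ENNReal.zero_lt_top

theorem measurable_restrict_jumpMeasure_jumpSigma (hw : ∀ ω, (W ω).IsCounting) (ht : 0 ≤ t) :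
    Measurable[jumpSigma C Φ x₀ W t]
      fun ω => (jumpMeasure C Φ x₀ (W ω)).restrict (Iic t ×ˢ univ) := by
  let _ := jumpSigma C Φ x₀ W t
  have (ω : Ω) := isFiniteMeasure_restrict_jumpMeasure (C := C) (Φ := Φ) (x₀ := x₀) (hw ω) t
  have hbox (s : ℝ) {A : Set (State Θ d)} (hA : MeasurableSet A) (ω : Ω) :
      (jumpMeasure C Φ x₀ (W ω)).restrict (Iic t ×ˢ univ) (Iic s ×ˢ A) =
        jumpMeasure C Φ x₀ (W ω) (Icc 0 (min s t) ×ˢ A) := by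
    rw [Measure.restrict_apply (measurableSet_Iic.prod hA), prod_inter_prod, inter_univ,
      Iic_inter_Iic, jumpMeasure_Iic_prod (hw ω) _ hA]
  have hspanning : IsCountablySpanning (range (Iic : ℝ → Set ℝ)) :=
    ⟨fun n : ℕ => Iic n, fun n => mem_range_self _, iUnion_Iic_of_not_bddAbove_range
      (not_bddAbove_of_tendsto_atTop tendsto_natCast_atTop_atTop)⟩
  have hgen := generateFrom_eq_prod (borel_eq_generateFrom_Iic ℝ).symm
    (MeasurableSpace.generateFrom_measurableSet (α := State Θ d)) hspanning
    isCountablySpanning_measurableSet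
  refine Measurable.measure_of_isPiSystem hgen.symm
    (isPiSystem_Iic.prod MeasurableSpace.isPiSystem_measurableSet) ?_ ?_
  · rintro _ ⟨_, ⟨s, rfl⟩, A, hA, rfl⟩
    simp only [hbox s hA]
    rcases lt_or_ge (min s t) 0 with h | h
    · simp only [Icc_eq_empty h.not_ge, empty_prod, measure_empty, measurable_const]
    · exact measurable_jumpMeasure_jumpSigma ⟨h, min_le_right s t⟩ hA
  · simp only [Measure.restrict_apply_univ, jumpMeasure_Iic_prod (hw _) t MeasurableSet.univ]
    exact measurable_jumpMeasure_jumpSigma ⟨ht, le_rfl⟩ MeasurableSet.univ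

theorem measurable_lastAnchor_fst_jumpSigma (hw : ∀ ω, (W ω).IsCounting) (ht : 0 ≤ t) :
    Measurable[(jumpSigma C Φ x₀ W t).prod inferInstance]
      fun z : Ω × ℝ => (lastAnchor C Φ x₀ (W z.1) (min z.2 t)).1 := by
  let _ := jumpSigma C Φ x₀ W t
  refine measurable_of_Iic fun r => ?_
  rcases lt_or_ge r 0 with hr | hr
  · convert MeasurableSet.empty
    exact eq_empty_of_forall_notMem fun z hz =>
      (hr.trans_le (anchor_fst_nonneg (hw z.1) _)).not_ge hz
  have hset : MeasurableSet {p : (Ω × ℝ) × ℝ × State Θ d |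
      p.2 ∈ Ioo r (min p.1.2 t) ×ˢ (univ : Set (State Θ d))} := by
    simp only [mem_prod, mem_Ioo, mem_univ, and_true]
    measurability
  have hcount := measurable_measure_prodMk_left
    ((measurable_restrict_jumpMeasure_jumpSigma (C := C) (Φ := Φ) (x₀ := x₀) hw ht).comp
      measurable_fst) (fun z => isFiniteMeasure_restrict_jumpMeasure (hw z.1) t) hset
  refine (congrArg _ (Set.ext fun z => ?_)).mpr (hcount (measurableSet_singleton 0))
  have hsub : Ioo r (min z.2 t) ×ˢ univ ⊆ Iic t ×ˢ (univ : Set (State Θ d)) :=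
    prod_mono_left fun u hu => hu.2.le.trans (min_le_right _ _)
  rw [mem_preimage, mem_Iic, lastAnchor_fst_le_iff (hw z.1) hr, ← Measure.restrict_eq_self _ hsub]
  rfl

theorem measurable_lastAnchor_jumpSigma (hw : ∀ ω, (W ω).IsCounting) (ht : 0 ≤ t) :
    Measurable[(jumpSigma C Φ x₀ W t).prod inferInstance]
      fun z : Ω × ℝ => lastAnchor C Φ x₀ (W z.1) (min z.2 t) := by
  let _ := jumpSigma C Φ x₀ W t
  have hfst := measurable_lastAnchor_fst_jumpSigma (C := C) (Φ := Φ) (x₀ := x₀) hw ht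
  have hsnd : Measurable fun z : Ω × ℝ => (lastAnchor C Φ x₀ (W z.1) (min z.2 t)).2 := by
    intro A hA
    have hset : MeasurableSet {p : (Ω × ℝ) × ℝ × State Θ d |
        p.2 ∈ {(lastAnchor C Φ x₀ (W p.1.1) (min p.1.2 t)).1} ×ˢ A} :=
      (measurableSet_eq_fun (by fun_prop) (hfst.comp measurable_fst)).inter
        (hA.preimage (by fun_prop))
    have hcount := measurable_measure_prodMk_left
      ((measurable_restrict_jumpMeasure_jumpSigma hw ht).comp measurable_fst)
      (fun z => isFiniteMeasure_restrict_jumpMeasure (hw z.1) t) hset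
    refine (congrArg _ (Set.ext fun z => ?_)).mpr
      (((hfst (measurableSet_singleton 0)).inter (MeasurableSet.const (x₀ ∈ A))).union
        (hcount (measurableSet_singleton 0).compl))
    have hle : (lastAnchor C Φ x₀ (W z.1) (min z.2 t)).1 ≤ t := by
      rw [lastAnchor_fst_le_iff (hw z.1) ht, Ioo_eq_empty (min_le_right _ _).not_gt, empty_prod,
        measure_empty]
    have hsub : {(lastAnchor C Φ x₀ (W z.1) (min z.2 t)).1} ×ˢ A ⊆ Iic t ×ˢ univ :=
      prod_mono (singleton_subset_iff.2 hle) (subset_univ A)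
    rw [mem_preimage, lastAnchor_snd_mem_iff (hw z.1) _ hA, ← Measure.restrict_eq_self _ hsub]
    rfl
  exact hfst.prodMk hsnd

variable [DiscreteMeasurableSpace Θ] [Countable Θ]

theorem measurable_flowFrom_lastAnchor_jumpSigma (hw : ∀ ω, (W ω).IsCounting) (hΦ : IsRegularFlow Φ)
    (ht : 0 ≤ t) : Measurable[(jumpSigma C Φ x₀ W t).prod inferInstance] fun z : Ω × ℝ =>
      flowFrom Φ (lastAnchor C Φ x₀ (W z.1) (min z.2 t)) z.2 := by
  let _ := jumpSigma C Φ x₀ W t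
  exact (measurable_flowFrom hΦ).comp
    ((measurable_lastAnchor_jumpSigma hw ht).prodMk measurable_snd)

variable [TopologicalSpace Θ] [DiscreteTopology Θ]

theorem measurable_integral_opS_jumpSigma (hw : ∀ ω, (W ω).IsCounting) (hΦ : IsRegularFlow Φ)
    (hg : IsBoundedMeasurable g) (ht : 0 ≤ t) :
    Measurable[jumpSigma C Φ x₀ W t]
      fun ω => ∫ s in (0 : ℝ)..t, opS C g s (process C Φ x₀ (W ω) s) := by
  let _ := jumpSigma C Φ x₀ W t
  have hb : Measurable (Function.uncurry fun ω s =>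
      opS C g (max s 0) (flowFrom Φ (lastAnchor C Φ x₀ (W ω) (min s t)) s)) :=
    (measurable_opS hg).comp
      (measurable_snd.prodMk (measurable_flowFrom_lastAnchor_jumpSigma hw hΦ ht))
  convert measurable_setIntegral_Ioc hb (measurable_const (a := 0)) (measurable_const (a := t))
    using 2 with ω
  rw [intervalIntegral.integral_of_le ht]
  refine setIntegral_congr_ae measurableSet_Ioc ?_
  filter_upwards [(countable_range (W ω).T).ae_notMem volume] with s hrange hs
  rw [max_eq_left hs.1.le, min_eq_left hs.2,
    ← leftLim_process_eq_flowFrom_lastAnchor (hw ω) hΦ hs.1,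
    leftLim_process_eq_process (hw ω) hΦ hs.1.le hrange]

theorem measurable_integral_jumpMeasure_jumpSigma (hw : ∀ ω, (W ω).IsCounting)
    (hΦ : IsRegularFlow Φ) (hg : IsBoundedMeasurable g) (ht : 0 ≤ t) :
    Measurable[jumpSigma C Φ x₀ W t] fun ω => ∫ z in Ioc 0 t ×ˢ univ,
      jumpIntegrand C Φ x₀ (W ω) g z ∂(jumpMeasure C Φ x₀ (W ω)) := by
  let _ := jumpSigma C Φ x₀ W t
  have hb : Measurable fun p : Ω × ℝ × State Θ d => g (max p.2.1 0) p.2.2 -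
      g (max p.2.1 0) (flowFrom Φ (lastAnchor C Φ x₀ (W p.1) (min p.2.1 t)) p.2.1) :=
    (hg.measurable.comp measurable_snd).sub (hg.measurable.comp
      ((by fun_prop : Measurable fun p : Ω × ℝ × State Θ d => p.2.1).prodMk
        ((measurable_flowFrom_lastAnchor_jumpSigma hw hΦ ht).comp
          (by fun_prop : Measurable fun p : Ω × ℝ × State Θ d => (p.1, p.2.1)))))
  have hset : MeasurableSet {p : Ω × ℝ × State Θ d | p.2.1 ∈ Ioc 0 t} :=
    measurableSet_Ioc.preimage (by fun_prop)
  convert measurable_integral_prodMk_left (measurable_restrict_jumpMeasure_jumpSigma hw ht)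
    (fun ω => isFiniteMeasure_restrict_jumpMeasure (hw ω) t) (hb.indicator hset) using 2 with ω
  have hsub : Ioc 0 t ×ˢ univ ⊆ Iic t ×ˢ (univ : Set (State Θ d)) :=
    prod_mono_left Ioc_subset_Iic_self
  have hS : MeasurableSet (Ioc 0 t ×ˢ (univ : Set (State Θ d))) :=
    measurableSet_Ioc.prod MeasurableSet.univ
  rw [← Measure.restrict_restrict_of_subset hsub, ← integral_indicator hS]
  refine integral_congr_ae (ae_of_all _ fun z => ?_)
  beta_reduce
  by_cases hz : z.1 ∈ Ioc 0 t
  · rw [indicator_of_mem (show z ∈ Ioc 0 t ×ˢ univ from ⟨hz, mem_univ _⟩), indicator_of_mem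
      (show (ω, z) ∈ {p : Ω × ℝ × State Θ d | p.2.1 ∈ Ioc 0 t} from hz), jumpIntegrand,
      leftLim_process_eq_flowFrom_lastAnchor (hw ω) hΦ hz.1, max_eq_left hz.1.le,
      min_eq_left hz.2]
  · rw [indicator_of_notMem (fun h => hz h.1), indicator_of_notMem
      (show (ω, z) ∉ {p : Ω × ℝ × State Θ d | p.2.1 ∈ Ioc 0 t} from hz)]

theorem measurable_martingalePart_jumpSigma (hw : ∀ ω, (W ω).IsCounting) (hΦ : IsRegularFlow Φ)
    (hg : IsBoundedMeasurable g) (ht : 0 ≤ t) :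
    Measurable[jumpSigma C Φ x₀ W t] fun ω => martingalePart C Φ x₀ (W ω) g t := by
  simp only [martingalePart, compensatedIntegral, integral_compensator (hw _) hΦ hg ht]
  exact (measurable_integral_jumpMeasure_jumpSigma hw hΦ hg ht).sub
    (measurable_integral_opS_jumpSigma hw hΦ hg ht)

variable {mΩ : MeasurableSpace Ω} {P : Measure Ω} [IsProbabilityMeasure P]

theorem exists_filtration_martingale (hW : IsThinningNoise P C.bound W) (hΦ : IsRegularFlow Φ)
    (hg : IsBoundedMeasurable g) :
    ∃ ℱ : Filtration ℝ≥0 mΩ, (∀ t : ℝ≥0, ℱ t = jumpSigma C Φ x₀ W t) ∧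
      Martingale (fun (t : ℝ≥0) ω => martingalePart C Φ x₀ (W ω) g t) ℱ P := by
  have hmeas (t : ℝ≥0) := measurable_martingalePart_jumpSigma (C := C) (x₀ := x₀) hW.isCounting
    hΦ hg t.2
  refine ⟨⟨fun t => jumpSigma C Φ x₀ W t, fun s t hst => jumpSigma_mono W hst,
    fun t => jumpSigma_le hW hΦ t⟩, fun t => rfl, fun t => (hmeas t).stronglyMeasurable,
    fun s t hst => ?_⟩
  exact (ae_eq_condExp_of_forall_setIntegral_eq (jumpSigma_le hW hΦ s)
    (integrable_martingalePart hW hΦ hg t.2)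
    (fun B _ _ => (integrable_martingalePart hW hΦ hg s.2).integrableOn)
    (fun B hB _ => setIntegral_martingalePart hW hΦ hg s.2 hst hB)
    (hmeas s).stronglyMeasurable.aestronglyMeasurable).symm

end Adapted

/-! ### The two flows -/

section Concatenation

variable {E : Type*} {δ : ℝ} {c : ℕ → ℝ → E}

/-- The concatenation of the curves `c i`, each followed on `[iδ, (i+1)δ[`. -/
def concatCurves (δ : ℝ) (c : ℕ → ℝ → E) (t : ℝ) : E := c ⌊t / δ⌋₊ t

theorem mem_Ico_floor_div_mul (hδ : 0 < δ) {t : ℝ} (ht : 0 ≤ t) :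
    t ∈ Ico (⌊t / δ⌋₊ * δ) ((⌊t / δ⌋₊ + 1) * δ) :=
  ⟨(le_div_iff₀ hδ).1 (Nat.floor_le (div_nonneg ht hδ.le)),
    (div_lt_iff₀ hδ).1 (Nat.lt_floor_add_one _)⟩

theorem concatCurves_eq (hδ : 0 < δ) (hc : ∀ i : ℕ, c i ((i + 1) * δ) = c (i + 1) ((i + 1) * δ))
    {i : ℕ} {t : ℝ} (ht : t ∈ Icc (i * δ) ((i + 1) * δ)) : concatCurves δ c t = c i t := by
  rcases ht.2.lt_or_eq with hlt | rfl
  · have hfloor : ⌊t / δ⌋₊ = i := by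
      rw [Nat.floor_eq_iff (div_nonneg ((mul_nonneg i.cast_nonneg hδ.le).trans ht.1) hδ.le)]
      exact ⟨(le_div_iff₀ hδ).2 ht.1, (div_lt_iff₀ hδ).2 hlt⟩
    rw [concatCurves, hfloor]
  · have hfloor : ⌊((i : ℝ) + 1) * δ / δ⌋₊ = i + 1 := by
      rw [mul_div_cancel_right₀ _ hδ.ne']
      exact_mod_cast Nat.floor_natCast (i + 1)
    rw [concatCurves, hfloor, hc]

theorem continuousOn_concatCurves [TopologicalSpace E] (hδ : 0 < δ)
    (hc : ∀ i : ℕ, c i ((i + 1) * δ) = c (i + 1) ((i + 1) * δ))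
    (hcont : ∀ i : ℕ, ContinuousOn (c i) (Icc (i * δ) ((i + 1) * δ))) :
    ContinuousOn (concatCurves δ c) (Ici 0) := by
  have hfin : LocallyFinite fun i : ℕ => Icc (i * δ) ((i + 1) * δ) := fun x =>
    ⟨Iio (x + 1), Iio_mem_nhds (lt_add_one x), (finite_Iic ⌈(x + 1) / δ⌉₊).subset
      fun i ⟨_, hi, hx⟩ => Nat.cast_le.1
        (((le_div_iff₀ hδ).2 (hi.1.trans (mem_Iio.1 hx).le)).trans (Nat.le_ceil _))⟩
  exact (hfin.continuousOn_iUnion (fun i => isClosed_Icc) fun i =>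
    (hcont i).congr fun t ht => concatCurves_eq hδ hc ht).mono
      fun t ht => mem_iUnion.2 ⟨_, Ico_subset_Icc_self (mem_Ico_floor_div_mul hδ ht)⟩

theorem hasDerivWithinAt_concatCurves [NormedAddCommGroup E] [NormedSpace ℝ E] (hδ : 0 < δ)
    (hc : ∀ i : ℕ, c i ((i + 1) * δ) = c (i + 1) ((i + 1) * δ)) {t : ℝ} (ht : 0 ≤ t) {v : E}
    (hv : HasDerivWithinAt (c ⌊t / δ⌋₊) v (Ici t) t) :
    HasDerivWithinAt (concatCurves δ c) v (Ici t) t := by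
  obtain ⟨hle, hlt⟩ := mem_Ico_floor_div_mul hδ ht
  refine hv.congr_of_eventuallyEq ?_ rfl
  filter_upwards [Icc_mem_nhdsGE hlt] with s hs
  exact concatCurves_eq hδ hc ⟨hle.trans hs.1, hs.2⟩

end Concatenation

section ODE

variable {E : Type*} [NormedAddCommGroup E] [NormedSpace ℝ E] [CompleteSpace E] {F : E → E}
  {L : ℝ≥0}

theorem exists_local_solution (hF : LipschitzWith L F) (ν : E) :
    ∃ y : ℝ → E, y 0 = ν ∧ ∀ t ∈ Icc 0 (1 + (L : ℝ))⁻¹,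
      HasDerivWithinAt y (F (y t)) (Icc 0 (1 + (L : ℝ))⁻¹) t := by
  have hδ : 0 ≤ (1 + (L : ℝ))⁻¹ := by positivity
  have hPL : IsPicardLindelof (fun _ => F) (⟨0, le_rfl, hδ⟩ : Icc 0 (1 + (L : ℝ))⁻¹) ν
      ‖F ν‖₊ 0 ((1 + L) * ‖F ν‖₊) L :=
    { lipschitzOnWith := fun _ _ => hF.lipschitzOnWith
      continuousOn := fun _ _ => continuousOn_const
      norm_le := fun _ _ x hx => by
        have hball : dist x ν ≤ ‖F ν‖ := hx
        calc ‖F x‖ ≤ ‖F ν‖ + dist (F x) (F ν) := by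
              rw [dist_eq_norm]
              exact norm_le_norm_add_norm_sub' _ _
          _ ≤ ‖F ν‖ + L * ‖F ν‖ := by
              gcongr
              exact (hF.dist_le_mul x ν).trans (by gcongr)
          _ = ((1 + L) * ‖F ν‖₊ : ℝ≥0) := by
              push_cast
              ring
      mul_max_le := by
        have hL : 1 + (L : ℝ) ≠ 0 := by positivity
        rw [sub_zero, sub_self, max_eq_left hδ, NNReal.coe_zero, sub_zero]
        push_cast
        field_simp
        exact le_rfl }
  exact hPL.exists_eq_forall_mem_Icc_hasDerivWithinAt₀

theorem exists_right_solution (hF : LipschitzWith L F) (ν : E) :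
    ∃ y : ℝ → E, y 0 = ν ∧ ContinuousOn y (Ici 0) ∧
      ∀ t, 0 ≤ t → HasDerivWithinAt y (F (y t)) (Ici t) t := by
  choose S hS0 hS using exists_local_solution hF
  set δ := (1 + (L : ℝ))⁻¹
  have hδ : 0 < δ := by positivity
  let z : ℕ → E := fun n => (fun x => S x δ)^[n] ν
  let c : ℕ → ℝ → E := fun i t => S (z i) (t - i * δ)
  have hc (i : ℕ) : c i ((i + 1) * δ) = c (i + 1) ((i + 1) * δ) := by
    simp only [c, z, Nat.cast_add_one, sub_self, hS0, Function.iterate_succ_apply', add_one_mul,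
      add_sub_cancel_left]
  have hmaps (i : ℕ) : MapsTo (fun t : ℝ => t - i * δ) (Icc (i * δ) ((i + 1) * δ)) (Icc 0 δ) :=
    fun t ht => ⟨sub_nonneg.2 ht.1, by linarith [ht.2]⟩
  have hderiv (i : ℕ) {t : ℝ} (ht : t ∈ Icc (i * δ) ((i + 1) * δ)) :
      HasDerivWithinAt (c i) (F (c i t)) (Icc (i * δ) ((i + 1) * δ)) t := by
    exact one_smul ℝ (F (c i t)) ▸ (hS (z i) _ (hmaps i ht)).scomp t
      ((hasDerivWithinAt_id t _).sub_const (i * δ)) (hmaps i)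
  refine ⟨concatCurves δ c, ?_, continuousOn_concatCurves hδ hc
    fun i t ht => (hderiv i ht).continuousWithinAt, fun t ht => ?_⟩
  · simp only [concatCurves, c, z, zero_div, Nat.floor_zero, Nat.cast_zero, zero_mul, sub_zero,
      hS0, Function.iterate_zero_apply]
  · have hmem := mem_Ico_floor_div_mul hδ ht
    exact hasDerivWithinAt_concatCurves hδ hc ht
      ((hderiv _ (Ico_subset_Icc_self hmem)).mono_of_mem_nhdsWithin
        (mem_of_superset (Icc_mem_nhdsGE hmem.2) (Icc_subset_Icc_left hmem.1)))

theorem hasDerivWithinAt_Ici_of_right {y y' : ℝ → E} {a : ℝ} (hy : ContinuousOn y (Ici a))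
    (hy' : ContinuousOn y' (Ici a))
    (hderiv : ∀ t, a ≤ t → HasDerivWithinAt y (y' t) (Ici t) t) {t : ℝ} (ht : a ≤ t) :
    HasDerivWithinAt y (y' t) (Ici a) t := by
  have hcont : Continuous fun s => y' (max s a) :=
    hy'.comp_continuous (by fun_prop) fun s => mem_Ici.2 (le_max_right s a)
  have hftc : ∀ s ∈ Ici a, y s = y a + ∫ u in a..s, y' (max u a) := by
    intro s hs
    rw [intervalIntegral.integral_eq_sub_of_hasDeriv_right_of_le hs
      (hy.mono Icc_subset_Ici_self) (fun u hu => ?_) (hcont.intervalIntegrable a s),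
      add_sub_cancel]
    rw [max_eq_left hu.1.le]
    exact (hderiv u hu.1.le).mono Ioi_subset_Ici_self
  have hint : HasDerivAt (fun s => y a + ∫ u in a..s, y' (max u a)) (y' (max t a)) t :=
    (intervalIntegral.integral_hasDerivAt_right (hcont.intervalIntegrable a t)
      (hcont.stronglyMeasurableAtFilter _ _) hcont.continuousAt).const_add (y a)
  rw [max_eq_left ht] at hint
  exact hint.hasDerivWithinAt.congr hftc (hftc t ht)

end ODE

section ODEFlow

variable {d : ℕ} {F : EuclideanSpace ℝ (Fin d) → EuclideanSpace ℝ (Fin d)} {L : ℝ≥0}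
  {ν ν' : EuclideanSpace ℝ (Fin d)} {y y' : ℝ → EuclideanSpace ℝ (Fin d)}

theorem exists_isODESolution (hF : LipschitzWith L F) (ν : EuclideanSpace ℝ (Fin d)) :
    ∃ y, IsODESolution F ν y := by
  obtain ⟨y, hy0, hcont, hderiv⟩ := exists_right_solution hF ν
  exact ⟨y, hy0, fun t ht =>
    hasDerivWithinAt_Ici_of_right hcont (hF.continuous.comp_continuousOn hcont) hderiv ht⟩

theorem IsODESolution.continuousOn (hy : IsODESolution F ν y) : ContinuousOn y (Ici 0) :=
  fun t ht => (hy.2 t ht).continuousWithinAt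

theorem IsODESolution.hasDerivWithinAt_Ici (hy : IsODESolution F ν y) {t : ℝ} (ht : 0 ≤ t) :
    HasDerivWithinAt y (F (y t)) (Ici t) t :=
  (hy.2 t ht).mono (Ici_subset_Ici.2 ht)

theorem IsODESolution.dist_le (hF : LipschitzWith L F) (hy : IsODESolution F ν y)
    (hy' : IsODESolution F ν' y') {t : ℝ} (ht : 0 ≤ t) :
    dist (y t) (y' t) ≤ dist ν ν' * Real.exp (L * t) := by
  simpa only [sub_zero] using dist_le_of_trajectories_ODE (v := fun _ => F) (fun _ => hF)
    (hy.continuousOn.mono Icc_subset_Ici_self) (fun s hs => hy.hasDerivWithinAt_Ici hs.1)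
    (hy'.continuousOn.mono Icc_subset_Ici_self) (fun s hs => hy'.hasDerivWithinAt_Ici hs.1)
    (by rw [hy.1, hy'.1]) t ⟨ht, le_rfl⟩

variable {Θ : Type*} {f : Θ → EuclideanSpace ℝ (Fin d) → EuclideanSpace ℝ (Fin d)}

theorem isODESolution_odeFlow {θ : Θ} (hf : LipschitzWith L (f θ))
    (ν : EuclideanSpace ℝ (Fin d)) : IsODESolution (f θ) ν fun t => odeFlow f θ t ν := by
  have hex := exists_isODESolution hf ν
  simp only [odeFlow, dif_pos hex]
  exact hex.choose_spec

theorem isRegularFlow_odeFlow (hf : ∀ θ, ∃ L : ℝ≥0, LipschitzWith L (f θ)) :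
    IsRegularFlow (odeFlow f) where
  zero θ ν := by
    obtain ⟨L, hL⟩ := hf θ
    exact (isODESolution_odeFlow hL ν).1
  continuousOn θ ν := by
    obtain ⟨L, hL⟩ := hf θ
    exact (isODESolution_odeFlow hL ν).continuousOn
  measurable θ := by
    obtain ⟨L, hL⟩ := hf θ
    refine measurable_uncurry_of_continuous_of_measurable
      (u := fun (t : ℝ) ν => odeFlow f θ (max t 0) ν) (fun ν => ?_) fun t => ?_
    · exact (isODESolution_odeFlow hL ν).continuousOn.comp_continuous (by fun_prop)
        fun t => mem_Ici.2 (le_max_right t 0)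
    · have hlip : LipschitzWith (Real.exp (L * max t 0)).toNNReal fun ν =>
          odeFlow f θ (max t 0) ν := by
        refine LipschitzWith.of_dist_le_mul fun ν ν' => ?_
        rw [Real.coe_toNNReal _ (Real.exp_nonneg _), mul_comm]
        exact (isODESolution_odeFlow hL ν).dist_le hL (isODESolution_odeFlow hL ν')
          (le_max_right t 0)
      exact hlip.continuous.measurable

theorem hasVelocity_odeFlow (hf : ∀ θ, ∃ L : ℝ≥0, LipschitzWith L (f θ)) :
    HasVelocity (odeFlow f) fun θ t ν => f θ (odeFlow f θ t ν) where
  hasDerivWithinAt θ ν t ht := by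
    obtain ⟨L, hL⟩ := hf θ
    exact ((isODESolution_odeFlow hL ν).hasDerivWithinAt_Ici ht).mono Ioi_subset_Ici_self
  intervalIntegrable θ ν t ht := by
    obtain ⟨L, hL⟩ := hf θ
    refine ContinuousOn.intervalIntegrable (hL.continuous.comp_continuousOn
      ((isODESolution_odeFlow hL ν).continuousOn.mono ?_))
    rw [uIcc_of_le ht]
    exact Icc_subset_Ici_self

end ODEFlow

section EulerFlow

variable {d : ℕ} {Θ : Type*} {f : Θ → EuclideanSpace ℝ (Fin d) → EuclideanSpace ℝ (Fin d)} {h : ℝ}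

/-- The line followed by the Euler polygon on its `i`-th edge. -/
def eulerEdge (F : EuclideanSpace ℝ (Fin d) → EuclideanSpace ℝ (Fin d)) (h : ℝ)
    (ν : EuclideanSpace ℝ (Fin d)) (i : ℕ) (t : ℝ) : EuclideanSpace ℝ (Fin d) :=
  eulerSeq F h ν i + (t - i * h) • F (eulerSeq F h ν i)

theorem eulerFlow_eq_concatCurves (θ : Θ) (ν : EuclideanSpace ℝ (Fin d)) :
    (fun t => eulerFlow f h θ t ν) = concatCurves h (eulerEdge (f θ) h ν) :=
  rfl

variable {F : EuclideanSpace ℝ (Fin d) → EuclideanSpace ℝ (Fin d)}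

theorem eulerEdge_succ (ν : EuclideanSpace ℝ (Fin d)) (i : ℕ) :
    eulerEdge F h ν i ((i + 1) * h) = eulerEdge F h ν (i + 1) ((i + 1) * h) := by
  simp only [eulerEdge, eulerSeq, Nat.cast_add_one, sub_self, zero_smul, add_zero, add_one_mul,
    add_sub_cancel_left]

theorem hasDerivAt_eulerEdge (ν : EuclideanSpace ℝ (Fin d)) (i : ℕ) (t : ℝ) :
    HasDerivAt (eulerEdge F h ν i) (F (eulerSeq F h ν i)) t :=
  one_smul ℝ (F (eulerSeq F h ν i)) ▸ (((hasDerivAt_id t).sub_const (i * h)).smul_const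
    (F (eulerSeq F h ν i))).const_add (eulerSeq F h ν i)

theorem continuous_eulerSeq (hF : Continuous F) (i : ℕ) : Continuous fun ν => eulerSeq F h ν i := by
  induction i with
  | zero => exact continuous_id
  | succ i ih => exact ih.add ((hF.comp ih).const_smul h)

theorem continuous_eulerEdge (hF : Continuous F) (i : ℕ) :
    Continuous fun z : ℝ × EuclideanSpace ℝ (Fin d) => eulerEdge F h z.2 i z.1 :=
  have hseq := (continuous_eulerSeq (h := h) hF i).comp continuous_snd
  hseq.add ((continuous_fst.sub continuous_const).smul (hF.comp hseq))

theorem eulerFlow_mul (hh : 0 < h) (θ : Θ) (ν : EuclideanSpace ℝ (Fin d)) (i : ℕ) :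
    eulerFlow f h θ (i * h) ν = eulerSeq (f θ) h ν i := by
  rw [eulerFlow]
  simp only [mul_div_cancel_right₀ _ hh.ne', Nat.floor_natCast, sub_self, zero_smul, add_zero]

theorem isRegularFlow_eulerFlow (hh : 0 < h) (hf : ∀ θ, Continuous (f θ)) :
    IsRegularFlow (eulerFlow f h) where
  zero θ ν := by
    simpa only [Nat.cast_zero, zero_mul, eulerSeq] using eulerFlow_mul (f := f) hh θ ν 0
  continuousOn θ ν := by
    rw [eulerFlow_eq_concatCurves]
    exact continuousOn_concatCurves hh (eulerEdge_succ ν)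
      fun i t _ => (hasDerivAt_eulerEdge ν i t).continuousAt.continuousWithinAt
  measurable θ := by
    have hedge : Measurable fun z : ℕ × ℝ × EuclideanSpace ℝ (Fin d) =>
        eulerEdge (f θ) h z.2.2 z.1 z.2.1 :=
      measurable_from_prod_countable_right fun i => (continuous_eulerEdge (hf θ) i).measurable
    have hfloor : Measurable fun z : ℝ × EuclideanSpace ℝ (Fin d) => ⌊max z.1 0 / h⌋₊ :=
      Nat.measurable_floor.comp (by fun_prop)
    exact hedge.comp (hfloor.prodMk (by fun_prop :
      Measurable fun z : ℝ × EuclideanSpace ℝ (Fin d) => (max z.1 0, z.2)))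

theorem intervalIntegrable_comp_floor_div {E : Type*} [NormedAddCommGroup E] (u : ℕ → E)
    (hh : 0 ≤ h) {t : ℝ} (ht : 0 ≤ t) :
    IntervalIntegrable (fun s => u ⌊s / h⌋₊) volume 0 t := by
  have hmeas : StronglyMeasurable fun s : ℝ => u ⌊s / h⌋₊ :=
    (StronglyMeasurable.of_discrete (f := u)).comp_measurable
      (Nat.measurable_floor.comp (by fun_prop))
  refine (intervalIntegrable_const (c := ∑ i ∈ Finset.range (⌊t / h⌋₊ + 1), ‖u i‖)).mono_fun
    hmeas.aestronglyMeasurable (ae_restrict_of_forall_mem measurableSet_uIoc fun s hs => ?_)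
  rw [uIoc_of_le ht] at hs
  have hfloor : ⌊s / h⌋₊ ≤ ⌊t / h⌋₊ := Nat.floor_mono (div_le_div_of_nonneg_right hs.2 hh)
  exact (Finset.single_le_sum (f := fun i => ‖u i‖) (fun i _ => norm_nonneg _)
    (Finset.mem_range_succ_iff.2 hfloor)).trans (Real.le_norm_self _)

theorem hasVelocity_eulerFlow (hh : 0 < h) :
    HasVelocity (eulerFlow f h) fun θ t ν => f θ (eulerSeq (f θ) h ν ⌊t / h⌋₊) where
  hasDerivWithinAt θ ν t ht := by
    rw [eulerFlow_eq_concatCurves]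
    exact (hasDerivWithinAt_concatCurves hh (eulerEdge_succ ν) ht
      (hasDerivAt_eulerEdge ν _ t).hasDerivWithinAt).mono Ioi_subset_Ici_self
  intervalIntegrable θ ν _ ht :=
    intervalIntegrable_comp_floor_div (fun i => f θ (eulerSeq (f θ) h ν i)) hh.le ht

variable [MeasurableSpace Θ] {C : JumpCharacteristics Θ d} {x₀ : State Θ d} {w : NoisePath}
  {g : ℝ → State Θ d → ℝ}

theorem jumpIndex_gridTime {Φ : FlowFamily Θ d} (hw : w.IsCounting) (hh : 0 < h) {s : ℝ}
    (hs : 0 ≤ s) :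
    jumpIndex C Φ x₀ w (gridTime C Φ x₀ w h s) = jumpIndex C Φ x₀ w s := by
  obtain ⟨k, hk⟩ := hw.exists_mem_Ico hs
  have hanchor := (anchor_fst_le (C := C) (Φ := Φ) (x₀ := x₀) hw k).trans hk.1
  rw [jumpIndex_eq hw ⟨hanchor, hk.2⟩]
  refine jumpIndex_eq hw ?_
  rw [gridTime, lastJump_eq hw hk]
  refine ⟨le_add_of_nonneg_right (by positivity), lt_of_le_of_lt ?_ hk.2⟩
  linarith [(mem_Ico_floor_div_mul hh (sub_nonneg.2 hanchor)).1]

theorem process_gridTime (hw : w.IsCounting) (hh : 0 < h) {s : ℝ} (hs : 0 ≤ s) :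
    process C (eulerFlow f h) x₀ w (gridTime C (eulerFlow f h) x₀ w h s) =
      ((process C (eulerFlow f h) x₀ w s).1,
        eulerSeq (f (process C (eulerFlow f h) x₀ w s).1) h
          (postJump C (eulerFlow f h) x₀ w (jumpIndex C (eulerFlow f h) x₀ w s)).2
          ⌊(s - lastJump C (eulerFlow f h) x₀ w s) / h⌋₊) := by
  have hindex := jumpIndex_gridTime (C := C) (Φ := eulerFlow f h) (x₀ := x₀) hw hh hs
  have hlast : lastJump C (eulerFlow f h) x₀ w (gridTime C (eulerFlow f h) x₀ w h s) =
      lastJump C (eulerFlow f h) x₀ w s := by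
    rw [lastJump, hindex, lastJump]
  rw [process]
  simp only [hlast, hindex]
  rw [gridTime, add_sub_cancel_left, eulerFlow_mul hh]
  rfl

theorem driftAlong_eulerFlow_add_opS (hw : w.IsCounting) (hh : 0 < h) {s : ℝ} (hs : 0 ≤ s) :
    driftAlong C (eulerFlow f h) (fun θ t ν => f θ (eulerSeq (f θ) h ν ⌊t / h⌋₊)) x₀ w g s +
      opS C g s (process C (eulerFlow f h) x₀ w s) =
    opAbar C f g s (process C (eulerFlow f h) x₀ w s)
      (process C (eulerFlow f h) x₀ w (gridTime C (eulerFlow f h) x₀ w h s)) := by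
  rw [opAbar, opTbar, process_gridTime hw hh hs, driftAlong]

end EulerFlow

section ItoFormulas

variable {Θ : Type*} [TopologicalSpace Θ] [DiscreteTopology Θ] [MeasurableSpace Θ]
  [DiscreteMeasurableSpace Θ] [Countable Θ] {d : ℕ} {C : JumpCharacteristics Θ d}
  {f : Θ → EuclideanSpace ℝ (Fin d) → EuclideanSpace ℝ (Fin d)} {x₀ : State Θ d} {w : NoisePath}
  {g : ℝ → State Θ d → ℝ}

theorem ito_odeFlow (hw : w.IsCounting) (hf : ∀ θ, ∃ L : ℝ≥0, LipschitzWith L (f θ))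
    (hg : IsC1 g) (hg' : IsBoundedMeasurable g) {t : ℝ} (ht : 0 ≤ t) :
    IntervalIntegrable (fun s => opA C f g s (process C (odeFlow f) x₀ w s)) volume 0 t ∧
      g t (process C (odeFlow f) x₀ w t) = g 0 x₀ +
        (∫ s in (0 : ℝ)..t, opA C f g s (process C (odeFlow f) x₀ w s)) +
          martingalePart C (odeFlow f) x₀ w g t :=
  ito_path hw (isRegularFlow_odeFlow hf) (hasVelocity_odeFlow hf) hg hg' ht

theorem ito_eulerFlow (hw : w.IsCounting) (hf : ∀ θ, Continuous (f θ)) {h : ℝ} (hh : 0 < h)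
    (hg : IsC1 g) (hg' : IsBoundedMeasurable g) {t : ℝ} (ht : 0 ≤ t) :
    IntervalIntegrable (fun s => opAbar C f g s (process C (eulerFlow f h) x₀ w s)
        (process C (eulerFlow f h) x₀ w (gridTime C (eulerFlow f h) x₀ w h s))) volume 0 t ∧
      g t (process C (eulerFlow f h) x₀ w t) = g 0 x₀ +
        (∫ s in (0 : ℝ)..t, opAbar C f g s (process C (eulerFlow f h) x₀ w s)
          (process C (eulerFlow f h) x₀ w (gridTime C (eulerFlow f h) x₀ w h s))) +
          martingalePart C (eulerFlow f h) x₀ w g t := by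
  obtain ⟨hint, heq⟩ := ito_path (C := C) (x₀ := x₀) hw (isRegularFlow_eulerFlow hh hf)
    (hasVelocity_eulerFlow hh) hg hg' ht
  refine ⟨hint.congr fun s hs => ?_, heq.trans ?_⟩
  · rw [uIoc_of_le ht] at hs
    exact driftAlong_eulerFlow_add_opS hw hh hs.1.le
  · congr 2
    refine intervalIntegral.integral_congr fun s hs => ?_
    rw [uIcc_of_le ht] at hs
    exact driftAlong_eulerFlow_add_opS hw hh hs.1

end ItoFormulas

end PDMP

end

open PDMP in
theorem theorem4_general {Θ : Type*} [TopologicalSpace Θ] [DiscreteTopology Θ] [MeasurableSpace Θ]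
    [BorelSpace Θ] {d : ℕ} {Ω : Type*} {mΩ : MeasurableSpace Ω} (P : Measure Ω)
    [IsProbabilityMeasure P]
    (C : JumpCharacteristics Θ d)
    (W : Ω → NoisePath) (hW : IsThinningNoise P C.bound W)
    (f : Θ → EuclideanSpace ℝ (Fin d) → EuclideanSpace ℝ (Fin d))
    (hf : ∀ θ, ∃ L : ℝ≥0, LipschitzWith L (f θ))
    (h : ℝ) (hh : 0 < h) (x : State Θ d)
    (g : ℝ → State Θ d → ℝ) (hg : IsC1 g)
    (hg_bdd : ∃ K : ℝ, ∀ t, 0 ≤ t → ∀ x, |g t x| ≤ K) :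
    ((∀ ω, ∀ t : ℝ, 0 ≤ t →
        IntegrableOn (jumpIntegrand C (odeFlow f) x (W ω) g) (Ioc 0 t ×ˢ univ)
          (jumpMeasure C (odeFlow f) x (W ω)) ∧
        IntegrableOn (jumpIntegrand C (odeFlow f) x (W ω) g) (Ioc 0 t ×ˢ univ)
          (compensator C (odeFlow f) x (W ω)) ∧
        IntervalIntegrable (fun s => opA C f g s (process C (odeFlow f) x (W ω) s)) volume 0 t ∧
        g t (process C (odeFlow f) x (W ω) t) =
          g 0 x + (∫ s in (0 : ℝ)..t, opA C f g s (process C (odeFlow f) x (W ω) s)) +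
            martingalePart C (odeFlow f) x (W ω) g t) ∧
      ∃ ℱ : Filtration ℝ≥0 mΩ,
        (∀ t : ℝ≥0, ℱ t = jumpSigma C (odeFlow f) x W t) ∧
        Martingale (fun (t : ℝ≥0) ω => martingalePart C (odeFlow f) x (W ω) g t) ℱ P) ∧
    ((∀ ω, ∀ t : ℝ, 0 ≤ t →
        IntegrableOn (jumpIntegrand C (eulerFlow f h) x (W ω) g) (Ioc 0 t ×ˢ univ)
          (jumpMeasure C (eulerFlow f h) x (W ω)) ∧
        IntegrableOn (jumpIntegrand C (eulerFlow f h) x (W ω) g) (Ioc 0 t ×ˢ univ)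
          (compensator C (eulerFlow f h) x (W ω)) ∧
        IntervalIntegrable (fun s => opAbar C f g s (process C (eulerFlow f h) x (W ω) s)
          (process C (eulerFlow f h) x (W ω) (gridTime C (eulerFlow f h) x (W ω) h s))) volume 0 t ∧
        g t (process C (eulerFlow f h) x (W ω) t) =
          g 0 x + (∫ s in (0 : ℝ)..t, opAbar C f g s (process C (eulerFlow f h) x (W ω) s)
            (process C (eulerFlow f h) x (W ω) (gridTime C (eulerFlow f h) x (W ω) h s))) +
            martingalePart C (eulerFlow f h) x (W ω) g t) ∧
      ∃ ℱ : Filtration ℝ≥0 mΩ,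
        (∀ t : ℝ≥0, ℱ t = jumpSigma C (eulerFlow f h) x W t) ∧
        Martingale (fun (t : ℝ≥0) ω => martingalePart C (eulerFlow f h) x (W ω) g t) ℱ P) := by
  have := C.countable
  have : DiscreteMeasurableSpace Θ := ⟨fun s => (isOpen_discrete s).measurableSet⟩
  have hΦ := isRegularFlow_odeFlow hf
  have hcont : ∀ θ, Continuous (f θ) := fun θ => (hf θ).elim fun _ hL => hL.continuous
  have hΨ := isRegularFlow_eulerFlow hh hcont
  have hg' := hg.isBoundedMeasurable hg_bdd
  refine ⟨⟨fun ω t ht => ?_, exists_filtration_martingale hW hΦ hg'⟩,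
    fun ω t ht => ?_, exists_filtration_martingale hW hΨ hg'⟩
  · have hw := hW.isCounting ω
    exact ⟨integrableOn_jumpMeasure hw _, integrableOn_compensator hw hΦ hg' t,
      ito_odeFlow hw hf hg hg' ht⟩
  · have hw := hW.isCounting ω
    exact ⟨integrableOn_jumpMeasure hw _, integrableOn_compensator hw hΨ hg' t,
      ito_eulerFlow hw hcont hh hg hg' ht⟩

theorem theorem4 {Θ : Type*} [TopologicalSpace Θ] [DiscreteTopology Θ] [MeasurableSpace Θ]
    [BorelSpace Θ] {d : ℕ} {Ω : Type*} {mΩ : MeasurableSpace Ω} (P : Measure Ω)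
    [IsProbabilityMeasure P]
    (C : PDMP.JumpCharacteristics Θ d)
    (W : Ω → PDMP.NoisePath) (hW : PDMP.IsThinningNoise P C.bound W)
    (f : Θ → EuclideanSpace ℝ (Fin d) → EuclideanSpace ℝ (Fin d))
    (hf_bdd : ∀ θ, ∃ K : ℝ, ∀ ν, ‖f θ ν‖ ≤ K)
    (hf_lip : ∃ L : ℝ≥0, ∀ θ, LipschitzWith L (f θ))
    (h : ℝ) (hh : 0 < h) (x : PDMP.State Θ d)
    (g : ℝ → PDMP.State Θ d → ℝ) (hg : PDMP.IsBoundedC1 g) :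
    -- the piecewise deterministic Markov process
    ((∀ ω, ∀ t : ℝ, 0 ≤ t →
        IntegrableOn (PDMP.jumpIntegrand C (PDMP.odeFlow f) x (W ω) g) (Ioc 0 t ×ˢ univ)
          (PDMP.jumpMeasure C (PDMP.odeFlow f) x (W ω)) ∧
        IntegrableOn (PDMP.jumpIntegrand C (PDMP.odeFlow f) x (W ω) g) (Ioc 0 t ×ˢ univ)
          (PDMP.compensator C (PDMP.odeFlow f) x (W ω)) ∧
        IntervalIntegrable (fun s => PDMP.opA C f g s (PDMP.process C (PDMP.odeFlow f) x (W ω) s)) volume 0 t ∧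
        g t (PDMP.process C (PDMP.odeFlow f) x (W ω) t) =
          g 0 x + (∫ s in (0 : ℝ)..t, PDMP.opA C f g s (PDMP.process C (PDMP.odeFlow f) x (W ω) s)) +
            PDMP.martingalePart C (PDMP.odeFlow f) x (W ω) g t) ∧
      ∃ ℱ : Filtration ℝ≥0 mΩ,
        (∀ t : ℝ≥0, ℱ t = PDMP.jumpSigma C (PDMP.odeFlow f) x W t) ∧
        Martingale (fun (t : ℝ≥0) ω => PDMP.martingalePart C (PDMP.odeFlow f) x (W ω) g t) ℱ P) ∧
    -- its Euler approximation
    ((∀ ω, ∀ t : ℝ, 0 ≤ t →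
        IntegrableOn (PDMP.jumpIntegrand C (PDMP.eulerFlow f h) x (W ω) g) (Ioc 0 t ×ˢ univ)
          (PDMP.jumpMeasure C (PDMP.eulerFlow f h) x (W ω)) ∧
        IntegrableOn (PDMP.jumpIntegrand C (PDMP.eulerFlow f h) x (W ω) g) (Ioc 0 t ×ˢ univ)
          (PDMP.compensator C (PDMP.eulerFlow f h) x (W ω)) ∧
        IntervalIntegrable (fun s => PDMP.opAbar C f g s (PDMP.process C (PDMP.eulerFlow f h) x (W ω) s)
            (PDMP.process C (PDMP.eulerFlow f h) x (W ω) (PDMP.gridTime C (PDMP.eulerFlow f h) x (W ω) h s))) volume 0 t ∧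
        g t (PDMP.process C (PDMP.eulerFlow f h) x (W ω) t) =
          g 0 x + (∫ s in (0 : ℝ)..t, PDMP.opAbar C f g s (PDMP.process C (PDMP.eulerFlow f h) x (W ω) s)
            (PDMP.process C (PDMP.eulerFlow f h) x (W ω) (PDMP.gridTime C (PDMP.eulerFlow f h) x (W ω) h s))) +
            PDMP.martingalePart C (PDMP.eulerFlow f h) x (W ω) g t) ∧
      ∃ ℱ : Filtration ℝ≥0 mΩ,
        (∀ t : ℝ≥0, ℱ t = PDMP.jumpSigma C (PDMP.eulerFlow f h) x W t) ∧
        Martingale (fun (t : ℝ≥0) ω => PDMP.martingalePart C (PDMP.eulerFlow f h) x (W ω) g t) ℱ P) :=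
  theorem4_general P C W hW f (fun θ => hf_lip.imp fun _ hL => hL θ) h hh x g hg.contDiffOn
    hg.bounded
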